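/- Let $k\ge 1$ and $\mathbf n,\mathbf m\in\{1,2,\dots\}^k$. For each $i\in\{1,\dots,k\}$ let $q_i=\sum_\alpha a_{i,\alpha}Z_\alpha$ be a positive regular polynomial in $n_i$ noncommuting indeterminates: finitely many nonzero coefficients, indexed by words $\alpha\in\mathbb F_{n_i}^+$ (the free monoid on generators $g_1,\dots,g_{n_i}$), with $a_{i,\alpha}\ge 0$, zero constant term, and $a_{i,g_j}>0$ for $j=1,\dots,n_i$. For operators $X=(X_{i,j})$, $1\le i\le k$, $1\le j\le n_i$, on a complex Hilbert space $\mathcal H$, put $X_i:=(X_{i,1},\dots,X_{i,n_i})$, $X_{i,\alpha}:=X_{i,j_1}\cdots X_{i,j_p}$ for $\alpha=g_{j_1}\cdots g_{j_p}$, $\Phi_{q_i,X_i}(Y):=\sum_\alpha a_{i,\alpha}X_{i,\alpha}YX_{i,\alpha}^*$ and $\mathbf\Delta^{\mathbf p}_{\mathbf q,X}:=(id-\Phi_{q_1,X_1})^{p_1}\circ\cdots\circ(id-\Phi_{q_k,X_k})^{p_k}$. The polydomain $\mathbf D^{\mathbf m}_{\mathbf q}(\mathcal H)$ is the set of all $X$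 such that $X_{i,j}$ commutes with $X_{i',j'}$ whenever $i\ne i'$, and $\mathbf\Delta^{\mathbf p}_{\mathbf q,X}(I)\ge 0$ for all $\mathbf 0\le\mathbf p\le\mathbf m$. Let $F^2(H_n)$ be the full Fock space on $n$ generators, with orthonormal basis $(e_\alpha)_{\alpha\in\mathbb F_n^+}$, and let $\mathcal F:=F^2(H_{n_1})\otimes\cdots\otimes F^2(H_{n_k})$. The universal model $\mathbf W=(\mathbf W_{i,j})$ consists of the operators on $\mathcal F$ that act on the $i$-th tensor factor by $e_\alpha\mapsto\sqrt{b_{i,\alpha}/b_{i,g_j\alpha}}\;e_{g_j\alpha}$ and as the identity on the other factors, where $b_{i,\alpha}=1$ for the empty word and otherwise $$b_{i,\alpha}=\sum_{p=1}^{|\alpha|}\ \sum_{\gamma_1\cdots\gamma_p=\alpha,\ |\gamma_s|\ge1}a_{i,\gamma_1}\cdots a_{i,\gamma_p}\binom{p+m_i-1}{m_i-1}.$$ Let $C^*(\mathbf W)$ be the $C^*$-algebra generated by the $\mathbf W_{i,j}$ and the identity. For a $*$-representation $\pi$ of it write $\pi(\mathbf W_i):=(\pi(\mathbf W_{i,1}),\dots,\pi(\mathbf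 W_{i,n_i}))$ and $\pi(\mathbf W):=(\pi(\mathbf W_{i,j}))$. **(1) Dilation.** Let $\mathbf T=(T_{i,j})\in\mathbf D^{\mathbf m}_{\mathbf q}(\mathcal H)$ and $\mathcal D:=\overline{\mathbf\Delta^{\mathbf m}_{\mathbf q,\mathbf T}(I)\mathcal H}$. There are a Hilbert space $\mathcal K_\pi$, separable if $\mathcal H$ is separable, and a unital $*$-representation $\pi:C^*(\mathbf W)\to B(\mathcal K_\pi)$ which annihilates the compact operators and satisfies $$(id-\Phi_{q_1,\pi(\mathbf W_1)})\cdots(id-\Phi_{q_k,\pi(\mathbf W_k)})(I_{\mathcal K_\pi})=0,$$ such that, with $V_{i,j}:=(\mathbf W_{i,j}\otimes I_{\mathcal D})\oplus\pi(\mathbf W_{i,j})$ on $\tilde{\mathcal K}:=(\mathcal F\otimes\mathcal D)\oplus\mathcal K_\pi$, the space $\mathcal H$ can be identified, through a linear isometry $\mathcal H\to\tilde{\mathcal K}$, with a subspace of $\tilde{\mathcal K}$ that is - co-invariant: $V_{i,j}^*\mathcal H\subset\mathcal H$ for all $i,j$; - $*$-cyclic: $\tilde{\mathcal K}$ is the closed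 linear span of the vectors $Yh$, with $h\in\mathcal H$ and $Y$ in the $C^*$-algebra generated by the $V_{i,j}$ and the identity; and $T_{i,j}^*=V_{i,j}^*|_{\mathcal H}$ for all $i,j$. **(2) Wold decomposition.** Let $\pi:C^*(\mathbf W)\to B(\mathcal K)$ be a nondegenerate $*$-representation on a separable Hilbert space, let $\Delta_\pi:=\mathbf\Delta^{\mathbf m}_{\mathbf q,\pi(\mathbf W)}(I_{\mathcal K})$, and let $$\mathcal K_0:=\overline{\mathrm{span}}\{\pi(\mathbf W_{1,\alpha_1}\cdots\mathbf W_{k,\alpha_k})\Delta_\pi x:\ \alpha_i\in\mathbb F_{n_i}^+,\ x\in\mathcal K\},\qquad\mathcal K_1:=\mathcal K_0^\perp.$$ Then $\mathcal K_0$ and $\mathcal K_1$ are invariant under $\pi$, so that $\pi=\pi_0\oplus\pi_1$ on $\mathcal K_0\oplus\mathcal K_1$. The representations $\pi_0$ and $\pi_1$ are disjoint, that is, no nonzero subrepresentation of $\pi_0$ is unitarily equivalent to a subrepresentation of $\pi_1$. There is a Hilbert space $\mathcal G$ with $\dim\mathcal G=\dim\mathrm{range}\,\Delta_\pi$ (Hilbert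 space dimensions) such that $\pi_0$ is unitarily equivalent to $X\mapsto X\otimes I_{\mathcal G}$ on $\mathcal F\otimes\mathcal G$. Moreover, $\pi_1$ annihilates the compact operators and $$(id-\Phi_{q_1,\pi_1(\mathbf W_1)})\cdots(id-\Phi_{q_k,\pi_1(\mathbf W_k)})(I_{\mathcal K_1})=0.$$ **(3) Classification.** Let $\pi$ and $\pi'$ be nondegenerate $*$-representations of $C^*(\mathbf W)$ on separable Hilbert spaces, with decompositions $\pi=\pi_0\oplus\pi_1$ and $\pi'=\pi_0'\oplus\pi_1'$ as in (2), and let $\mathcal G,\mathcal G'$ be Hilbert spaces such that $\pi_0$ is unitarily equivalent to $X\mapsto X\otimes I_{\mathcal G}$ and $\pi_0'$ to $X\mapsto X\otimes I_{\mathcal G'}$. Then $\pi$ and $\pi'$ are unitarily equivalent if and only if $\dim\mathcal G=\dim\mathcal G'$ and $\pi_1$ and $\pi_1'$ are unitarily equivalent. -/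

import Mathlib

open scoped ENNReal TensorProduct

noncomputable section

namespace Polydomain

/-! ### Positive regular polynomials and the maps they induce -/

/-- A positive regular polynomial in `n` noncommuting indeterminates `Z_1, …, Z_n`.  A word
`g_{j_1} ⋯ g_{j_p}` of the free monoid on `n` generators is the list `[j_1, …, j_p]`, and a
noncommutative polynomial is the finitely supported family of its coefficients. -/
structure PosRegPoly (n : ℕ) where
  /-- the coefficient of each word -/
  coeff : List (Fin n) →₀ ℝ
  coeff_nonneg : ∀ α, 0 ≤ coeff α
  coeff_nil : coeff [] = 0
  coeff_letter_pos : ∀ j, 0 < coeff [j]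

/-- `X_α = X_{j_1} ⋯ X_{j_p}` for the word `α = [j_1, …, j_p]`. -/
def wordProd {A : Type*} [Monoid A] {n : ℕ} (X : Fin n → A) (α : List (Fin n)) : A :=
  (α.map X).prod

/-- `X_(α) = X_{1,α_1} ⋯ X_{k,α_k}` for a `k`-tuple of words. -/
def multiWordProd {A : Type*} [Monoid A] {k : ℕ} {n : Fin k → ℕ} (X : ∀ i, Fin (n i) → A)
    (α : ∀ i, List (Fin (n i))) : A :=
  (List.ofFn fun i => wordProd (X i) (α i)).prod

section Defect

variable {A : Type*} [Ring A] [StarRing A] [Algebra ℂ A]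

/-- `Φ_{q,X}(Y) = ∑_α a_α X_α Y X_α^*`. -/
def Phi {n : ℕ} (q : PosRegPoly n) (X : Fin n → A) : Module.End ℂ A :=
  ∑ α ∈ q.coeff.support, (q.coeff α : ℂ) •
    (LinearMap.mulLeft ℂ (wordProd X α) ∘ₗ LinearMap.mulRight ℂ (star (wordProd X α)))

theorem Phi_apply {n : ℕ} (q : PosRegPoly n) (X : Fin n → A) (Y : A) :
    Phi q X Y = ∑ α ∈ q.coeff.support,
      (q.coeff α : ℂ) • (wordProd X α * Y * star (wordProd X α)) := by
  simp [Phi, mul_assoc]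

/-- `Δ^p_{q,X} = (id - Φ_{q_1,X_1})^{p_1} ∘ ⋯ ∘ (id - Φ_{q_k,X_k})^{p_k}`. -/
def defect {k : ℕ} {n : Fin k → ℕ} (q : ∀ i, PosRegPoly (n i)) (p : Fin k → ℕ)
    (X : ∀ i, Fin (n i) → A) : Module.End ℂ A :=
  (List.ofFn fun i => (1 - Phi (q i) (X i)) ^ p i).prod

end Defect

/-- The noncommutative polydomain `D_q^m(H)`. -/
def polydomain {k : ℕ} {n : Fin k → ℕ} (q : ∀ i, PosRegPoly (n i)) (m : Fin k → ℕ)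
    (H : Type*) [NormedAddCommGroup H] [InnerProductSpace ℂ H] [CompleteSpace H] :
    Set (∀ i, Fin (n i) → (H →L[ℂ] H)) :=
  {X | (∀ i i', i ≠ i' → ∀ j j', Commute (X i j) (X i' j')) ∧
    ∀ p : Fin k → ℕ, (∀ i, p i ≤ m i) → (defect q p X 1).IsPositive}

/-! ### The universal model -/

/-- `F^2(H_{n_1}) ⊗ ⋯ ⊗ F^2(H_{n_k})`.  The full Fock space `F^2(H_n)` has the orthonormal basis
`e_α` indexed by words, so the tensor product has the orthonormal basis
`e_{α_1} ⊗ ⋯ ⊗ e_{α_k}` indexed by `k`-tuples of words; it is realised as the `ℓ²` space over this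
index set, where that basis vector is `lp.single 2 α 1`. -/
abbrev Fock {k : ℕ} (n : Fin k → ℕ) : Type :=
  lp (fun _ : ∀ i, List (Fin (n i)) => ℂ) 2

/-- The coefficient `b_α^{(m)}`: the sum over all factorisations `α = γ_1 ⋯ γ_p` into nonempty
words of `a_{γ_1} ⋯ a_{γ_p} * binom (p + m - 1) (m - 1)`.  For the empty word only the empty
factorisation occurs, and `b = 1`. -/
def bCoeff {n : ℕ} (q : PosRegPoly n) (m : ℕ) (α : List (Fin n)) : ℝ :=
  ∑ c : Composition α.length,
    ((α.splitWrtComposition c).map q.coeff).prod * ((c.length + m - 1).choose (m - 1) : ℝ)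

theorem prod_coeff_nonneg {n : ℕ} (q : PosRegPoly n) (L : List (List (Fin n))) :
    0 ≤ (L.map q.coeff).prod :=
  List.prod_nonneg fun x hx => by
    obtain ⟨γ, _, rfl⟩ := List.mem_map.1 hx
    exact q.coeff_nonneg γ

theorem bCoeff_nonneg {n : ℕ} (q : PosRegPoly n) (m : ℕ) (α : List (Fin n)) :
    0 ≤ bCoeff q m α :=
  Finset.sum_nonneg fun _ _ => mul_nonneg (prod_coeff_nonneg q _) (Nat.cast_nonneg _)

theorem bCoeff_nil {n : ℕ} (q : PosRegPoly n) (m : ℕ) : bCoeff q m [] = 1 := by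
  have h : (Finset.univ : Finset (Composition ([] : List (Fin n)).length)) =
      {Composition.ones 0} := by
    have : Subsingleton (Composition ([] : List (Fin n)).length) :=
      Fintype.card_le_one_iff_subsingleton.1 (by rw [composition_card]; simp)
    ext c
    simpa using Subsingleton.elim c (Composition.ones 0)
  unfold bCoeff
  rw [h, Finset.sum_singleton]
  simp [List.splitWrtComposition, List.splitWrtCompositionAux, Composition.ones,
    Composition.length]

/-- Prepending a block of size one to a composition. -/
def consOne {l : ℕ} (c : Composition l) : Composition (l + 1) where
  blocks := 1 :: c.blocks
  blocks_pos := by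
    intro i hi
    rcases List.mem_cons.1 hi with rfl | hi
    · exact one_pos
    · exact c.blocks_pos hi
  blocks_sum := by simp [c.blocks_sum, add_comm]

theorem coeff_mul_bCoeff_le {n : ℕ} (q : PosRegPoly n) (m : ℕ) (j : Fin n) (α : List (Fin n)) :
    q.coeff [j] * bCoeff q m α ≤ bCoeff q m (j :: α) := by
  have hinj : Function.Injective (consOne : Composition α.length → Composition (α.length + 1)) := by
    intro c d h
    have := congrArg Composition.blocks h
    exact Composition.ext (by simpa [consOne] using this)
  unfold bCoeff
  rw [Finset.mul_sum]
  calc _ ≤ ∑ c : Composition α.length,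
        (((j :: α).splitWrtComposition (consOne c)).map q.coeff).prod *
          (((consOne c).length + m - 1).choose (m - 1) : ℝ) := by
        refine Finset.sum_le_sum fun c _ => ?_
        have h1 : (j :: α).splitWrtComposition (consOne c) =
            [j] :: α.splitWrtComposition c := by
          simp [List.splitWrtComposition, consOne, List.splitWrtCompositionAux]
        have h2 : (consOne c).length = c.length + 1 := by
          simp [consOne, Composition.length]
        rw [h1, h2, List.map_cons, List.prod_cons, ← mul_assoc]
        refine mul_le_mul_of_nonneg_left ?_
          (mul_nonneg (q.coeff_nonneg _) (prod_coeff_nonneg q _))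
        exact_mod_cast Nat.choose_le_choose _ (by omega)
    _ = ∑ c ∈ Finset.univ.map ⟨consOne, hinj⟩,
        (((j :: α).splitWrtComposition c).map q.coeff).prod *
          ((c.length + m - 1).choose (m - 1) : ℝ) := by
        rw [Finset.sum_map]; rfl
    _ ≤ _ := by
        refine Finset.sum_le_sum_of_subset_of_nonneg (Finset.subset_univ _) fun _ _ _ => ?_
        exact mul_nonneg (prod_coeff_nonneg q _) (Nat.cast_nonneg _)

theorem bCoeff_pos {n : ℕ} (q : PosRegPoly n) (m : ℕ) (α : List (Fin n)) :
    0 < bCoeff q m α := by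
  induction α with
  | nil => rw [bCoeff_nil]; exact one_pos
  | cons j α ih =>
    exact lt_of_lt_of_le (mul_pos (q.coeff_letter_pos j) ih) (coeff_mul_bCoeff_le q m j α)

/-- The weight `√(b_α) / √(b_{g_j α})`. -/
def weight {n : ℕ} (q : PosRegPoly n) (m : ℕ) (j : Fin n) (α : List (Fin n)) : ℝ :=
  √(bCoeff q m α) / √(bCoeff q m (j :: α))

theorem abs_weight_le {n : ℕ} (q : PosRegPoly n) (m : ℕ) (j : Fin n) (α : List (Fin n)) :
    |weight q m j α| ≤ √(1 / q.coeff [j]) := by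
  have hb := bCoeff_pos q m (j :: α)
  have ha := q.coeff_letter_pos j
  rw [weight, abs_of_nonneg (by positivity), ← Real.sqrt_div (bCoeff_nonneg q m α)]
  refine Real.sqrt_le_sqrt ?_
  rw [div_le_div_iff₀ hb ha]
  have := coeff_mul_bCoeff_le q m j α
  linarith

section WeightedShift

variable {A B : Type*}

theorem summable_weighted (w : A → ℝ) (C : ℝ) (hw : ∀ a, |w a| ≤ C) (σ : A → B)
    (hσ : Function.Injective σ) (f : lp (fun _ : B => ℂ) 2) :
    Summable (fun a => ‖(w a : ℂ) * f (σ a)‖ ^ 2) ∧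
      ∑' a, ‖(w a : ℂ) * f (σ a)‖ ^ 2 ≤ C ^ 2 * ‖f‖ ^ 2 := by
  have hf : Summable fun b => ‖f b‖ ^ 2 := by
    simpa using (lp.memℓp f).summable (by norm_num)
  have hle : ∀ a, ‖(w a : ℂ) * f (σ a)‖ ^ 2 ≤ C ^ 2 * ‖f (σ a)‖ ^ 2 := fun a => by
    rw [norm_mul, mul_pow, Complex.norm_real, Real.norm_eq_abs]
    gcongr
    exact hw a
  have hs : Summable fun a => C ^ 2 * ‖f (σ a)‖ ^ 2 := (hf.comp_injective hσ).mul_left _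
  have hsum : Summable fun a => ‖(w a : ℂ) * f (σ a)‖ ^ 2 :=
    Summable.of_nonneg_of_le (fun _ => by positivity) hle hs
  refine ⟨hsum, (hsum.tsum_le_tsum hle hs).trans ?_⟩
  rw [tsum_mul_left]
  refine mul_le_mul_of_nonneg_left ?_ (sq_nonneg C)
  have h2 : ‖f‖ ^ 2 = ∑' b, ‖f b‖ ^ 2 := by
    simpa using lp.norm_rpow_eq_tsum (p := 2) (by norm_num) f
  rw [h2]
  exact (hf.comp_injective hσ).tsum_le_tsum_of_inj σ hσ (fun _ _ => by positivity)
    (fun _ => le_rfl) hf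

/-- The bounded operator `f ↦ (a ↦ w a * f (σ a))` between `ℓ²` spaces, for bounded weights `w`
and an injective map `σ`. -/
def weightedPullback (w : A → ℝ) (C : ℝ) (hw : ∀ a, |w a| ≤ C) (σ : A → B)
    (hσ : Function.Injective σ) : lp (fun _ : B => ℂ) 2 →L[ℂ] lp (fun _ : A => ℂ) 2 :=
  LinearMap.mkContinuous
    { toFun := fun f => ⟨fun a => (w a : ℂ) * f (σ a),
        memℓp_gen (by simpa using (summable_weighted w C hw σ hσ f).1)⟩
      map_add' := fun f g => by ext a; exact mul_add _ _ _
      map_smul' := fun c f => by ext a; simp; ring } |C|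
    (fun f => by
      refine lp.norm_le_of_tsum_le (by norm_num) (by positivity) ?_
      simpa [mul_pow] using (summable_weighted w C hw σ hσ f).2)

@[simp] theorem weightedPullback_apply (w : A → ℝ) (C : ℝ) (hw : ∀ a, |w a| ≤ C) (σ : A → B)
    (hσ : Function.Injective σ) (f : lp (fun _ : B => ℂ) 2) (a : A) :
    weightedPullback w C hw σ hσ f a = (w a : ℂ) * f (σ a) := rfl

/-- The weighted shift `e_a ↦ w a • e_{σ a}`, as the adjoint of the weighted pullback. -/
def weightedShift (w : A → ℝ) (C : ℝ) (hw : ∀ a, |w a| ≤ C) (σ : A → B)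
    (hσ : Function.Injective σ) : lp (fun _ : A => ℂ) 2 →L[ℂ] lp (fun _ : B => ℂ) 2 :=
  ContinuousLinearMap.adjoint (weightedPullback w C hw σ hσ)

theorem weightedShift_single [DecidableEq A] [DecidableEq B] (w : A → ℝ) (C : ℝ)
    (hw : ∀ a, |w a| ≤ C) (σ : A → B) (hσ : Function.Injective σ) (a : A) :
    weightedShift w C hw σ hσ (lp.single 2 a (1 : ℂ)) =
      (w a : ℂ) • lp.single 2 (σ a) (1 : ℂ) := by
  refine ext_inner_right ℂ fun f => ?_
  rw [weightedShift, ContinuousLinearMap.adjoint_inner_left, inner_smul_left,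
    lp.inner_single_left, lp.inner_single_left]
  simp [mul_comm]

end WeightedShift

section Model

variable {k : ℕ} {n : Fin k → ℕ}

/-- Replace the `i`-th word `α_i` by `g_j α_i`. -/
def prepend (i : Fin k) (j : Fin (n i)) (α : ∀ i, List (Fin (n i))) : ∀ i, List (Fin (n i)) :=
  Function.update α i (j :: α i)

theorem prepend_injective (i : Fin k) (j : Fin (n i)) :
    Function.Injective (prepend i j : (∀ i, List (Fin (n i))) → _) := by
  intro α β h
  funext l
  have hl := congrFun h l
  by_cases hli : l = i
  · subst hli
    simpa [prepend] using hl
  · simpa [prepend, Function.update_of_ne hli] using hl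

/-- The universal model `W_{i,j} = I ⊗ ⋯ ⊗ I ⊗ W_{i,j} ⊗ I ⊗ ⋯ ⊗ I`, where the `i`-th tensor
factor is the weighted left creation operator `e_α ↦ (√(b_α) / √(b_{g_j α})) e_{g_j α}`. -/
def model (q : ∀ i, PosRegPoly (n i)) (m : Fin k → ℕ) (i : Fin k) (j : Fin (n i)) :
    Fock n →L[ℂ] Fock n :=
  weightedShift (fun α => weight (q i) (m i) j (α i)) (√(1 / (q i).coeff [j]))
    (fun α => abs_weight_le (q i) (m i) j (α i)) (prepend i j) (prepend_injective i j)

theorem model_single (q : ∀ i, PosRegPoly (n i)) (m : Fin k → ℕ) (i : Fin k) (j : Fin (n i))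
    (α : ∀ i, List (Fin (n i))) :
    model q m i j (lp.single 2 α (1 : ℂ)) =
      ((√(bCoeff (q i) (m i) (α i)) / √(bCoeff (q i) (m i) (j :: α i)) : ℝ) : ℂ) •
        lp.single 2 (Function.update α i (j :: α i)) (1 : ℂ) :=
  weightedShift_single _ _ _ _ _ α

/-- The `C^*`-algebra generated by a tuple of operators and the identity. -/
def cstarOf {E : Type*} [NormedAddCommGroup E] [InnerProductSpace ℂ E] [CompleteSpace E]
    (X : ∀ i, Fin (n i) → (E →L[ℂ] E)) : StarSubalgebra ℂ (E →L[ℂ] E) :=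
  (StarAlgebra.adjoin ℂ {Y | ∃ i j, Y = X i j}).topologicalClosure

theorem mem_cstarOf {E : Type*} [NormedAddCommGroup E] [InnerProductSpace ℂ E] [CompleteSpace E]
    (X : ∀ i, Fin (n i) → (E →L[ℂ] E)) (i : Fin k) (j : Fin (n i)) : X i j ∈ cstarOf X :=
  StarSubalgebra.le_topologicalClosure _ (StarAlgebra.subset_adjoin ℂ _ ⟨i, j, rfl⟩)

/-- `C^*(W_{i,j})`. -/
abbrev CstarW (q : ∀ i, PosRegPoly (n i)) (m : Fin k → ℕ) : Type := cstarOf (model q m)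

/-- `W_{i,j}` as an element of `C^*(W_{i,j})`. -/
def genW (q : ∀ i, PosRegPoly (n i)) (m : Fin k → ℕ) (i : Fin k) (j : Fin (n i)) : CstarW q m :=
  ⟨model q m i j, mem_cstarOf (model q m) i j⟩

/-- A map on `C^*(W_{i,j})` vanishes at the compact operators. -/
def AnnihilatesCompacts {q : ∀ i, PosRegPoly (n i)} {m : Fin k → ℕ} {B : Type*} [Zero B]
    (π : CstarW q m → B) : Prop :=
  ∀ X : CstarW q m, IsCompactOperator (X : Fock n →L[ℂ] Fock n) → π X = 0

end Model

/-! ### Hilbert tensor products, direct sums, Hilbert dimension -/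

/-- The Hilbert space tensor product: the completion of the algebraic tensor product with
`⟪x ⊗ y, x' ⊗ y'⟫ = ⟪x, x'⟫ * ⟪y, y'⟫`. -/
abbrev HTensor (E F : Type*) [NormedAddCommGroup E] [InnerProductSpace ℂ E]
    [NormedAddCommGroup F] [InnerProductSpace ℂ F] : Type _ :=
  UniformSpace.Completion (E ⊗[ℂ] F)

/-- The operator `X ⊗ I_G`. -/
def ampliation {E : Type*} [NormedAddCommGroup E] [InnerProductSpace ℂ E] (X : E →L[ℂ] E)
    (G : Type*) [NormedAddCommGroup G] [InnerProductSpace ℂ G] :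
    HTensor E G →L[ℂ] HTensor E G :=
  (X.rTensor G).completion

theorem ampliation_tmul {E : Type*} [NormedAddCommGroup E] [InnerProductSpace ℂ E]
    (X : E →L[ℂ] E) (G : Type*) [NormedAddCommGroup G] [InnerProductSpace ℂ G] (x : E) (g : G) :
    ampliation X G ((x ⊗ₜ[ℂ] g : E ⊗[ℂ] G) : HTensor E G) =
      ((X x ⊗ₜ[ℂ] g : E ⊗[ℂ] G) : HTensor E G) := by
  simp [ampliation]

/-- The direct sum of two operators on the Hilbert direct sum. -/
def directSum {E F : Type*} [NormedAddCommGroup E] [InnerProductSpace ℂ E]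
    [NormedAddCommGroup F] [InnerProductSpace ℂ F] (X : E →L[ℂ] E) (Y : F →L[ℂ] F) :
    WithLp 2 (E × F) →L[ℂ] WithLp 2 (E × F) :=
  (WithLp.prodContinuousLinearEquiv 2 ℂ E F).symm.toContinuousLinearMap ∘L
    (X.prodMap Y) ∘L (WithLp.prodContinuousLinearEquiv 2 ℂ E F).toContinuousLinearMap

theorem directSum_apply {E F : Type*} [NormedAddCommGroup E] [InnerProductSpace ℂ E]
    [NormedAddCommGroup F] [InnerProductSpace ℂ F] (X : E →L[ℂ] E) (Y : F →L[ℂ] F) (x : E)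
    (y : F) : directSum X Y (WithLp.toLp 2 (x, y)) = WithLp.toLp 2 (X x, Y y) := rfl

/-- The Hilbert space dimension: the cardinality of an orthonormal basis. -/
def hilbertDim (E : Type*) [NormedAddCommGroup E] [InnerProductSpace ℂ E] : Cardinal :=
  sInf {κ | ∃ s : Set E, Orthonormal ℂ ((↑) : s → E) ∧
    (Submodule.span ℂ s).topologicalClosure = ⊤ ∧ κ = Cardinal.mk s}

/-! ### The dilation -/

section Dilation

variable {k : ℕ} {n : Fin k → ℕ} (q : ∀ i, PosRegPoly (n i)) (m : Fin k → ℕ)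

/-- The closure of `Δ^m_{q,T}(I) H`. -/
abbrev defectSpace {H : Type*} [NormedAddCommGroup H] [InnerProductSpace ℂ H] [CompleteSpace H]
    (T : ∀ i, Fin (n i) → (H →L[ℂ] H)) : Submodule ℂ H :=
  (LinearMap.range (defect q m T 1 : H →L[ℂ] H).toLinearMap).topologicalClosure

/-- `V_{i,j} = (W_{i,j} ⊗ I_D) ⊕ π(W_{i,j})`. -/
def dilation (D : Type*) [NormedAddCommGroup D] [InnerProductSpace ℂ D]
    {K : Type*} [NormedAddCommGroup K] [InnerProductSpace ℂ K]
    (π : CstarW q m → (K →L[ℂ] K)) (i : Fin k) (j : Fin (n i)) :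
    WithLp 2 (HTensor (Fock n) D × K) →L[ℂ] WithLp 2 (HTensor (Fock n) D × K) :=
  directSum (ampliation (model q m i j) D) (π (genW q m i j))

end Dilation

/-- A subspace `M` of `K` is `*`-cyclic for a tuple `X` if `K` is the closed span of the vectors
`Y h` with `Y` in the `C^*`-algebra generated by `X` and the identity, and `h` in `M`. -/
def IsStarCyclic {k : ℕ} {n : Fin k → ℕ} {K : Type*} [NormedAddCommGroup K]
    [InnerProductSpace ℂ K] [CompleteSpace K] (X : ∀ i, Fin (n i) → (K →L[ℂ] K))
    (M : Submodule ℂ K) : Prop :=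
  (Submodule.span ℂ {x | ∃ Y ∈ cstarOf X, ∃ h ∈ M, x = Y h}).topologicalClosure = ⊤

/-! ### Representations -/

section Representations

variable {𝒜 : Type*} [NonUnitalRing 𝒜] [Module ℂ 𝒜] [Star 𝒜]
variable {K : Type*} [NormedAddCommGroup K] [InnerProductSpace ℂ K] [CompleteSpace K]
variable {K' : Type*} [NormedAddCommGroup K'] [InnerProductSpace ℂ K'] [CompleteSpace K']

/-- A representation is nondegenerate if the vectors `π(X) x` span a dense subspace. -/
def Nondegenerate (π : 𝒜 →⋆ₙₐ[ℂ] (K →L[ℂ] K)) : Prop :=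
  (Submodule.span ℂ {y | ∃ X x, y = π X x}).topologicalClosure = ⊤

/-- The subspace `M` is invariant under all `π(X)`. -/
def InvariantUnder (π : 𝒜 →⋆ₙₐ[ℂ] (K →L[ℂ] K)) (M : Submodule ℂ K) : Prop :=
  ∀ X, ∀ x ∈ M, π X x ∈ M

/-- The restriction of a representation to an invariant closed subspace. -/
def subrep (π : 𝒜 →⋆ₙₐ[ℂ] (K →L[ℂ] K)) (M : Submodule ℂ K) [CompleteSpace M]
    (hM : InvariantUnder π M) : 𝒜 →⋆ₙₐ[ℂ] (M →L[ℂ] M) where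
  toFun X := ((π X).comp M.subtypeL).codRestrict M fun x => hM X x x.2
  map_smul' c X := by
    ext x
    change π (c • X) x = c • π X x
    rw [map_smul]
    rfl
  map_zero' := by
    ext x
    change π 0 x = 0
    rw [map_zero]
    rfl
  map_add' X Y := by
    ext x
    change π (X + Y) x = π X x + π Y x
    rw [map_add]
    rfl
  map_mul' X Y := by
    ext x
    change π (X * Y) x = π X (π Y x)
    rw [map_mul]
    rfl
  map_star' X := by
    rw [ContinuousLinearMap.star_eq_adjoint, ContinuousLinearMap.eq_adjoint_iff]
    intro x y
    change inner ℂ (π (star X) x : K) (y : K) = inner ℂ (x : K) (π X y)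
    rw [map_star, ContinuousLinearMap.star_eq_adjoint, ContinuousLinearMap.adjoint_inner_left]

@[simp] theorem coe_subrep_apply (π : 𝒜 →⋆ₙₐ[ℂ] (K →L[ℂ] K)) (M : Submodule ℂ K)
    [CompleteSpace M] (hM : InvariantUnder π M) (X : 𝒜) (x : M) :
    (subrep π M hM X x : K) = π X x := rfl

/-- Unitary equivalence of operator-valued maps on `𝒜`. -/
def UnitarilyEquivalent {𝒜 K K' : Type*} [NormedAddCommGroup K] [InnerProductSpace ℂ K]
    [NormedAddCommGroup K'] [InnerProductSpace ℂ K']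
    (π : 𝒜 → (K →L[ℂ] K)) (π' : 𝒜 → (K' →L[ℂ] K')) : Prop :=
  ∃ U : K ≃ₗᵢ[ℂ] K', ∀ X x, U (π X x) = π' X (U x)

/-- Two representations are disjoint if no nonzero subrepresentation of the first is unitarily
equivalent to a subrepresentation of the second. -/
def AreDisjoint (π : 𝒜 →⋆ₙₐ[ℂ] (K →L[ℂ] K)) (π' : 𝒜 →⋆ₙₐ[ℂ] (K' →L[ℂ] K')) : Prop :=
  ∀ (M : Submodule ℂ K) (M' : Submodule ℂ K') [CompleteSpace M] [CompleteSpace M']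
    (hM : InvariantUnder π M) (hM' : InvariantUnder π' M'),
    UnitarilyEquivalent ⇑(subrep π M hM) ⇑(subrep π' M' hM') → M = ⊥

end Representations

section Wold

/-- The map `X ↦ X ⊗ I_G` on `C^*(W_{i,j})`. -/
def ampRep {k : ℕ} {n : Fin k → ℕ} (q : ∀ i, PosRegPoly (n i)) (m : Fin k → ℕ)
    (G : Type*) [NormedAddCommGroup G] [InnerProductSpace ℂ G] :
    CstarW q m → (HTensor (Fock n) G →L[ℂ] HTensor (Fock n) G) :=
  fun X => ampliation (X : Fock n →L[ℂ] Fock n) G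

variable {k : ℕ} {n : Fin k → ℕ} {q : ∀ i, PosRegPoly (n i)} {m : Fin k → ℕ}
variable {K : Type*} [NormedAddCommGroup K] [InnerProductSpace ℂ K] [CompleteSpace K]

variable (q m K) in
/-- The `*`-representations of `C^*(W_{i,j})` on `K`, not assumed to be unital. -/
abbrev RepW : Type _ := CstarW q m →⋆ₙₐ[ℂ] (K →L[ℂ] K)

/-- The tuple of the operators `π(W_{i,j})`. -/
def repTuple (π : RepW q m K) (i : Fin k) (j : Fin (n i)) : K →L[ℂ] K := π (genW q m i j)

/-- `Δ^m_{q,π(W)}(I_K)`. -/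
def repDefect (π : RepW q m K) : K →L[ℂ] K := defect q m (repTuple π) 1

/-- `K_0`, the closed span of the vectors `π(W_(α)) Δ^m_{q,π(W)}(I_K) x`. -/
abbrev woldSpace (π : RepW q m K) : Submodule ℂ K :=
  (Submodule.span ℂ {y | ∃ (α : ∀ i, List (Fin (n i))) (x : K),
    y = π (multiWordProd (genW q m) α) (repDefect π x)}).topologicalClosure

/-- `π_0`, the restriction of `π` to `K_0`. -/
def pureRep (π : RepW q m K) (h₀ : InvariantUnder π (woldSpace π)) : RepW q m (woldSpace π) :=
  subrep π (woldSpace π) h₀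

/-- `π_1`, the restriction of `π` to the orthogonal complement of `K_0`. -/
def residualRep (π : RepW q m K) (h₁ : InvariantUnder π (woldSpace π)ᗮ) :
    RepW q m ↥(woldSpace π)ᗮ :=
  subrep π (woldSpace π)ᗮ h₁

end Wold

end Polydomain

end

universe u v w

open Polydomain

/-! Everything about representations rests on the vacuum projection. On diagonal operators of the
Fock space, `1 - Φ_i` lowers by one the exponent in the coefficients of `(1 - q_i)^{-m_i}`
(`isDiag_one_sub_Phi_pow`), so `Δ^m(I)` of the model is the rank one projection `P` onto the vacuum
(`coe_vacProj`). Hence `C^*(W)` contains the operators `θ(ξ) : f ↦ ⟪e_∅, f⟫ ξ`, and `X θ(ξ) = θ(X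
ξ)`, `θ(ξ)^* θ(η) = ⟪ξ, η⟫ P`.

Under a representation `π` these relations say that `ξ ⊗ g ↦ π(θ(ξ)) g`, for `g` in the range of
`π(P)`, is an isometry onto `K_0` intertwining `X ⊗ I` with `π(X)` (`exists_wold_equiv`). On `K_0^⊥`
the projection `P` acts as zero, hence so does whatever is a norm limit of its compressions by
finite coordinate projections: the compact operators, and `Δ^{(1,…,1)}(I)` of the model, which is
diagonal with entries tending to zero. Disjointness holds because the `θ(ξ)^*` act as zero on
`K_0^⊥` and have no common null vector in `K_0`; the multiplicity space is recovered as the range of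
`P ⊗ I`.

For the dilation it is enough to find a representation `ρ` and an isometry `J` of `H` with `ρ(W)^* J
= J T^*` and `ρ(C^*(W)) J H` total (`exists_cyclic_representation`). The Wold decomposition of `ρ`
is then the required one, since `Δ_T^{1/2} h ↦ ρ(P) J h` extends to a unitary from `D` onto the
range of `ρ(P)`.

To construct `ρ`, replace every `q_i` by `s q_i` with `s < 1`. The tuple `T` still satisfies the
positivity conditions, and `Φ_{s q_i}(I) ≤ s`, so Neumann series converge and the Poisson kernel
`κ_s h = ∑ √b_α e_α ⊗ Δ^{1/2} T_α^* h` is an isometry intertwining `T^*` with the adjoint of the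
model `W^{(s)}` of `s q`. An ultrafilter limit of the inner products of the vectors `(X ⊗ I) κ_s h`
as `s → 1` yields `ρ` and `J`. The intertwining relation survives because `W^{(s)} → W` in norm.

This norm convergence (`exists_weight_scale_sub_le`) is the analytic core. The weights are
exponentials of differences `log b_α - log b_{gα}`, and the logarithmic derivative of `b_α` in `s`
is the expected number of factors of a random factorisation of `α`, divided by `s`. Adding one
letter changes this expectation by a bounded amount: up to a bounded error it becomes an average of
its values at the last few suffixes, with a definite weight on the nearest one, and such an
averaging sequence has bounded oscillation on windows (`osc_le_of_averaging`). -/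

noncomputable section

namespace Polydomain

/-! ### Factorisations of words -/

section Series

variable {n : ℕ}

/-- The sum, over all factorisations of a word into `p` nonempty words, of the products of the
coefficients of the factors. -/
def facCoeff (q : PosRegPoly n) : ℕ → List (Fin n) → ℝ
  | 0, α => if α = [] then 1 else 0
  | p + 1, α => ∑ l ∈ Finset.range α.length,
      q.coeff (α.take (l + 1)) * facCoeff q p (α.drop (l + 1))

theorem facCoeff_zero (q : PosRegPoly n) (α : List (Fin n)) :
    facCoeff q 0 α = if α = [] then 1 else 0 := rfl

theorem facCoeff_succ (q : PosRegPoly n) (p : ℕ) (α : List (Fin n)) :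
    facCoeff q (p + 1) α = ∑ l ∈ Finset.range α.length,
      q.coeff (α.take (l + 1)) * facCoeff q p (α.drop (l + 1)) := rfl

theorem facCoeff_nonneg (q : PosRegPoly n) (p : ℕ) (α : List (Fin n)) : 0 ≤ facCoeff q p α := by
  induction p generalizing α with
  | zero => rw [facCoeff_zero]; split_ifs <;> norm_num
  | succ p ih =>
    exact Finset.sum_nonneg fun l _ => mul_nonneg (q.coeff_nonneg _) (ih _)

theorem facCoeff_eq_zero_of_length_lt (q : PosRegPoly n) (p : ℕ) (α : List (Fin n))
    (h : α.length < p) : facCoeff q p α = 0 := by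
  induction p generalizing α with
  | zero => omega
  | succ p ih =>
    refine Finset.sum_eq_zero fun l hl => ?_
    have := Finset.mem_range.1 hl
    rw [ih _ (by rw [List.length_drop]; omega), mul_zero]

theorem facCoeff_eq_zero_of_lt_length (q : PosRegPoly n) {d : ℕ}
    (hd : ∀ γ, q.coeff γ ≠ 0 → γ.length ≤ d) (p : ℕ) (α : List (Fin n))
    (h : p * d < α.length) : facCoeff q p α = 0 := by
  induction p generalizing α with
  | zero =>
    rw [facCoeff_zero, if_neg]
    rintro rfl
    simp at h
  | succ p ih =>
    refine Finset.sum_eq_zero fun l hl => ?_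
    have hl := Finset.mem_range.1 hl
    by_cases hc : q.coeff (α.take (l + 1)) = 0
    · rw [hc, zero_mul]
    · have := hd _ hc
      rw [List.length_take] at this
      rw [ih _ (by rw [List.length_drop]; rw [Nat.succ_mul] at h; omega), mul_zero]

/-- Splitting off the first block is a bijection. The summand is a function of block lists, since
compositions of different totals have different types. -/
theorem sum_composition_succ {M : Type*} [AddCommMonoid M] (N : ℕ) (F : List ℕ → M) :
    ∑ c : Composition (N + 1), F c.blocks =
      ∑ l ∈ Finset.range (N + 1), ∑ c : Composition (N - l), F ((l + 1) :: c.blocks) := by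
  rw [Finset.sum_sigma']
  symm
  refine Finset.sum_bij (fun x hx => ⟨(x.1 + 1) :: x.2.blocks, ?_, ?_⟩) ?_ ?_ ?_ ?_
  · intro i hi
    rcases List.mem_cons.1 hi with rfl | hi
    · omega
    · exact x.2.blocks_pos hi
  · have := Finset.mem_range.1 (Finset.mem_sigma.1 hx).1
    rw [List.sum_cons, x.2.blocks_sum]
    omega
  · exact fun _ _ => Finset.mem_univ _
  · rintro ⟨l, c⟩ _ ⟨l', c'⟩ _ h
    have h := congrArg Composition.blocks h
    simp only [List.cons.injEq, add_left_inj] at h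
    obtain ⟨rfl, h⟩ := h
    rw [Composition.ext h]
  · intro c _
    obtain ⟨blocks, hpos, hsum⟩ := c
    cases blocks with
    | nil => simp at hsum
    | cons b bs =>
      have hb : 0 < b := hpos (by simp)
      rw [List.sum_cons] at hsum
      refine ⟨⟨b - 1, ⟨bs, fun hi => hpos (by simp [hi]), by omega⟩⟩, ?_, ?_⟩
      · simp; omega
      · apply Composition.ext
        simp; omega
  · exact fun _ _ => rfl

/-- Peeling off the first factor shifts `f` by one, so the induction on the length needs arbitrary
`f`. The result turns `bCoeff` into a sum over the number of factors, which obeys recursions. -/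
theorem sum_composition_eq_sum_facCoeff (q : PosRegPoly n) (f : ℕ → ℝ) (α : List (Fin n)) :
    ∑ c : Composition α.length,
      ((α.splitWrtCompositionAux c.blocks).map q.coeff).prod * f c.blocks.length =
      ∑ p ∈ Finset.range (α.length + 1), f p * facCoeff q p α := by
  induction hN : α.length using Nat.strong_induction_on generalizing α f with
  | _ N ih =>
  cases N with
  | zero =>
    obtain rfl : α = [] := List.length_eq_zero_iff.1 hN
    have h : (Finset.univ : Finset (Composition 0)) = {Composition.ones 0} := by
      have : Subsingleton (Composition 0) :=
        Fintype.card_le_one_iff_subsingleton.1 (by rw [composition_card]; simp)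
      ext c
      simpa using Subsingleton.elim c (Composition.ones 0)
    rw [h, Finset.sum_singleton]
    simp [List.splitWrtCompositionAux, Composition.ones, facCoeff_zero]
  | succ N =>
    rw [sum_composition_succ N (fun b =>
      ((α.splitWrtCompositionAux b).map q.coeff).prod * f b.length),
      Finset.sum_range_succ' (fun p => f p * facCoeff q p α)]
    have h0 : facCoeff q 0 α = 0 := by
      rw [facCoeff_zero, if_neg]
      rintro rfl
      simp at hN
    rw [h0, mul_zero, add_zero]
    simp only [facCoeff_succ, hN, Finset.mul_sum]
    rw [Finset.sum_comm]
    refine Finset.sum_congr rfl fun l hl => ?_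
    have hl := Finset.mem_range.1 hl
    have hlen : (α.drop (l + 1)).length = N - l := by rw [List.length_drop]; omega
    have key := ih (N - l) (by omega) (fun p => f (p + 1)) (α.drop (l + 1)) hlen
    simp only [List.splitWrtCompositionAux_cons, List.map_cons, List.prod_cons, List.length_cons,
      mul_assoc, ← Finset.mul_sum]
    rw [key, Finset.mul_sum]
    have hsub : Finset.range (N - l + 1) ⊆ Finset.range (N + 1) := by
      intro x; simp; omega
    rw [Finset.sum_subset hsub]
    · exact Finset.sum_congr rfl fun p _ => by ring
    · intro p _ hp
      rw [facCoeff_eq_zero_of_length_lt, mul_zero, mul_zero]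
      rw [hlen]
      simpa using hp

/-- The coefficients of `(1 - q)^{-m}`, for every `m`. -/
def serCoeff (q : PosRegPoly n) (m : ℕ) (α : List (Fin n)) : ℝ :=
  ∑ p ∈ Finset.range (α.length + 1), (m.multichoose p : ℝ) * facCoeff q p α

/-- The case `m = 0` must be excluded: by truncated subtraction the binomial in `bCoeff` would be
`1` for every `p`, while `Nat.multichoose 0 p` vanishes for `p > 0`. -/
theorem bCoeff_eq_serCoeff (q : PosRegPoly n) {m : ℕ} (hm : 1 ≤ m) (α : List (Fin n)) :
    bCoeff q m α = serCoeff q m α := by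
  have := sum_composition_eq_sum_facCoeff q
    (fun p => ((p + m - 1).choose (m - 1) : ℝ)) α
  refine Eq.trans this (Finset.sum_congr rfl fun p _ => ?_)
  rw [Nat.multichoose_eq, ← Nat.choose_symm_of_eq_add (show m + p - 1 = (m - 1) + p by omega),
    add_comm p m]

/-- A weighted sum over the number of factors may be extended. -/
theorem sum_range_facCoeff (q : PosRegPoly n) (f : ℕ → ℝ) (α : List (Fin n)) {N : ℕ}
    (hN : α.length ≤ N) :
    ∑ p ∈ Finset.range (N + 1), f p * facCoeff q p α =
      ∑ p ∈ Finset.range (α.length + 1), f p * facCoeff q p α := by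
  refine (Finset.sum_subset (by intro x; simp; omega) fun p _ hp => ?_).symm
  rw [facCoeff_eq_zero_of_length_lt, mul_zero]
  simpa using hp

/-- Splitting off the first factor. -/
theorem sum_succ_mul_facCoeff (q : PosRegPoly n) (f : ℕ → ℝ) (α : List (Fin n)) :
    ∑ p ∈ Finset.range α.length, f p * facCoeff q (p + 1) α =
      ∑ l ∈ Finset.range α.length, q.coeff (α.take (l + 1)) *
        ∑ p ∈ Finset.range ((α.drop (l + 1)).length + 1), f p * facCoeff q p (α.drop (l + 1)) := by
  simp only [facCoeff_succ, Finset.mul_sum]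
  rw [Finset.sum_comm]
  refine Finset.sum_congr rfl fun l hl => ?_
  have hl := Finset.mem_range.1 hl
  have h := sum_range_facCoeff q f (α.drop (l + 1)) (N := α.length - 1)
    (by rw [List.length_drop]; omega)
  rw [show α.length - 1 + 1 = α.length by omega] at h
  rw [← Finset.mul_sum, ← h, Finset.mul_sum]
  exact Finset.sum_congr rfl fun p _ => by ring

theorem serCoeff_zero (q : PosRegPoly n) (α : List (Fin n)) :
    serCoeff q 0 α = if α = [] then 1 else 0 := by
  rw [serCoeff, Finset.sum_range_succ']
  simp [facCoeff_zero]

theorem serCoeff_nil (q : PosRegPoly n) (m : ℕ) : serCoeff q m [] = 1 := by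
  simp [serCoeff, facCoeff_zero]

theorem serCoeff_nonneg (q : PosRegPoly n) (m : ℕ) (α : List (Fin n)) : 0 ≤ serCoeff q m α :=
  Finset.sum_nonneg fun _ _ => mul_nonneg (Nat.cast_nonneg _) (facCoeff_nonneg _ _ _)

/-- The coefficients of `(1 - q)^{-m-1} = (1 - q)^{-m} + q (1 - q)^{-m-1}`, obtained from Pascal's
rule for `multichoose`. Both the averaging recursion for expected lengths and the action of `1 - Φ`
on diagonal operators come from it. -/
theorem serCoeff_succ (q : PosRegPoly n) (m : ℕ) (α : List (Fin n)) :
    serCoeff q (m + 1) α = serCoeff q m α + ∑ l ∈ Finset.range α.length,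
      q.coeff (α.take (l + 1)) * serCoeff q (m + 1) (α.drop (l + 1)) := by
  have h := sum_succ_mul_facCoeff q (fun p => ((m + 1).multichoose p : ℝ)) α
  simp only [serCoeff]
  rw [← h, Finset.sum_range_succ', Finset.sum_range_succ' (fun p => (m.multichoose p : ℝ) * _)]
  simp only [Nat.multichoose_succ_succ, Nat.multichoose_zero_right, Nat.cast_add, add_mul,
    Finset.sum_add_distrib]
  ring

theorem serCoeff_succ_pos (q : PosRegPoly n) (m : ℕ) (α : List (Fin n)) :
    0 < serCoeff q (m + 1) α := by
  rw [← bCoeff_eq_serCoeff q (Nat.succ_pos m)]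
  exact bCoeff_pos _ _ _

theorem serCoeff_le_succ (q : PosRegPoly n) (m : ℕ) (α : List (Fin n)) :
    serCoeff q m α ≤ serCoeff q (m + 1) α := by
  rw [serCoeff_succ]
  exact le_add_of_nonneg_right <| Finset.sum_nonneg fun l _ =>
    mul_nonneg (q.coeff_nonneg _) (serCoeff_nonneg _ _ _)

theorem coeff_mul_serCoeff_le (q : PosRegPoly n) (m : ℕ) (j : Fin n) (α : List (Fin n)) :
    q.coeff [j] * serCoeff q (m + 1) α ≤ serCoeff q (m + 1) (j :: α) := by
  rw [← bCoeff_eq_serCoeff q (Nat.succ_pos m), ← bCoeff_eq_serCoeff q (Nat.succ_pos m)]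
  exact coeff_mul_bCoeff_le _ _ _ _

theorem mul_multichoose_succ (m p : ℕ) :
    m * (m + 1).multichoose p = (m + p) * m.multichoose p := by
  cases m with
  | zero => cases p <;> simp
  | succ m =>
    have h := Nat.add_one_mul_choose_eq (m + p) m
    rw [Nat.multichoose_eq, Nat.multichoose_eq,
      ← Nat.choose_symm_of_eq_add (show m + 1 + 1 + p - 1 = (m + 1) + p by omega),
      ← Nat.choose_symm_of_eq_add (show m + 1 + p - 1 = m + p by omega),
      show m + 1 + 1 + p - 1 = m + p + 1 by omega, show m + 1 + p - 1 = m + p by omega, mul_comm]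
    rw [← h]
    ring

/-- The coefficients of `(1 - q)^{-m}` are small compared with those of `(1 - q)^{-m-1}`, at long
words. -/
theorem length_mul_serCoeff_le (q : PosRegPoly n) {d : ℕ}
    (hd : ∀ γ, q.coeff γ ≠ 0 → γ.length ≤ d) (m : ℕ) (α : List (Fin n)) :
    (α.length : ℝ) * serCoeff q m α ≤ d * m * serCoeff q (m + 1) α := by
  simp only [serCoeff, Finset.mul_sum]
  refine Finset.sum_le_sum fun p _ => ?_
  by_cases hp : p * d < α.length
  · rw [facCoeff_eq_zero_of_lt_length q hd p α hp]; simp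
  -- A nonzero term has `|α| ≤ p d`, and the identity `m * (m+1).multichoose p = (m+p) *
  -- m.multichoose p` trades the factor `p` for `m` while raising the exponent.
  · have h1 : (m : ℝ) * (m + 1).multichoose p = (m + p) * m.multichoose p := by
      exact_mod_cast mul_multichoose_succ m p
    have h2 : (α.length : ℝ) ≤ p * d := by exact_mod_cast not_lt.1 hp
    have h3 := facCoeff_nonneg q p α
    have h4 : (0 : ℝ) ≤ m.multichoose p := Nat.cast_nonneg _
    have h5 : (0 : ℝ) ≤ d * m := by positivity
    calc (α.length : ℝ) * (m.multichoose p * facCoeff q p α)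
        ≤ (p * d) * (m.multichoose p * facCoeff q p α) := by gcongr
      _ ≤ (p * d) * (m.multichoose p * facCoeff q p α) +
          d * m * (m.multichoose p * facCoeff q p α) := le_add_of_nonneg_right (by positivity)
      _ = d * m * ((m + 1).multichoose p * facCoeff q p α) := by
          linear_combination (-(d : ℝ) * facCoeff q p α) * h1

end Series

/-! ### Sequences that are nearly averages of their predecessors -/

/-- The bound `M` on the current window deteriorates by at most `C` per step, while the gap `M - x
t` below it is passed on with a factor `δ` per step, because each new value puts weight `δ` on its
predecessor. -/
theorem le_of_averaging {x : ℕ → ℝ} {N d : ℕ} {δ C : ℝ} (hδ : 0 ≤ δ) (hC : 0 ≤ C)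
    (hx : ∀ t < N, ∀ M, (∀ i ≤ t, t < i + d → x i ≤ M) → x (t + 1) ≤ δ * x t + (1 - δ) * M + C)
    {t : ℕ} {M : ℝ} (hM : ∀ i ≤ t, t < i + d → x i ≤ M) (ht : x t ≤ M) (s : ℕ)
    (hs : t + s ≤ N) :
    x (t + s) ≤ M - δ ^ s * (M - x t) + s * C := by
  induction s using Nat.strong_induction_on with
  | _ s ih =>
  cases s with
  | zero => simp
  | succ s =>
    have h1 : ∀ i ≤ t + s, t + s < i + d → x i ≤ M + s * C := by
      intro i hi hid
      rcases le_or_gt i t with hit | hit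
      · have := hM i hit (by omega)
        have : 0 ≤ s * C := by positivity
        linarith [hM i hit (by omega)]
      · obtain ⟨r, rfl⟩ := Nat.exists_eq_add_of_le hit.le
        have h2 := ih r (by omega) (by omega)
        have h3 : (r : ℝ) * C ≤ s * C := by
          gcongr
          omega
        have h4 : 0 ≤ δ ^ r * (M - x t) := mul_nonneg (by positivity) (by linarith)
        linarith
    have h2 := hx (t + s) (by omega) _ h1
    have h3 := mul_le_mul_of_nonneg_left (ih s (by omega) (by omega)) hδ
    rw [← add_assoc, pow_succ]
    push_cast
    linarith

/-- Compare a window with the one `d` steps earlier, with maximum `x a`, minimum `x b` and last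
value `x r`. By `le_of_averaging` and its mirror image, the new values lie below `x a - δ^d (x a - x
r) + d C` and above `x b + δ^d (x r - x b) - d C`. So the oscillation is multiplied by at most `1 -
δ^d`, plus `2 d C`; the asserted bound is stable under this, and it holds at the start because `0 ≤
x t ≤ t`. -/
theorem osc_le_of_averaging {x : ℕ → ℝ} {N d : ℕ} {δ C : ℝ} (hδ : 0 < δ) (hδ1 : δ ≤ 1)
    (hC : 0 ≤ C) (hd : 1 ≤ d)
    (hx : ∀ t < N, ∀ M, (∀ i ≤ t, t < i + d → x i ≤ M) → x (t + 1) ≤ δ * x t + (1 - δ) * M + C)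
    (hx' : ∀ t < N, ∀ M, (∀ i ≤ t, t < i + d → M ≤ x i) → δ * x t + (1 - δ) * M - C ≤ x (t + 1))
    (h0 : ∀ t, 0 ≤ x t) (h1 : ∀ t, t ≤ N → x t ≤ t) (t : ℕ) (ht : t ≤ N) :
    ∀ i ≤ t, t < i + d → ∀ j ≤ t, t < j + d → x i - x j ≤ 2 * d + 2 * d * C / δ ^ d := by
  induction t using Nat.strong_induction_on with
  | _ t ih =>
  intro i hi hid j hj hjd
  have hpos : 0 ≤ 2 * d * C / δ ^ d := by positivity
  rcases lt_or_ge t (2 * d) with htd | htd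
  · have h2 := h1 i (hi.trans ht)
    have h3 : (i : ℝ) ≤ 2 * d := by exact_mod_cast (by omega : i ≤ 2 * d)
    linarith [h0 j]
  obtain ⟨r, rfl⟩ := Nat.exists_eq_add_of_le (show d ≤ t by omega)
  rw [add_comm d r] at *
  let S := (Finset.range (r + 1)).filter (fun i => r < i + d)
  have hS : S.Nonempty := ⟨r, by simp [S]; omega⟩
  have hmem : ∀ i, i ∈ S ↔ i ≤ r ∧ r < i + d := by intro i; simp [S]
  obtain ⟨a, ha, hmax⟩ := S.exists_max_image x hS
  obtain ⟨b, hb, hmin⟩ := S.exists_min_image x hS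
  have hr : r ∈ S := (hmem r).2 ⟨le_rfl, by omega⟩
  have hosc := ih r (by omega) (by omega) a ((hmem a).1 ha).1 ((hmem a).1 ha).2 b
    ((hmem b).1 hb).1 ((hmem b).1 hb).2
  obtain ⟨u, rfl⟩ := Nat.exists_eq_add_of_le (show r ≤ i by omega)
  obtain ⟨v, rfl⟩ := Nat.exists_eq_add_of_le (show r ≤ j by omega)
  have hu := le_of_averaging hδ.le hC hx (M := x a)
    (fun i hi hid => hmax i ((hmem i).2 ⟨hi, hid⟩)) (hmax r hr) u (by omega)
  have hv := le_of_averaging (x := fun i => -x i) (N := N) (d := d) hδ.le hC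
    (fun t ht M hM => by
      have := hx' t ht (-M) (fun i hi hid => by linarith [hM i hi hid])
      linarith) (M := - x b)
    (fun i hi hid => neg_le_neg (hmin i ((hmem i).2 ⟨hi, hid⟩))) (neg_le_neg (hmin r hr)) v
    (by omega)
  have hpu : δ ^ d ≤ δ ^ u := pow_le_pow_of_le_one hδ.le hδ1 (by omega)
  have hpv : δ ^ d ≤ δ ^ v := pow_le_pow_of_le_one hδ.le hδ1 (by omega)
  have huC : (u : ℝ) * C ≤ d * C := by gcongr; omega
  have hvC : (v : ℝ) * C ≤ d * C := by gcongr; omega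
  have hau := mul_le_mul_of_nonneg_right hpu (sub_nonneg.2 (hmax r hr))
  have hav := mul_le_mul_of_nonneg_right hpv (sub_nonneg.2 (hmin r hr))
  have hδd : 0 < δ ^ d := by positivity
  have hδd1 : δ ^ d ≤ 1 := pow_le_one₀ hδ.le hδ1
  have hfin := mul_le_mul_of_nonneg_left hosc (sub_nonneg.2 hδd1)
  have hcancel : δ ^ d * (2 * d * C / δ ^ d) = 2 * d * C := by field_simp
  have : 0 ≤ δ ^ d * (2 * d) := by positivity
  nlinarith

/-! ### The expected number of factors -/

section Expected

variable {n : ℕ}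

/-- The number of factors, summed over all factorisations with the weights of `serCoeff`. -/
def lenCoeff (q : PosRegPoly n) (m : ℕ) (α : List (Fin n)) : ℝ :=
  ∑ p ∈ Finset.range (α.length + 1), ((p : ℝ) * m.multichoose p) * facCoeff q p α

theorem lenCoeff_nonneg (q : PosRegPoly n) (m : ℕ) (α : List (Fin n)) : 0 ≤ lenCoeff q m α :=
  Finset.sum_nonneg fun _ _ => mul_nonneg (by positivity) (facCoeff_nonneg _ _ _)

theorem lenCoeff_le (q : PosRegPoly n) (m : ℕ) (α : List (Fin n)) :
    lenCoeff q m α ≤ α.length * serCoeff q m α := by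
  rw [lenCoeff, serCoeff, Finset.mul_sum]
  refine Finset.sum_le_sum fun p hp => ?_
  rw [mul_assoc]
  have hp : (p : ℝ) ≤ α.length := by
    exact_mod_cast Nat.lt_succ_iff.1 (Finset.mem_range.1 hp)
  exact mul_le_mul_of_nonneg_right hp (mul_nonneg (Nat.cast_nonneg _) (facCoeff_nonneg _ _ _))

/-- The analogue of `serCoeff_succ` with factors counted: the split-off factor adds one to the count
of the rest, whence the extra `serCoeff`. -/
theorem lenCoeff_succ (q : PosRegPoly n) (m : ℕ) (α : List (Fin n)) :
    lenCoeff q (m + 1) α = lenCoeff q m α + ∑ l ∈ Finset.range α.length,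
      q.coeff (α.take (l + 1)) * (lenCoeff q (m + 1) (α.drop (l + 1)) +
        serCoeff q (m + 1) (α.drop (l + 1))) := by
  have h := sum_succ_mul_facCoeff q (fun p => ((p + 1 : ℝ) * (m + 1).multichoose p : ℝ)) α
  have h2 : ∀ β : List (Fin n), ∑ p ∈ Finset.range (β.length + 1),
      ((p + 1 : ℝ) * (m + 1).multichoose p : ℝ) * facCoeff q p β =
      lenCoeff q (m + 1) β + serCoeff q (m + 1) β := by
    intro β
    rw [lenCoeff, serCoeff, ← Finset.sum_add_distrib]
    exact Finset.sum_congr rfl fun p _ => by ring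
  simp only [h2] at h
  rw [← h, lenCoeff, lenCoeff, Finset.sum_range_succ',
    Finset.sum_range_succ' (fun p => ((p : ℝ) * m.multichoose p : ℝ) * _)]
  simp only [Nat.multichoose_succ_succ, Nat.cast_add, Nat.cast_zero, zero_mul, add_zero,
    Nat.cast_one]
  rw [← Finset.sum_add_distrib]
  exact Finset.sum_congr rfl fun p _ => by ring

/-- Each deleted letter may be restored as a factor of its own, of weight at least `c`. This makes
the coefficients of nearby suffixes comparable. -/
theorem pow_mul_serCoeff_drop_le (q : PosRegPoly n) {c : ℝ} (hc0 : 0 ≤ c)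
    (hc : ∀ j, c ≤ q.coeff [j]) (m : ℕ) (l : ℕ) (β : List (Fin n)) (hl : l ≤ β.length) :
    c ^ l * serCoeff q (m + 1) (β.drop l) ≤ serCoeff q (m + 1) β := by
  induction l generalizing β with
  | zero => simp
  | succ l ih =>
    cases β with
    | nil => simp at hl
    | cons j β =>
      have h := ih β (by simpa using hl)
      calc c ^ (l + 1) * serCoeff q (m + 1) ((j :: β).drop (l + 1))
          = c * (c ^ l * serCoeff q (m + 1) (β.drop l)) := by rw [List.drop_succ_cons]; ring
        _ ≤ c * serCoeff q (m + 1) β := by gcongr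
        _ ≤ q.coeff [j] * serCoeff q (m + 1) β :=
          mul_le_mul_of_nonneg_right (hc j) (serCoeff_nonneg _ _ _)
        _ ≤ _ := coeff_mul_serCoeff_le q m j β

/-- The expected number of factors of a random factorisation. -/
def expLen (q : PosRegPoly n) (m : ℕ) (α : List (Fin n)) : ℝ :=
  lenCoeff q m α / serCoeff q m α

/-- Conditioning on the first factor: the rest is a suffix of `β` with fewer than `d` letters
removed, so the expected length is an average over these suffixes. The errors are the split-off
factor itself and the terms with the lower exponent `m`, which `length_mul_serCoeff_le` controls. -/
theorem expLen_step (q : PosRegPoly n) {c C₀ : ℝ} {d : ℕ} (hc0 : 0 < c) (hc1 : c ≤ 1)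
    (hd1 : 1 ≤ d) (hC₀ : 0 < C₀)
    (hc : ∀ j, c ≤ q.coeff [j]) (hC : ∀ γ, q.coeff γ ≤ C₀)
    (hd : ∀ γ, q.coeff γ ≠ 0 → γ.length ≤ d) (m : ℕ) (j : Fin n) (β : List (Fin n)) :
    ∃ w : ℕ → ℝ, (∀ l, 0 ≤ w l) ∧ ∑ l ∈ Finset.range (β.length + 1), w l = 1 ∧
      c ^ (d + 1) / (d * C₀) ≤ w 0 ∧ (∀ l, w l ≠ 0 → l < d) ∧
      |expLen q (m + 1) (j :: β) -
        ∑ l ∈ Finset.range (β.length + 1), w l * expLen q (m + 1) (β.drop l)| ≤ d * m + 1 := by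
  set α := j :: β with hα
  have hB : ∀ γ, 0 < serCoeff q (m + 1) γ := fun γ => serCoeff_succ_pos q m γ
  set A : ℝ := ∑ l ∈ Finset.range (β.length + 1),
    q.coeff (α.take (l + 1)) * serCoeff q (m + 1) (β.drop l) with hA
  have hAser : serCoeff q (m + 1) α = serCoeff q m α + A := by
    rw [serCoeff_succ]; rfl
  have hterm : ∀ l, 0 ≤ q.coeff (α.take (l + 1)) * serCoeff q (m + 1) (β.drop l) :=
    fun l => mul_nonneg (q.coeff_nonneg _) (hB _).le
  have hA0 : c * serCoeff q (m + 1) β ≤ A := by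
    calc c * serCoeff q (m + 1) β ≤ q.coeff (α.take (0 + 1)) * serCoeff q (m + 1) (β.drop 0) := by
          simp only [hα, zero_add, List.take_succ_cons, List.take_zero, List.drop_zero]
          exact mul_le_mul_of_nonneg_right (hc j) (hB _).le
      _ ≤ A := Finset.single_le_sum (fun l _ => hterm l) (by simp)
  have hApos : 0 < A := lt_of_lt_of_le (mul_pos hc0 (hB β)) hA0
  have hcd : 0 < c ^ d := by positivity
  have hsupp : ∀ l ∈ Finset.range (β.length + 1), q.coeff (α.take (l + 1)) ≠ 0 → l < d := by
    intro l hl h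
    have h1 := hd _ h
    have h2 := Finset.mem_range.1 hl
    simp only [hα, List.take_succ_cons, List.length_cons, List.length_take] at h1
    omega
  -- At most `d` terms are nonzero, and each is at most `C₀ c^{-d}` times the coefficient of `β`.
  -- Against the lower bound `c` for the numerator of the first weight this gives `c^(d+1) / (d
  -- C₀)`.
  have hA1 : A ≤ d * (C₀ / c ^ d * serCoeff q (m + 1) β) := by
    calc A = ∑ l ∈ (Finset.range (β.length + 1)).filter (· < d),
          q.coeff (α.take (l + 1)) * serCoeff q (m + 1) (β.drop l) := by
          rw [Finset.sum_filter_of_ne]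
          intro l hl h
          exact hsupp l hl (left_ne_zero_of_mul h)
      _ ≤ ∑ l ∈ (Finset.range (β.length + 1)).filter (· < d),
          C₀ / c ^ d * serCoeff q (m + 1) β := by
          refine Finset.sum_le_sum fun l hl => ?_
          obtain ⟨h1, h2⟩ := Finset.mem_filter.1 hl
          have h1 := Finset.mem_range.1 h1
          have h3 := pow_mul_serCoeff_drop_le q hc0.le hc m l β (by omega)
          have h4 : c ^ d ≤ c ^ l := pow_le_pow_of_le_one hc0.le hc1 h2.le
          have h5 : serCoeff q (m + 1) (β.drop l) ≤ serCoeff q (m + 1) β / c ^ d := by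
            rw [le_div_iff₀ hcd, mul_comm]
            exact (mul_le_mul_of_nonneg_right h4 (hB _).le).trans h3
          calc _ ≤ C₀ * (serCoeff q (m + 1) β / c ^ d) :=
                mul_le_mul (hC _) h5 (hB _).le hC₀.le
            _ = _ := by ring
      _ = ((Finset.range (β.length + 1)).filter (· < d)).card *
          (C₀ / c ^ d * serCoeff q (m + 1) β) := by rw [Finset.sum_const, nsmul_eq_mul]
      _ ≤ _ := by
          refine mul_le_mul_of_nonneg_right ?_ (by have := hB β; positivity)
          have : (Finset.range (β.length + 1)).filter (· < d) ⊆ Finset.range d := by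
            intro l; simp
          exact_mod_cast (Finset.card_le_card this).trans_eq (Finset.card_range d)
  refine ⟨fun l => if l < β.length + 1 then
    q.coeff (α.take (l + 1)) * serCoeff q (m + 1) (β.drop l) / A else 0, ?_, ?_, ?_, ?_, ?_⟩
  · intro l
    dsimp only
    split_ifs
    · exact div_nonneg (hterm l) hApos.le
    · exact le_rfl
  · rw [Finset.sum_congr rfl fun l hl => if_pos (Finset.mem_range.1 hl), ← Finset.sum_div,
      div_self hApos.ne']
  · dsimp only
    rw [if_pos (Nat.succ_pos _), div_le_div_iff₀ (by positivity) hApos]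
    simp only [hα, zero_add, List.take_succ_cons, List.take_zero, List.drop_zero]
    have hdC : 0 < (d : ℝ) * C₀ := by positivity
    calc c ^ (d + 1) * A ≤ c ^ (d + 1) * (d * (C₀ / c ^ d * serCoeff q (m + 1) β)) := by gcongr
      _ = c * serCoeff q (m + 1) β * (d * C₀) := by field_simp; ring
      _ ≤ _ := mul_le_mul_of_nonneg_right
          (mul_le_mul_of_nonneg_right (hc j) (hB _).le) hdC.le
  · intro l hl
    dsimp only at hl
    split_ifs at hl with h
    · exact hsupp l (Finset.mem_range.2 h) fun h0 => hl (by rw [h0]; simp)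
    · exact absurd rfl hl
  · set S : ℝ := ∑ l ∈ Finset.range (β.length + 1),
      q.coeff (α.take (l + 1)) * lenCoeff q (m + 1) (β.drop l) with hS
    have hsum : ∑ l ∈ Finset.range (β.length + 1), (if l < β.length + 1 then
        q.coeff (α.take (l + 1)) * serCoeff q (m + 1) (β.drop l) / A else 0) *
        expLen q (m + 1) (β.drop l) = S / A := by
      rw [hS, Finset.sum_div]
      refine Finset.sum_congr rfl fun l hl => ?_
      rw [if_pos (Finset.mem_range.1 hl), expLen]
      have := (hB (β.drop l)).ne'
      field_simp
    have hS0 : 0 ≤ S := Finset.sum_nonneg fun l _ =>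
      mul_nonneg (q.coeff_nonneg _) (lenCoeff_nonneg _ _ _)
    have hlen : lenCoeff q (m + 1) α = lenCoeff q m α + (S + A) := by
      rw [lenCoeff_succ, hS, hA, ← Finset.sum_add_distrib]
      simp only [mul_add]
      rfl
    have hSA : S ≤ β.length * A := by
      rw [hS, hA, Finset.mul_sum]
      refine Finset.sum_le_sum fun l _ => ?_
      rw [mul_left_comm]
      refine mul_le_mul_of_nonneg_left ((lenCoeff_le _ _ _).trans ?_) (q.coeff_nonneg _)
      refine mul_le_mul_of_nonneg_right ?_ (hB _).le
      rw [List.length_drop]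
      exact_mod_cast Nat.sub_le _ _
    have h1 := length_mul_serCoeff_le q hd m α
    have h2 := lenCoeff_le q m α
    have h3 := lenCoeff_nonneg q m α
    have h4 := serCoeff_nonneg q m α
    have hB' := hB α
    have hαlen : (α.length : ℝ) = β.length + 1 := by simp [hα]
    rw [hsum, expLen, hlen]
    -- The error is a difference of two nonnegative quantities. The first is at most `d m + 1` and
    -- the second at most `d m`, as `S / A` is an average of lengths and so at most `|α|`.
    have h5 : (lenCoeff q m α + (S + A)) / serCoeff q (m + 1) α - S / A =
        (lenCoeff q m α + A) / serCoeff q (m + 1) α -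
          (S / A) * serCoeff q m α / serCoeff q (m + 1) α := by
      have : S = S / A * A := by field_simp
      rw [hAser] at hB' ⊢
      field_simp
      ring
    have hSA' : S / A ≤ α.length := by
      rw [div_le_iff₀ hApos, hαlen]
      linarith
    have h6 : S / A * serCoeff q m α ≤ d * m * serCoeff q (m + 1) α :=
      (mul_le_mul_of_nonneg_right hSA' h4).trans h1
    rw [h5, abs_le]
    constructor
    · have h7 : S / A * serCoeff q m α / serCoeff q (m + 1) α ≤ d * m := by
        rw [div_le_iff₀ hB']; exact h6
      have h8 : 0 ≤ (lenCoeff q m α + A) / serCoeff q (m + 1) α := by positivity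
      linarith
    · have h7 : (lenCoeff q m α + A) / serCoeff q (m + 1) α ≤ d * m + 1 := by
        rw [div_le_iff₀ hB', add_mul, one_mul]
        linarith
      have h8 : 0 ≤ S / A * serCoeff q m α / serCoeff q (m + 1) α := by positivity
      linarith

/-- The constant depends only on bounds for the coefficients and the degree. This uniformity in `q`
allows one `K` for all `t q` with `t` between `1/2` and `1`. -/
theorem exists_expLen_cons_sub_le {c C₀ : ℝ} (d m : ℕ) (hc0 : 0 < c) (hc1 : c ≤ 1)
    (hcC : c ≤ C₀) : ∃ K : ℝ, 0 ≤ K ∧ ∀ {n : ℕ} (q : PosRegPoly n), (∀ j, c ≤ q.coeff [j]) →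
      (∀ γ, q.coeff γ ≤ C₀) → (∀ γ, q.coeff γ ≠ 0 → γ.length ≤ d) →
      ∀ (j : Fin n) (α : List (Fin n)),
        |expLen q (m + 1) (j :: α) - expLen q (m + 1) α| ≤ K := by
  have hC₀ : 0 < C₀ := hc0.trans_le hcC
  -- A window of length at least two is needed to contain both the full word and its suffix with one
  -- letter less.
  set D := d + 2 with hD
  set δ := c ^ (D + 1) / (D * C₀) with hδdef
  have hδ : 0 < δ := by positivity
  have hδ1 : δ ≤ 1 := by
    rw [hδdef, div_le_one (by positivity), pow_succ, mul_comm]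
    have h1 : c ^ D ≤ 1 := pow_le_one₀ hc0.le hc1
    have h2 : (1 : ℝ) ≤ D := by rw [hD]; push_cast; linarith [(Nat.cast_nonneg d : (0 : ℝ) ≤ d)]
    nlinarith
  refine ⟨2 * D + 2 * D * (D * m + 1) / δ ^ D, by positivity, ?_⟩
  intro n q hc hC hd j α
  have hd' : ∀ γ, q.coeff γ ≠ 0 → γ.length ≤ D := fun γ h => (hd γ h).trans (by omega)
  set ω := j :: α with hω
  set N := ω.length with hN
  -- The sequence runs through the suffixes of `ω`, indexed by their length.
  let x : ℕ → ℝ := fun t => expLen q (m + 1) (ω.drop (N - t))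
  have hx0 : ∀ t, 0 ≤ x t := fun t =>
    div_nonneg (lenCoeff_nonneg _ _ _) (serCoeff_nonneg _ _ _)
  have hx1 : ∀ t ≤ N, x t ≤ t := by
    intro t ht
    refine (div_le_iff₀ (serCoeff_succ_pos _ _ _)).2 ((lenCoeff_le _ _ _).trans_eq ?_)
    rw [List.length_drop, ← hN, Nat.sub_sub_self ht]
  have hstep : ∀ t < N, ∃ w : ℕ → ℝ, (∀ l, 0 ≤ w l) ∧ ∑ l ∈ Finset.range (t + 1), w l = 1 ∧
      δ ≤ w 0 ∧ (∀ l, w l ≠ 0 → l < D) ∧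
      |x (t + 1) - ∑ l ∈ Finset.range (t + 1), w l * x (t - l)| ≤ D * m + 1 := by
    intro t ht
    have hlt : N - (t + 1) < ω.length := by omega
    have hcons : ω.drop (N - (t + 1)) = ω[N - (t + 1)] :: ω.drop (N - t) := by
      rw [List.drop_eq_getElem_cons hlt, show N - (t + 1) + 1 = N - t by omega]
    have hlen : (ω.drop (N - t)).length = t := by rw [List.length_drop]; omega
    obtain ⟨w, h1, h2, h3, h4, h5⟩ := expLen_step q hc0 hc1 (d := D) (by omega) hC₀ hc hC hd' m
      (ω[N - (t + 1)]) (ω.drop (N - t))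
    rw [← hcons, hlen] at h5
    rw [hlen] at h2
    refine ⟨w, h1, h2, h3, h4, ?_⟩
    convert h5 using 5 with l hl
    have := Finset.mem_range.1 hl
    simp only [x, List.drop_drop]
    congr 2
    omega
  have hup : ∀ t < N, ∀ M, (∀ i ≤ t, t < i + D → x i ≤ M) →
      x (t + 1) ≤ δ * x t + (1 - δ) * M + (D * m + 1) := by
    intro t ht M hM
    obtain ⟨w, h1, h2, h3, h4, h5⟩ := hstep t ht
    have h6 := (abs_le.1 h5).2
    have h7 : ∑ l ∈ Finset.range (t + 1), w l * x (t - l) ≤ w 0 * x t + (1 - w 0) * M := by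
      rw [Finset.sum_range_succ'] at h2 ⊢
      have : ∑ l ∈ Finset.range t, w (l + 1) * x (t - (l + 1)) ≤
          ∑ l ∈ Finset.range t, w (l + 1) * M := by
        refine Finset.sum_le_sum fun l hl => ?_
        have := Finset.mem_range.1 hl
        by_cases hw : w (l + 1) = 0
        · rw [hw]; simp
        · exact mul_le_mul_of_nonneg_left (hM _ (by omega) (by have := h4 _ hw; omega)) (h1 _)
      rw [← Finset.sum_mul, show ∑ l ∈ Finset.range t, w (l + 1) = 1 - w 0 by linarith] at this
      simp only [Nat.sub_zero]
      linarith
    have h8 := mul_le_mul_of_nonneg_right h3 (sub_nonneg.2 (hM t le_rfl (by omega)))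
    linarith
  have hlow : ∀ t < N, ∀ M, (∀ i ≤ t, t < i + D → M ≤ x i) →
      δ * x t + (1 - δ) * M - (D * m + 1) ≤ x (t + 1) := by
    intro t ht M hM
    obtain ⟨w, h1, h2, h3, h4, h5⟩ := hstep t ht
    have h6 := (abs_le.1 h5).1
    have h7 : w 0 * x t + (1 - w 0) * M ≤ ∑ l ∈ Finset.range (t + 1), w l * x (t - l) := by
      rw [Finset.sum_range_succ'] at h2 ⊢
      have : ∑ l ∈ Finset.range t, w (l + 1) * M ≤
          ∑ l ∈ Finset.range t, w (l + 1) * x (t - (l + 1)) := by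
        refine Finset.sum_le_sum fun l hl => ?_
        have := Finset.mem_range.1 hl
        by_cases hw : w (l + 1) = 0
        · rw [hw]; simp
        · exact mul_le_mul_of_nonneg_left (hM _ (by omega) (by have := h4 _ hw; omega)) (h1 _)
      rw [← Finset.sum_mul, show ∑ l ∈ Finset.range t, w (l + 1) = 1 - w 0 by linarith] at this
      simp only [Nat.sub_zero]
      linarith
    have h8 := mul_le_mul_of_nonneg_right h3 (sub_nonneg.2 (hM t le_rfl (by omega)))
    linarith
  have hosc := osc_le_of_averaging hδ hδ1 (by positivity) (by omega) hup hlow hx0 hx1 N le_rfl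
  have hN1 : N = α.length + 1 := by simp [hN, hω]
  have e1 : x N = expLen q (m + 1) (j :: α) := by simp [x, hω]
  have e2 : x (N - 1) = expLen q (m + 1) α := by
    simp only [x]
    rw [show N - (N - 1) = 1 by omega, hω, List.drop_succ_cons, List.drop_zero]
  rw [← e1, ← e2, abs_le]
  have h1 := hosc N le_rfl (by omega) (N - 1) (by omega) (by omega)
  have h2 := hosc (N - 1) (by omega) (by omega) N le_rfl (by omega)
  constructor <;> linarith

end Expected

/-! ### Scaling a positive regular polynomial -/

section Scale

variable {n : ℕ}

/-- The polynomial `s q`, for `s > 0`. -/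
def PosRegPoly.scale (q : PosRegPoly n) (s : ℝ) (hs : 0 < s) : PosRegPoly n where
  coeff := s • q.coeff
  coeff_nonneg α := mul_nonneg hs.le (q.coeff_nonneg α)
  coeff_nil := by simp [q.coeff_nil]
  coeff_letter_pos j := mul_pos hs (q.coeff_letter_pos j)

theorem PosRegPoly.scale_coeff (q : PosRegPoly n) (s : ℝ) (hs : 0 < s) (α : List (Fin n)) :
    (q.scale s hs).coeff α = s * q.coeff α := rfl

theorem PosRegPoly.scale_one (q : PosRegPoly n) (h : (0 : ℝ) < 1) : q.scale 1 h = q := by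
  cases q; simp [PosRegPoly.scale]

theorem facCoeff_scale (q : PosRegPoly n) (s : ℝ) (hs : 0 < s) (p : ℕ) (α : List (Fin n)) :
    facCoeff (q.scale s hs) p α = s ^ p * facCoeff q p α := by
  induction p generalizing α with
  | zero => simp [facCoeff_zero]
  | succ p ih =>
    rw [facCoeff_succ, facCoeff_succ, Finset.mul_sum]
    refine Finset.sum_congr rfl fun l _ => ?_
    rw [ih, q.scale_coeff]
    ring

theorem serCoeff_scale (q : PosRegPoly n) (s : ℝ) (hs : 0 < s) (m : ℕ) (α : List (Fin n)) :
    serCoeff (q.scale s hs) m α = ∑ p ∈ Finset.range (α.length + 1),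
      s ^ p * ((m.multichoose p : ℝ) * facCoeff q p α) := by
  rw [serCoeff]
  exact Finset.sum_congr rfl fun p _ => by rw [facCoeff_scale]; ring

/-- The factorisations into `p` factors scale as `s^p`, so differentiation counts factors: the
logarithmic derivative is `expLen` of the scaled polynomial, divided by `s`. -/
theorem hasDerivAt_serCoeff_scale (q : PosRegPoly n) (s : ℝ) (hs : 0 < s) (m : ℕ)
    (α : List (Fin n)) :
    HasDerivAt (fun s : ℝ => ∑ p ∈ Finset.range (α.length + 1),
      s ^ p * ((m.multichoose p : ℝ) * facCoeff q p α)) (lenCoeff (q.scale s hs) m α / s) s := by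
  have : lenCoeff (q.scale s hs) m α / s = ∑ p ∈ Finset.range (α.length + 1),
      (p * s ^ (p - 1)) * ((m.multichoose p : ℝ) * facCoeff q p α) := by
    rw [lenCoeff, Finset.sum_div]
    refine Finset.sum_congr rfl fun p _ => ?_
    rw [facCoeff_scale]
    cases p with
    | zero => simp
    | succ p =>
      rw [Nat.add_sub_cancel, pow_succ]
      field_simp
  rw [this]
  exact HasDerivAt.fun_sum fun p _ => (hasDerivAt_pow p s).mul_const _

theorem PosRegPoly.exists_bounds (q : PosRegPoly n) : ∃ c C₀ : ℝ, ∃ d : ℕ, 0 < c ∧ c ≤ 1 ∧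
    1 ≤ C₀ ∧ (∀ j, c ≤ q.coeff [j]) ∧ (∀ γ, q.coeff γ ≤ C₀) ∧
    ∀ γ, q.coeff γ ≠ 0 → γ.length ≤ d := by
  obtain ⟨c, hc0, hc⟩ : ∃ c : ℝ, 0 < c ∧ ∀ j, c ≤ q.coeff [j] := by
    rcases isEmpty_or_nonempty (Fin n) with h | h
    · exact ⟨1, one_pos, fun j => h.elim j⟩
    · obtain ⟨i, hi⟩ := Finite.exists_min (fun j => q.coeff [j])
      exact ⟨_, q.coeff_letter_pos i, hi⟩
  refine ⟨min c 1, 1 + ∑ γ ∈ q.coeff.support, q.coeff γ, q.coeff.support.sup List.length,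
    lt_min hc0 one_pos, min_le_right _ _,
    le_add_of_nonneg_right (Finset.sum_nonneg fun γ _ => q.coeff_nonneg γ),
    fun j => (min_le_left _ _).trans (hc j), fun γ => ?_,
    fun γ h => Finset.le_sup (f := List.length) (Finsupp.mem_support_iff.2 h)⟩
  by_cases h : q.coeff γ = 0
  · rw [h]
    exact add_nonneg zero_le_one (Finset.sum_nonneg fun γ _ => q.coeff_nonneg γ)
  · have := Finset.single_le_sum (f := q.coeff) (fun γ _ => q.coeff_nonneg γ)
      (Finsupp.mem_support_iff.2 h)
    linarith

theorem weight_eq_exp (q : PosRegPoly n) {m : ℕ} (hm : 1 ≤ m) (j : Fin n) (α : List (Fin n)) :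
    weight q m j α =
      Real.exp (-(Real.log (serCoeff q m (j :: α)) - Real.log (serCoeff q m α)) / 2) := by
  have h1 := bCoeff_pos q m α
  have h2 := bCoeff_pos q m (j :: α)
  rw [← bCoeff_eq_serCoeff q hm, ← bCoeff_eq_serCoeff q hm, weight,
    ← Real.log_div h2.ne' h1.ne', ← Real.sqrt_div h1.le, neg_div, Real.exp_neg,
    ← Real.log_sqrt (by positivity), Real.exp_log (by positivity), ← Real.sqrt_inv, inv_div]

theorem abs_exp_sub_exp_le {a b W : ℝ} (ha : Real.exp a ≤ W) (hb : Real.exp b ≤ W) :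
    |Real.exp a - Real.exp b| ≤ W * |a - b| := by
  have key : ∀ a b : ℝ, Real.exp a ≤ W → Real.exp a - Real.exp b ≤ W * |a - b| := by
    intro a b ha
    have h1 := Real.add_one_le_exp (b - a)
    have h2 : Real.exp b = Real.exp a * Real.exp (b - a) := by rw [← Real.exp_add]; ring_nf
    calc Real.exp a - Real.exp b = Real.exp a * (1 - Real.exp (b - a)) := by rw [h2]; ring
      _ ≤ Real.exp a * |a - b| :=
        mul_le_mul_of_nonneg_left (by linarith [le_abs_self (a - b)]) (Real.exp_pos a).le
      _ ≤ W * |a - b| := mul_le_mul_of_nonneg_right ha (abs_nonneg _)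
  rw [abs_le]
  have h1 := key a b ha
  have h2 := key b a hb
  rw [abs_sub_comm b a] at h2
  constructor <;> linarith

/-- The weights of `s q` converge to those of `q` as `s → 1`, uniformly in the word. -/
theorem exists_weight_scale_sub_le (q : PosRegPoly n) {m : ℕ} (hm : 1 ≤ m) :
    ∃ K : ℝ, 0 ≤ K ∧ ∀ (s : ℝ) (hs : 0 < s), 1 / 2 ≤ s → s ≤ 1 → ∀ j α,
      |weight (q.scale s hs) m j α - weight q m j α| ≤ K * (1 - s) := by
  obtain ⟨m, rfl⟩ := Nat.exists_eq_add_of_le' hm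
  obtain ⟨c, C₀, d, hc0, hc1, hC1, hc, hC, hd⟩ := q.exists_bounds
  -- The letters of `t q` have coefficients at least `c / 2` for `t ≥ 1/2`, while `C₀` and `d` serve
  -- for all `t ≤ 1`.
  obtain ⟨K, hK0, hK⟩ := exists_expLen_cons_sub_le (c := c / 2) (C₀ := C₀) d m (by linarith)
    (by linarith) (by linarith)
  set W : ℝ := √(1 / (c / 2)) with hW
  refine ⟨W * K, by positivity, ?_⟩
  intro s hs hs2 hs1 j α
  let F : List (Fin n) → ℝ → ℝ := fun α s => ∑ p ∈ Finset.range (α.length + 1),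
      s ^ p * (((m + 1).multichoose p : ℝ) * facCoeff q p α)
  have hF : ∀ β s (hs : 0 < s), F β s = serCoeff (q.scale s hs) (m + 1) β :=
    fun β s hs => (serCoeff_scale q s hs _ β).symm
  -- The weight at parameter `s` is `exp (-g s / 2)`. The mean value inequality bounds the change of
  -- `g` by `2 K (1 - s)`, and the exponential is Lipschitz with constant `W` where its values are
  -- at most `W`.
  let g : ℝ → ℝ := fun s => Real.log (F (j :: α) s) - Real.log (F α s)
  have hderiv : ∀ t ∈ Set.Icc (1 / 2 : ℝ) 1, ∃ g', HasDerivAt g g' t ∧ ‖g'‖ ≤ 2 * K := by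
    intro t ⟨ht1, ht2⟩
    have ht : 0 < t := by linarith
    have hne : ∀ β, F β t ≠ 0 := fun β => by
      rw [hF β t ht]; exact (serCoeff_succ_pos _ _ _).ne'
    have h1 := ((hasDerivAt_serCoeff_scale q t ht (m + 1) (j :: α)).log (hne _)).sub
      ((hasDerivAt_serCoeff_scale q t ht (m + 1) α).log (hne _))
    refine ⟨_, h1, ?_⟩
    have h2 := hK (q.scale t ht)
      (fun j => by rw [q.scale_coeff]; nlinarith [hc j])
      (fun γ => by rw [q.scale_coeff]; nlinarith [hC γ, q.coeff_nonneg γ])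
      (fun γ h => hd γ fun h0 => h (by rw [q.scale_coeff, h0, mul_zero])) j α
    have h3 : lenCoeff (q.scale t ht) (m + 1) (j :: α) / t / F (j :: α) t -
        lenCoeff (q.scale t ht) (m + 1) α / t / F α t =
        (expLen (q.scale t ht) (m + 1) (j :: α) - expLen (q.scale t ht) (m + 1) α) / t := by
      rw [expLen, expLen, hF _ t ht, hF _ t ht]
      have := (serCoeff_succ_pos (q.scale t ht) m (j :: α)).ne'
      have := (serCoeff_succ_pos (q.scale t ht) m α).ne'
      field_simp
    refine (congrArg norm h3).trans_le ?_
    rw [Real.norm_eq_abs, abs_div, abs_of_pos ht, div_le_iff₀ ht]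
    nlinarith
  choose! g' hg' hg'K using hderiv
  have hg := Convex.norm_image_sub_le_of_norm_hasDerivWithin_le (f := g) (f' := g')
    (s := Set.Icc (1 / 2 : ℝ) 1) (C := 2 * K)
    (fun t ht => (hg' t ht).hasDerivWithinAt) hg'K (convex_Icc _ _)
    (Set.right_mem_Icc.2 (by norm_num)) (⟨hs2, hs1⟩ : s ∈ Set.Icc (1 / 2 : ℝ) 1)
  have hbd : ∀ t (ht : 0 < t), 1 / 2 ≤ t → weight (q.scale t ht) (m + 1) j α ≤ W := by
    intro t ht ht2
    refine (le_abs_self _).trans ((abs_weight_le _ _ _ _).trans (Real.sqrt_le_sqrt ?_))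
    rw [q.scale_coeff]
    exact one_div_le_one_div_of_le (by linarith) (by nlinarith [hc j])
  have e1 : weight q (m + 1) j α = weight (q.scale 1 one_pos) (m + 1) j α := by
    rw [q.scale_one]
  have w1 := hbd 1 one_pos (by norm_num)
  have ws := hbd s hs hs2
  rw [weight_eq_exp _ hm] at w1 ws
  rw [e1, weight_eq_exp _ hm, weight_eq_exp _ hm]
  refine (abs_exp_sub_exp_le ws w1).trans ?_
  rw [mul_assoc]
  refine mul_le_mul_of_nonneg_left ?_ (Real.sqrt_nonneg _)
  simp only [g, hF _ s hs, hF _ 1 one_pos, Real.norm_eq_abs] at hg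
  rw [abs_sub_comm s 1, abs_of_nonneg (by linarith : 0 ≤ 1 - s)] at hg
  rw [← sub_div, abs_div, abs_two, neg_sub_neg, abs_sub_comm]
  linarith

end Scale

/-! ### The maps `Φ` under maps intertwining the tuples -/

section Intertwine

variable {A A' : Type*} [Ring A] [StarRing A] [Algebra ℂ A] [Ring A'] [StarRing A'] [Algebra ℂ A']

theorem wordProd_nil {M : Type*} [Monoid M] {n : ℕ} (X : Fin n → M) : wordProd X [] = 1 := rfl

theorem wordProd_cons {M : Type*} [Monoid M] {n : ℕ} (X : Fin n → M) (j : Fin n)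
    (α : List (Fin n)) : wordProd X (j :: α) = X j * wordProd X α := by
  simp [wordProd]

theorem wordProd_append {M : Type*} [Monoid M] {n : ℕ} (X : Fin n → M)
    (α β : List (Fin n)) : wordProd X (α ++ β) = wordProd X α * wordProd X β := by
  simp [wordProd]

theorem apply_wordProd_conj {n : ℕ} {X : Fin n → A} {X' : Fin n → A'} (Θ : A →ₗ[ℂ] A')
    (hΘ : ∀ j Y, Θ (X j * Y * star (X j)) = X' j * Θ Y * star (X' j)) (α : List (Fin n)) (Y : A) :
    Θ (wordProd X α * Y * star (wordProd X α)) =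
      wordProd X' α * Θ Y * star (wordProd X' α) := by
  induction α generalizing Y with
  | nil => simp [wordProd_nil]
  | cons j α ih =>
    have h := hΘ j (wordProd X α * Y * star (wordProd X α))
    rw [ih] at h
    simp only [wordProd_cons, star_mul, mul_assoc] at h ⊢
    exact h

theorem apply_Phi {n : ℕ} {X : Fin n → A} {X' : Fin n → A'} (Θ : A →ₗ[ℂ] A')
    (hΘ : ∀ j Y, Θ (X j * Y * star (X j)) = X' j * Θ Y * star (X' j)) (q : PosRegPoly n) (Y : A) :
    Θ (Phi q X Y) = Phi q X' (Θ Y) := by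
  rw [Phi_apply, Phi_apply, map_sum]
  exact Finset.sum_congr rfl fun α _ => by rw [map_smul, apply_wordProd_conj Θ hΘ]

/-- Besides `*`-homomorphisms this covers compressions `Y ↦ J^* Y J`, which are linear but not
multiplicative; that is why only the conjugation identity is assumed of `Θ`. -/
theorem apply_defect {k : ℕ} {n : Fin k → ℕ} {X : ∀ i, Fin (n i) → A} {X' : ∀ i, Fin (n i) → A'}
    (Θ : A →ₗ[ℂ] A') (hΘ : ∀ i j Y, Θ (X i j * Y * star (X i j)) = X' i j * Θ Y * star (X' i j))
    (q : ∀ i, PosRegPoly (n i)) (p : Fin k → ℕ) (Y : A) :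
    Θ (defect q p X Y) = defect q p X' (Θ Y) := by
  have hpow : ∀ i (r : ℕ) Y, Θ (((1 - Phi (q i) (X i)) ^ r) Y) =
      ((1 - Phi (q i) (X' i)) ^ r) (Θ Y) := by
    intro i r
    induction r with
    | zero => intro Y; simp
    | succ r ih =>
      intro Y
      rw [pow_succ, pow_succ, Module.End.mul_apply, Module.End.mul_apply, ih]
      simp [apply_Phi Θ (hΘ i)]
  unfold defect
  rw [List.ofFn_eq_map, List.ofFn_eq_map]
  induction List.finRange k with
  | nil => simp
  | cons i l ih =>
    simp only [List.map_cons, List.prod_cons, Module.End.mul_apply]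
    rw [hpow, ih]

theorem starAlgHom_defect {k : ℕ} {n : Fin k → ℕ} (φ : A →⋆ₐ[ℂ] A') (X : ∀ i, Fin (n i) → A)
    (q : ∀ i, PosRegPoly (n i)) (p : Fin k → ℕ) :
    φ (defect q p X 1) = defect q p (fun i j => φ (X i j)) 1 := by
  have := apply_defect (X := X) (X' := fun i j => φ (X i j)) φ.toAlgHom.toLinearMap
    (fun i j Y => by simp [map_star]) q p 1
  simpa using this

theorem Phi_scale {n : ℕ} (q : PosRegPoly n) (s : ℝ) (hs : 0 < s) (X : Fin n → A) :
    Phi (q.scale s hs) X = (s : ℂ) • Phi q X := by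
  have h : (q.scale s hs).coeff.support = q.coeff.support := Finsupp.support_smul_eq hs.ne'
  rw [Phi, Phi, h, Finset.smul_sum]
  refine Finset.sum_congr rfl fun α _ => ?_
  rw [q.scale_coeff, smul_smul, Complex.ofReal_mul]

theorem commute_wordProd {M : Type*} [Monoid M] {n n' : ℕ} {X : Fin n → M} {X' : Fin n' → M}
    (h : ∀ j j', Commute (X j) (X' j')) (α : List (Fin n)) (α' : List (Fin n')) :
    Commute (wordProd X α) (wordProd X' α') := by
  refine Commute.list_prod_left _ _ fun x hx => Commute.list_prod_right _ _ fun y hy => ?_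
  obtain ⟨j, _, rfl⟩ := List.mem_map.1 hx
  obtain ⟨j', _, rfl⟩ := List.mem_map.1 hy
  exact h j j'

theorem commute_Phi {n n' : ℕ} {X : Fin n → A} {X' : Fin n' → A} (q : PosRegPoly n)
    (q' : PosRegPoly n') (h : ∀ j j', Commute (X j) (X' j')) :
    Commute (Phi q X) (Phi q' X') := by
  refine Commute.sum_left _ _ _ fun α _ => Commute.sum_right _ _ _ fun α' _ => ?_
  refine (Commute.smul_left ?_ _).smul_right _
  have h1 := (commute_wordProd h α α').eq
  have h2 := congrArg star h1
  rw [star_mul, star_mul] at h2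
  ext Y
  simp only [Module.End.mul_apply, LinearMap.comp_apply, LinearMap.mulLeft_apply,
    LinearMap.mulRight_apply]
  calc _ = (wordProd X α * wordProd X' α') * Y *
        (star (wordProd X' α') * star (wordProd X α)) := by simp only [mul_assoc]
    _ = _ := by rw [h1, h2]; simp only [mul_assoc]

theorem commute_one_sub_Phi_pow {n n' : ℕ} {X : Fin n → A} {X' : Fin n' → A} (q : PosRegPoly n)
    (q' : PosRegPoly n') (h : ∀ j j', Commute (X j) (X' j')) (r r' : ℕ) :
    Commute ((1 - Phi q X) ^ r) ((1 - Phi q' X') ^ r') :=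
  (((Commute.one_right _).sub_right
    (((Commute.one_left _).sub_left (commute_Phi q q' h))))).pow_pow r r'

theorem prod_ofFn_eq_single {M : Type*} [Monoid M] {k : ℕ} (f : Fin k → M) (i : Fin k)
    (hf : ∀ j, j ≠ i → f j = 1) : (List.ofFn f).prod = f i := by
  induction k with
  | zero => exact i.elim0
  | succ k ih =>
    rw [List.ofFn_succ, List.prod_cons]
    rcases Fin.eq_zero_or_eq_succ i with rfl | ⟨i, rfl⟩
    · rw [show (fun j : Fin k => f j.succ) = fun _ => 1 from
        funext fun j => hf _ (Fin.succ_ne_zero j)]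
      simp
    · rw [hf 0 (Fin.succ_ne_zero i).symm, one_mul,
        ih (fun j => f j.succ) i fun j hj => hf _ fun h => hj (Fin.succ_injective _ h)]

theorem defect_single {k : ℕ} {n : Fin k → ℕ} (q : ∀ i, PosRegPoly (n i)) (i : Fin k)
    (X : ∀ i, Fin (n i) → A) : defect q (Pi.single i 1) X = 1 - Phi (q i) (X i) := by
  unfold defect
  rw [prod_ofFn_eq_single _ i]
  · simp
  · intro j hj
    simp [Pi.single_eq_of_ne hj]

/-- If a cone contains all `A_1^{r_1} ⋯ A_k^{r_k} z`, it contains the corresponding products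
of nonnegative combinations of `1` and `A_i`. -/
theorem prod_ofFn_affine_mem {V : Type*} [AddCommGroup V] [Module ℂ V] {c s : ℝ} (hc : 0 ≤ c)
    (hs : 0 ≤ s) {k : ℕ} (m : Fin k → ℕ) (E : Fin k → Module.End ℂ V) (z : V) (C : Set V)
    (hadd : ∀ x ∈ C, ∀ y ∈ C, x + y ∈ C) (hsmul : ∀ t : ℝ, 0 ≤ t → ∀ x ∈ C, (t : ℂ) • x ∈ C)
    (hz : ∀ r : Fin k → ℕ, (∀ i, r i ≤ m i) → (List.ofFn fun i => E i ^ r i).prod z ∈ C)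
    (p : Fin k → ℕ) (hp : ∀ i, p i ≤ m i) :
    (List.ofFn fun i => ((c : ℂ) • (1 : Module.End ℂ V) + (s : ℂ) • E i) ^ p i).prod z ∈ C := by
  induction k generalizing C with
  | zero => simpa using hz 0 (fun i => i.elim0)
  | succ k ih =>
    -- Induction on `k` with a smaller cone: once the last factors land in `C₁`, the binomial
    -- expansion of the power with index `0` has all its terms in `C`.
    let C₁ : Set V := {y | ∀ r ≤ m 0, (E 0 ^ r) y ∈ C}
    have h1 := ih (fun i => m i.succ) (fun i => E i.succ) C₁
      (fun x hx y hy r hr => by rw [map_add]; exact hadd _ (hx r hr) _ (hy r hr))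
      (fun t ht x hx r hr => by rw [map_smul]; exact hsmul t ht _ (hx r hr))
      (fun r hr r₀ hr₀ => by
        have := hz (Fin.cons r₀ r) (fun i => by
          refine Fin.cases ?_ (fun i => ?_) i
          · simpa using hr₀
          · simpa using hr i)
        simpa [List.ofFn_succ] using this)
      (fun i => p i.succ) (fun i => hp i.succ)
    rw [List.ofFn_succ, List.prod_cons, Module.End.mul_apply]
    generalize (List.ofFn fun i : Fin k =>
      ((c : ℂ) • (1 : Module.End ℂ V) + (s : ℂ) • E i.succ) ^ p i.succ).prod z = y at h1
    have hzero : (0 : V) ∈ C := by simpa using hsmul 0 le_rfl _ (h1 0 (Nat.zero_le _))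
    have hcomm : Commute ((s : ℂ) • E 0) ((c : ℂ) • (1 : Module.End ℂ V)) :=
      (Commute.one_right _).smul_right _
    rw [add_comm, hcomm.add_pow, LinearMap.sum_apply]
    refine Finset.sum_induction _ (· ∈ C) (fun x y hx hy => hadd x hx y hy) hzero fun r hr => ?_
    have hr : r ≤ p 0 := Nat.lt_succ_iff.1 (Finset.mem_range.1 hr)
    have h2 := hsmul (s ^ r * c ^ (p 0 - r) * (p 0).choose r) (by positivity) _
      (h1 r (hr.trans (hp 0)))
    convert h2 using 1
    rw [smul_pow, smul_pow, one_pow, ← nsmul_eq_mul', LinearMap.smul_apply]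
    simp only [mul_smul_comm, mul_one, LinearMap.smul_apply, smul_smul]
    rw [← Nat.cast_smul_eq_nsmul ℂ, smul_smul]
    congr 1
    push_cast
    ring

end Intertwine

/-! ### Quadratic forms and Neumann series -/

section Neumann

theorem multichoose_succ_succ_cast (j p : ℕ) :
    ((j + 1).multichoose (p + 1) : ℝ) = j.multichoose (p + 1) + (j + 1).multichoose p := by
  rw [Nat.multichoose_succ_succ]; push_cast; ring

/-- The model is `y j p = ⟪Φ^p (1 - Φ)^j Z h, h⟫`, for which this is `(1 - Φ)^{-j} (1 - Φ)^j Z = Z`.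
Summation by parts carries the series for `j` to that for `j + 1`, with boundary term
`(j+1).multichoose N * y j (N+1)`; geometric decay beats its polynomial growth. -/
theorem hasSum_multichoose_mul {m : ℕ} (y : ℕ → ℕ → ℝ) {s : ℝ} (hs0 : 0 ≤ s) (hs1 : s < 1)
    (hy : ∀ j p, y (j + 1) p = y j p - y j (p + 1)) (hpos : ∀ j ≤ m, ∀ p, 0 ≤ y j p)
    (hbd : ∀ j, ∃ C, ∀ p, y j p ≤ s ^ p * C) (j : ℕ) (hj : j ≤ m) :
    HasSum (fun p => (j.multichoose p : ℝ) * y j p) (y 0 0) := by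
  induction j with
  | zero =>
    have : (fun p => ((0 : ℕ).multichoose p : ℝ) * y 0 p) = fun p => if p = 0 then y 0 0 else 0 := by
      funext p
      cases p <;> simp
    rw [this]
    exact hasSum_ite_eq 0 _
  | succ j ih =>
    have h1 := (ih (by omega)).tendsto_sum_nat.comp (Filter.tendsto_add_atTop_nat 1)
    rw [hasSum_iff_tendsto_nat_of_nonneg
      (fun p => mul_nonneg (Nat.cast_nonneg _) (hpos _ hj p)), ← Filter.tendsto_add_atTop_iff_nat 1]
    have hsum : ∀ N : ℕ, ∑ p ∈ Finset.range (N + 1), ((j + 1).multichoose p : ℝ) * y (j + 1) p =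
        ∑ p ∈ Finset.range (N + 1), (j.multichoose p : ℝ) * y j p -
          (j + 1).multichoose N * y j (N + 1) := by
      intro N
      induction N with
      | zero => simp [hy]
      | succ N ihN =>
        rw [Finset.sum_range_succ, ihN, Finset.sum_range_succ _ (N + 1), hy,
          multichoose_succ_succ_cast]
        ring
    simp only [hsum]
    have hlim : Filter.Tendsto (fun N : ℕ => ((j + 1).multichoose N : ℝ) * y j (N + 1))
        Filter.atTop (nhds 0) := by
      obtain ⟨C, hC⟩ := hbd j
      have h2 := (summable_choose_mul_geometric_of_norm_lt_one (R := ℝ) j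
        (r := s) (by rwa [Real.norm_eq_abs, abs_of_nonneg hs0])).tendsto_atTop_zero
      have h3 := h2.mul_const (s * C)
      rw [zero_mul] at h3
      refine squeeze_zero
        (fun N => mul_nonneg (Nat.cast_nonneg _) (hpos j (by omega) _)) (fun N => ?_) h3
      have h4 : (j + 1).multichoose N = (N + j).choose j := by
        rw [Nat.multichoose_eq, show j + 1 + N - 1 = N + j by omega, Nat.choose_symm_add]
      rw [h4]
      calc ((N + j).choose j : ℝ) * y j (N + 1)
          ≤ (N + j).choose j * (s ^ (N + 1) * C) :=
            mul_le_mul_of_nonneg_left (hC _) (Nat.cast_nonneg _)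
        _ = _ := by ring
    simpa using h1.sub hlim

/-- A double series over pairs of words, summed along the concatenations. -/
theorem tsum_take_drop {n : ℕ} (F : List (Fin n) → List (Fin n) → ℝ≥0∞) (hF : ∀ β, F [] β = 0) :
    ∑' α : List (Fin n), ∑ l ∈ Finset.range α.length, F (α.take (l + 1)) (α.drop (l + 1)) =
      ∑' γ, ∑' β, F γ β := by
  rw [← ENNReal.tsum_prod]
  have h1 : ∀ α : List (Fin n), ∑ l ∈ Finset.range α.length,
      F (α.take (l + 1)) (α.drop (l + 1)) =
      ∑' l : Fin α.length, F (α.take (l + 1)) (α.drop (l + 1)) := by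
    intro α
    rw [tsum_fintype, Finset.sum_range]
  simp only [h1]
  rw [← ENNReal.tsum_sigma' (f := fun x : Σ α : List (Fin n), Fin α.length =>
    F (x.1.take (x.2 + 1)) (x.1.drop (x.2 + 1)))]
  let g : (Σ α : List (Fin n), Fin α.length) → List (Fin n) × List (Fin n) :=
    fun x => (x.1.take (x.2 + 1), x.1.drop (x.2 + 1))
  have hg : Function.Injective g := by
    rintro ⟨α, l⟩ ⟨α', l'⟩ h
    obtain ⟨h1, h2⟩ := Prod.mk.inj h
    obtain rfl : α = α' := by
      rw [← List.take_append_drop (l + 1) α, ← List.take_append_drop (l' + 1) α']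
      exact congrArg₂ (· ++ ·) h1 h2
    have h3 := congrArg List.length h1
    simp only [List.length_take] at h3
    have := l.2
    have := l'.2
    have : l = l' := Fin.ext (by omega)
    rw [this]
  refine hg.tsum_eq (f := fun x : List (Fin n) × List (Fin n) => F x.1 x.2) ?_
  rintro ⟨γ, β⟩ hx
  cases γ with
  | nil => exact absurd (hF β) hx
  | cons j γ =>
    refine ⟨⟨j :: γ ++ β, ⟨γ.length, by simp⟩⟩, ?_⟩
    simp [g]

variable {H : Type*} [NormedAddCommGroup H] [InnerProductSpace ℂ H]

theorem reApplyInnerSelf_sub (X Y : H →L[ℂ] H) (h : H) :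
    (X - Y).reApplyInnerSelf h = X.reApplyInnerSelf h - Y.reApplyInnerSelf h := by
  simp [ContinuousLinearMap.reApplyInnerSelf_apply, inner_sub_left]

theorem reApplyInnerSelf_smul (t : ℝ) (X : H →L[ℂ] H) (h : H) :
    ((t : ℂ) • X).reApplyInnerSelf h = t * X.reApplyInnerSelf h := by
  rw [ContinuousLinearMap.reApplyInnerSelf_apply, _root_.smul_apply, inner_smul_left,
    Complex.conj_ofReal]
  exact Complex.re_ofReal_mul _ _

theorem reApplyInnerSelf_one (h : H) : (1 : H →L[ℂ] H).reApplyInnerSelf h = ‖h‖ ^ 2 :=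
  inner_self_eq_norm_sq (𝕜 := ℂ) h

theorem reApplyInnerSelf_sum {ι : Type*} (s : Finset ι) (X : ι → (H →L[ℂ] H)) (h : H) :
    (∑ i ∈ s, X i).reApplyInnerSelf h = ∑ i ∈ s, (X i).reApplyInnerSelf h := by
  simp [ContinuousLinearMap.reApplyInnerSelf_apply, sum_inner]

theorem reApplyInnerSelf_le (X : H →L[ℂ] H) (h : H) :
    X.reApplyInnerSelf h ≤ ‖X‖ * ‖h‖ ^ 2 := by
  calc X.reApplyInnerSelf h ≤ ‖inner ℂ (X h) h‖ := RCLike.re_le_norm _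
    _ ≤ ‖X h‖ * ‖h‖ := norm_inner_le_norm _ _
    _ ≤ ‖X‖ * ‖h‖ * ‖h‖ := by gcongr; exact X.le_opNorm h
    _ = _ := by ring

variable [CompleteSpace H]

theorem reApplyInnerSelf_conj (X Y : H →L[ℂ] H) (h : H) :
    (X * Y * star X).reApplyInnerSelf h = Y.reApplyInnerSelf (star X h) := by
  simp only [ContinuousLinearMap.reApplyInnerSelf_apply, ContinuousLinearMap.star_eq_adjoint]
  rw [ContinuousLinearMap.adjoint_inner_right]
  rfl

variable {n : ℕ} (q : PosRegPoly n) (X : Fin n → (H →L[ℂ] H))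

theorem reApplyInnerSelf_Phi (Y : H →L[ℂ] H) (h : H) :
    (Phi q X Y).reApplyInnerSelf h = ∑ γ ∈ q.coeff.support,
      q.coeff γ * Y.reApplyInnerSelf (star (wordProd X γ) h) := by
  rw [Phi_apply, reApplyInnerSelf_sum]
  exact Finset.sum_congr rfl fun γ _ => by rw [reApplyInnerSelf_smul, reApplyInnerSelf_conj]

theorem isPositive_Phi {Y : H →L[ℂ] H} (hY : Y.IsPositive) : (Phi q X Y).IsPositive := by
  rw [Phi_apply]
  refine Finset.sum_induction _ ContinuousLinearMap.IsPositive (fun _ _ h h' => h.add h')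
    ContinuousLinearMap.isPositive_zero fun γ _ => ?_
  refine ContinuousLinearMap.IsPositive.smul_of_nonneg ?_
    (by exact_mod_cast q.coeff_nonneg γ)
  exact hY.conj_adjoint (wordProd X γ)

theorem isPositive_Phi_pow {Y : H →L[ℂ] H} (hY : Y.IsPositive) (p : ℕ) :
    ((Phi q X ^ p) Y).IsPositive := by
  induction p with
  | zero => simpa using hY
  | succ p ih => rw [pow_succ', Module.End.mul_apply]; exact isPositive_Phi q X ih

theorem reApplyInnerSelf_Phi_pow_le {s : ℝ}
    (hs : ∀ h, (Phi q X 1).reApplyInnerSelf h ≤ s * ‖h‖ ^ 2) (hs0 : 0 ≤ s) (Y : H →L[ℂ] H) (p : ℕ)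
    (h : H) : ((Phi q X ^ p) Y).reApplyInnerSelf h ≤ s ^ p * (‖Y‖ * ‖h‖ ^ 2) := by
  induction p generalizing h with
  | zero => simpa using reApplyInnerSelf_le Y h
  | succ p ih =>
    rw [pow_succ', Module.End.mul_apply, reApplyInnerSelf_Phi]
    calc _ ≤ ∑ γ ∈ q.coeff.support,
          q.coeff γ * (s ^ p * (‖Y‖ * ‖star (wordProd X γ) h‖ ^ 2)) :=
        Finset.sum_le_sum fun γ _ => mul_le_mul_of_nonneg_left (ih _) (q.coeff_nonneg γ)
      _ = s ^ p * ‖Y‖ * (Phi q X 1).reApplyInnerSelf h := by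
        rw [reApplyInnerSelf_Phi, Finset.mul_sum]
        refine Finset.sum_congr rfl fun γ _ => ?_
        rw [reApplyInnerSelf_one]
        ring
      _ ≤ s ^ p * ‖Y‖ * (s * ‖h‖ ^ 2) := mul_le_mul_of_nonneg_left (hs h) (by positivity)
      _ = _ := by ring

/-- Iterating `Φ` concatenates words, and `facCoeff` collects the weights of all ways to obtain a
given word. With values in `ℝ≥0∞` the rearrangements need no summability. -/
theorem tsum_facCoeff_mul {Y : H →L[ℂ] H} (hY : Y.IsPositive) (p : ℕ) (h : H) :
    ∑' α, ENNReal.ofReal (facCoeff q p α * Y.reApplyInnerSelf (star (wordProd X α) h)) =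
      ENNReal.ofReal (((Phi q X ^ p) Y).reApplyInnerSelf h) := by
  induction p generalizing h with
  | zero =>
    rw [tsum_eq_single []]
    · simp [facCoeff_zero, wordProd_nil]
    · intro α hα
      simp [facCoeff_zero, hα]
  | succ p ih =>
    let F : List (Fin n) → List (Fin n) → ℝ≥0∞ := fun γ β =>
      ENNReal.ofReal (q.coeff γ) * ENNReal.ofReal
        (facCoeff q p β * Y.reApplyInnerSelf (star (wordProd X β) (star (wordProd X γ) h)))
    have h1 : ∀ α, ENNReal.ofReal (facCoeff q (p + 1) α *
        Y.reApplyInnerSelf (star (wordProd X α) h)) =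
        ∑ l ∈ Finset.range α.length, F (α.take (l + 1)) (α.drop (l + 1)) := by
      intro α
      rw [facCoeff_succ, Finset.sum_mul, ENNReal.ofReal_sum_of_nonneg]
      · refine Finset.sum_congr rfl fun l _ => ?_
        simp only [F]
        rw [← ENNReal.ofReal_mul (q.coeff_nonneg _), mul_assoc]
        congr 4
        conv_lhs => rw [← List.take_append_drop (l + 1) α, wordProd_append, star_mul]
        rfl
      · intro l _
        exact mul_nonneg (mul_nonneg (q.coeff_nonneg _) (facCoeff_nonneg _ _ _)) (hY.2 _)
    simp only [h1]
    rw [tsum_take_drop F (fun β => by simp [F, q.coeff_nil])]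
    simp only [F, ENNReal.tsum_mul_left, ih]
    rw [tsum_eq_sum (s := q.coeff.support), pow_succ', Module.End.mul_apply, reApplyInnerSelf_Phi,
      ENNReal.ofReal_sum_of_nonneg]
    · exact Finset.sum_congr rfl fun γ _ => (ENNReal.ofReal_mul (q.coeff_nonneg _)).symm
    · exact fun γ _ => mul_nonneg (q.coeff_nonneg _) ((isPositive_Phi_pow q X hY p).2 _)
    · intro γ hγ
      rw [Finsupp.notMem_support_iff.1 hγ]
      simp

theorem tsum_serCoeff_mul {Y : H →L[ℂ] H} (hY : Y.IsPositive) (m : ℕ) (h : H) :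
    ∑' α, ENNReal.ofReal (serCoeff q m α * Y.reApplyInnerSelf (star (wordProd X α) h)) =
      ∑' p : ℕ, ENNReal.ofReal (m.multichoose p * ((Phi q X ^ p) Y).reApplyInnerSelf h) := by
  have h1 : ∀ α, ENNReal.ofReal (serCoeff q m α * Y.reApplyInnerSelf (star (wordProd X α) h)) =
      ∑' p : ℕ, ENNReal.ofReal (m.multichoose p) *
        ENNReal.ofReal (facCoeff q p α * Y.reApplyInnerSelf (star (wordProd X α) h)) := by
    intro α
    rw [tsum_eq_sum (s := Finset.range (α.length + 1)), serCoeff, Finset.sum_mul,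
      ENNReal.ofReal_sum_of_nonneg]
    · exact Finset.sum_congr rfl fun p _ => by
        rw [mul_assoc, ENNReal.ofReal_mul (Nat.cast_nonneg _)]
    · exact fun p _ => mul_nonneg
        (mul_nonneg (Nat.cast_nonneg _) (facCoeff_nonneg _ _ _)) (hY.2 _)
    · intro p hp
      rw [facCoeff_eq_zero_of_length_lt]
      · simp
      · simpa using hp
  simp only [h1]
  rw [ENNReal.tsum_comm]
  refine tsum_congr fun p => ?_
  rw [ENNReal.tsum_mul_left, tsum_facCoeff_mul q X hY, ← ENNReal.ofReal_mul (Nat.cast_nonneg _)]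

/-- The Neumann series of `(1 - Φ)^{-m}` applied to `(1 - Φ)^m Z`. Positivity of the intermediate
defects keeps all terms nonnegative, and `Φ(I) ≤ s < 1` gives the geometric decay. -/
theorem tsum_serCoeff_mul_defect {s : ℝ} (hs0 : 0 ≤ s) (hs1 : s < 1)
    (hs : ∀ h, (Phi q X 1).reApplyInnerSelf h ≤ s * ‖h‖ ^ 2) (m : ℕ) (Z : H →L[ℂ] H)
    (hZ : ∀ j ≤ m, (((1 - Phi q X) ^ j) Z).IsPositive) (h : H) :
    ∑' α, ENNReal.ofReal (serCoeff q m α *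
      (((1 - Phi q X) ^ m) Z).reApplyInnerSelf (star (wordProd X α) h)) =
      ENNReal.ofReal (Z.reApplyInnerSelf h) := by
  rw [tsum_serCoeff_mul q X (hZ m le_rfl)]
  have h1 := hasSum_multichoose_mul (m := m)
    (fun j p => ((Phi q X ^ p) (((1 - Phi q X) ^ j) Z)).reApplyInnerSelf h) hs0 hs1
    (fun j p => by
      rw [pow_succ', Module.End.mul_apply, LinearMap.sub_apply, map_sub, reApplyInnerSelf_sub,
        Module.End.one_apply, pow_succ, Module.End.mul_apply])
    (fun j hj p => (isPositive_Phi_pow q X (hZ j hj) p).2 h)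
    (fun j => ⟨_, fun p => reApplyInnerSelf_Phi_pow_le q X hs hs0 _ p h⟩) m le_rfl
  rw [← ENNReal.ofReal_tsum_of_nonneg _ h1.summable, h1.tsum_eq]
  · simp
  · exact fun p => mul_nonneg (Nat.cast_nonneg _) ((isPositive_Phi_pow q X (hZ m le_rfl) p).2 h)

end Neumann

/-! ### The Neumann series identity in several commuting families. -/

section Kernel

variable {H : Type*} [NormedAddCommGroup H] [InnerProductSpace ℂ H] [CompleteSpace H]

theorem multiWordProd_succ {A : Type*} [Monoid A] {k : ℕ} {n : Fin (k + 1) → ℕ}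
    (X : ∀ i, Fin (n i) → A) (α : ∀ i, List (Fin (n i))) :
    multiWordProd X α = wordProd (X 0) (α 0) *
      multiWordProd (fun i : Fin k => X i.succ) (fun i => α i.succ) := by
  simp [multiWordProd, List.ofFn_succ]

theorem defect_succ {A : Type*} [Ring A] [StarRing A] [Algebra ℂ A] {k : ℕ}
    {n : Fin (k + 1) → ℕ} (q : ∀ i, PosRegPoly (n i)) (p : Fin (k + 1) → ℕ)
    (X : ∀ i, Fin (n i) → A) :
    defect q p X = (1 - Phi (q 0) (X 0)) ^ p 0 *
      defect (fun i : Fin k => q i.succ) (fun i => p i.succ) (fun i => X i.succ) := by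
  simp [defect, List.ofFn_succ]

/-- Induction on `k`: commutation lets `(1 - Φ_0)^{m_0}` act on `Z` first, and the remaining
families are treated with the resulting operator in place of `Z`. Hence the general `Z`, although
only `Z = 1` is wanted. -/
theorem tsum_prod_serCoeff_mul_defect {k : ℕ} {n : Fin k → ℕ} (q : ∀ i, PosRegPoly (n i))
    (m : Fin k → ℕ) (X : ∀ i, Fin (n i) → (H →L[ℂ] H))
    (hX : ∀ i i', i ≠ i' → ∀ j j', Commute (X i j) (X i' j')) {s : ℝ} (hs0 : 0 ≤ s) (hs1 : s < 1)
    (hs : ∀ i h, (Phi (q i) (X i) 1).reApplyInnerSelf h ≤ s * ‖h‖ ^ 2) (Z : H →L[ℂ] H)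
    (hZ : ∀ p : Fin k → ℕ, (∀ i, p i ≤ m i) → (defect q p X Z).IsPositive) (h : H) :
    ∑' α : ∀ i, List (Fin (n i)), ENNReal.ofReal ((∏ i, serCoeff (q i) (m i) (α i)) *
      (defect q m X Z).reApplyInnerSelf (star (multiWordProd X α) h)) =
      ENNReal.ofReal (Z.reApplyInnerSelf h) := by
  induction k generalizing Z h with
  | zero =>
    rw [tsum_eq_single default (fun α hα => absurd (Subsingleton.elim _ _) hα)]
    simp [multiWordProd, defect]
  | succ k ih =>
    set Z' := ((1 - Phi (q 0) (X 0)) ^ m 0) Z with hZ'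
    have hcomm : ∀ r (p : Fin (k + 1) → ℕ), Commute ((1 - Phi (q 0) (X 0)) ^ r)
        (defect (fun i : Fin k => q i.succ) (fun i => p i.succ) (fun i => X i.succ)) := by
      intro r p
      refine Commute.list_prod_right _ _ fun y hy => ?_
      obtain ⟨i, rfl⟩ := List.mem_ofFn.1 hy
      exact commute_one_sub_Phi_pow _ _ (hX 0 i.succ (Fin.succ_ne_zero i).symm) _ _
    have hD : defect q m X Z =
        defect (fun i : Fin k => q i.succ) (fun i => m i.succ) (fun i => X i.succ) Z' := by
      rw [defect_succ, (hcomm _ _).eq, Module.End.mul_apply]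
    have ih' := ih (fun i => q i.succ) (fun i => m i.succ) (fun i => X i.succ)
      (fun i i' hi => hX _ _ fun h => hi (Fin.succ_injective _ h)) (fun i => hs i.succ) Z'
      (fun p hp => by
        have := hZ (Fin.cons (m 0) p) (fun i => by
          refine Fin.cases ?_ (fun i => ?_) i
          · simp
          · simpa using hp i)
        rw [defect_succ, (hcomm _ _).eq, Module.End.mul_apply] at this
        simpa using this)
    have h0 := tsum_serCoeff_mul_defect (q 0) (X 0) hs0 hs1 (hs 0) (m 0) Z
      (fun j hj => by
        have := hZ (Fin.cons j 0) (fun i => by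
          refine Fin.cases ?_ (fun i => ?_) i
          · simpa using hj
          · simp)
        rw [defect_succ] at this
        simpa [defect] using this) h
    rw [← h0, ← (Fin.consEquiv (fun i => List (Fin (n i)))).tsum_eq, ENNReal.tsum_prod']
    refine tsum_congr fun γ => ?_
    rw [ENNReal.ofReal_mul (serCoeff_nonneg _ _ _), ← ih', ← ENNReal.tsum_mul_left]
    refine tsum_congr fun β => ?_
    rw [← ENNReal.ofReal_mul (serCoeff_nonneg _ _ _), hD, multiWordProd_succ, Fin.prod_univ_succ]
    simp [Fin.consEquiv, mul_assoc]

/-- The polydomain condition is inherited by the scaled polynomials. -/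
theorem isPositive_defect_scale {k : ℕ} {n : Fin k → ℕ} (q : ∀ i, PosRegPoly (n i))
    (m : Fin k → ℕ) {T : ∀ i, Fin (n i) → (H →L[ℂ] H)} (hT : T ∈ polydomain q m H) {s : ℝ}
    (hs : 0 < s) (hs1 : s ≤ 1) (p : Fin k → ℕ) (hp : ∀ i, p i ≤ m i) :
    (defect (fun i => (q i).scale s hs) p T 1).IsPositive := by
  have h := prod_ofFn_affine_mem (c := 1 - s) (s := s) (by linarith) hs.le m
    (fun i => 1 - Phi (q i) (T i)) (1 : H →L[ℂ] H) {Y | Y.IsPositive}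
    (fun x hx y hy => hx.add hy)
    (fun t ht x hx => hx.smul_of_nonneg (by exact_mod_cast ht)) hT.2 p hp
  have h2 : ∀ i, ((1 - s : ℝ) : ℂ) • (1 : Module.End ℂ (H →L[ℂ] H)) +
      (s : ℂ) • (1 - Phi (q i) (T i)) = 1 - Phi ((q i).scale s hs) (T i) := fun i => by
    rw [Phi_scale, smul_sub]
    push_cast
    module
  simp only [h2] at h
  exact h

theorem tsum_bCoeff_scale_mul_defect {k : ℕ} {n : Fin k → ℕ} (q : ∀ i, PosRegPoly (n i))
    (m : Fin k → ℕ) (hm : ∀ i, 1 ≤ m i) {T : ∀ i, Fin (n i) → (H →L[ℂ] H)}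
    (hT : T ∈ polydomain q m H) {s : ℝ} (hs : 0 < s) (hs1 : s < 1) (h : H) :
    ∑' α : ∀ i, List (Fin (n i)), ENNReal.ofReal
      ((∏ i, bCoeff ((q i).scale s hs) (m i) (α i)) *
        (defect (fun i => (q i).scale s hs) m T 1).reApplyInnerSelf
          (star (multiWordProd T α) h)) = ENNReal.ofReal (‖h‖ ^ 2) := by
  simp only [fun i => funext (bCoeff_eq_serCoeff ((q i).scale s hs) (hm i))]
  rw [tsum_prod_serCoeff_mul_defect (fun i => (q i).scale s hs) m T hT.1 hs.le hs1 ?_ 1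
    (isPositive_defect_scale q m hT hs hs1.le), reApplyInnerSelf_one]
  intro i h
  -- The defect with the single exponent `p_i = 1` gives `Φ_{q_i}(I) ≤ I`, hence `Φ_{s q_i}(I) ≤ s`;
  -- `1 ≤ m i` makes this exponent admissible.
  have h1 := hT.2 (Pi.single i 1) (fun j => by
    by_cases hj : j = i
    · subst hj; simpa using hm j
    · simp [Pi.single_eq_of_ne hj])
  rw [defect_single] at h1
  have h2 := h1.2 h
  rw [LinearMap.sub_apply, reApplyInnerSelf_sub, Module.End.one_apply, reApplyInnerSelf_one] at h2
  rw [Phi_scale, LinearMap.smul_apply, reApplyInnerSelf_smul]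
  exact mul_le_mul_of_nonneg_left (by linarith) hs.le

end Kernel

/-! ### Hilbert spaces with a dense linear image of a vector space -/

section Dense

variable {V E F : Type*} [AddCommGroup V] [Module ℂ V] [NormedAddCommGroup E]
  [InnerProductSpace ℂ E] [NormedAddCommGroup F] [InnerProductSpace ℂ F]

theorem exists_clm_of_denseRange [CompleteSpace F] {f : V →ₗ[ℂ] E} (hf : DenseRange f)
    (g : V →ₗ[ℂ] F) {C : ℝ} (h : ∀ v, ‖g v‖ ≤ C * ‖f v‖) :
    ∃ T : E →L[ℂ] F, ∀ v, T (f v) = g v :=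
  ⟨g.extendOfNorm f, fun v => LinearMap.extendOfNorm_eq hf ⟨C, h⟩ v⟩

theorem exists_linearIsometry_of_denseRange [CompleteSpace F] {f : V →ₗ[ℂ] E} (hf : DenseRange f)
    (g : V →ₗ[ℂ] F) (h : ∀ v, ‖g v‖ = ‖f v‖) : ∃ T : E →ₗᵢ[ℂ] F, ∀ v, T (f v) = g v := by
  obtain ⟨T, hT⟩ := exists_clm_of_denseRange hf g (C := 1) (fun v => by rw [one_mul, h v])
  refine ⟨⟨T.toLinearMap, fun x => ?_⟩, hT⟩
  induction x using hf.induction_on with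
  | hp => exact isClosed_eq (by fun_prop) (by fun_prop)
  | ih v =>
    change ‖T (f v)‖ = ‖f v‖
    rw [hT, h]

/-- Two linear maps of one vector space with dense ranges and equal norms determine a unitary. The
unitary equivalences constructed below are obtained in this way, without choosing bases. -/
theorem exists_linearIsometryEquiv_of_denseRange [CompleteSpace E] [CompleteSpace F]
    {f : V →ₗ[ℂ] E} (hf : DenseRange f) {g : V →ₗ[ℂ] F} (hg : DenseRange g)
    (h : ∀ v, ‖g v‖ = ‖f v‖) : ∃ T : E ≃ₗᵢ[ℂ] F, ∀ v, T (f v) = g v := by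
  obtain ⟨T, hT⟩ := exists_linearIsometry_of_denseRange hf g h
  have hsurj : Function.Surjective T := by
    have hc : IsClosed (Set.range T) := T.isometry.isClosedEmbedding.isClosed_range
    intro y
    have : y ∈ closure (Set.range T) :=
      closure_mono (by rintro _ ⟨v, rfl⟩; exact ⟨f v, hT v⟩) (hg y)
    rwa [hc.closure_eq] at this
  exact ⟨LinearIsometryEquiv.ofSurjective T hsurj, hT⟩

end Dense

/-! ### Limits of Hilbert spaces along an ultrafilter. -/

section Limit


/-- The Hilbert space obtained from a bounded family of linear maps into Hilbert spaces by passing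
to the limit of the inner products along an ultrafilter. -/
theorem exists_limit_space {V : Type u} [AddCommGroup V] [Module ℂ V] {ι : Type*}
    (U : Ultrafilter ι) {E : ι → Type*} [∀ i, NormedAddCommGroup (E i)]
    [∀ i, InnerProductSpace ℂ (E i)] (L : ∀ i, V →ₗ[ℂ] E i) (hL : ∀ v, ∃ C, ∀ i, ‖L i v‖ ≤ C) :
    ∃ (K : Type u) (_ : NormedAddCommGroup K) (_ : InnerProductSpace ℂ K) (_ : CompleteSpace K)
      (Λ : V →ₗ[ℂ] K), DenseRange Λ ∧
      ∀ v w, Filter.Tendsto (fun i => inner ℂ (L i v) (L i w)) U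
        (nhds (inner ℂ (Λ v) (Λ w))) := by
  have hlim : ∀ v w, ∃ z, Filter.Tendsto (fun i => inner ℂ (L i v) (L i w)) U (nhds z) := by
    intro v w
    obtain ⟨C, hC⟩ := hL v
    obtain ⟨C', hC'⟩ := hL w
    obtain ⟨z, _, hz⟩ := (isCompact_closedBall (0 : ℂ) (C * C')).ultrafilter_le_nhds'
      (U.map fun i => inner ℂ (L i v) (L i w)) (Filter.mem_map.2 <| Filter.Eventually.of_forall fun i => by
        refine mem_closedBall_zero_iff.2 ?_
        exact (norm_inner_le_norm _ _).trans
          (mul_le_mul (hC i) (hC' i) (norm_nonneg _) ((norm_nonneg _).trans (hC i))))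
    exact ⟨z, hz⟩
  choose B hB using hlim
  let c : PreInnerProductSpace.Core ℂ V :=
    { inner := B
      conj_inner_symm := fun v w => by
        refine tendsto_nhds_unique
          ((Complex.continuous_conj.tendsto _).comp (hB w v)) ?_
        convert hB v w using 1
        funext i
        simp
      re_inner_nonneg := fun v => by
        refine ge_of_tendsto' ((Complex.continuous_re.tendsto _).comp (hB v v)) fun i => ?_
        exact inner_self_nonneg (𝕜 := ℂ) (x := L i v)
      add_left := fun v w x => by
        refine tendsto_nhds_unique (hB _ _) ?_
        convert (hB v x).add (hB w x) using 1
        funext i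
        rw [map_add, inner_add_left]
      smul_left := fun v w a => by
        refine tendsto_nhds_unique (hB _ _) ?_
        convert (hB v w).const_mul ((starRingEnd ℂ) a) using 1
        funext i
        rw [map_smul, inner_smul_left] }
  let _ : SeminormedAddCommGroup V := InnerProductSpace.Core.toSeminormedAddCommGroup (c := c)
  let _ : InnerProductSpace ℂ V := InnerProductSpace.ofCore c
  -- The limit form may be degenerate; the completion of the seminormed space is separated, so no
  -- explicit quotient by null vectors is needed.
  refine ⟨UniformSpace.Completion V, inferInstance, inferInstance, inferInstance,
    (UniformSpace.Completion.toComplₗᵢ (𝕜 := ℂ) (E := V)).toLinearMap,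
    UniformSpace.Completion.denseRange_coe, fun v w => ?_⟩
  change Filter.Tendsto _ _ (nhds (inner ℂ (v : UniformSpace.Completion V) w))
  rw [UniformSpace.Completion.inner_coe]
  exact hB v w

end Limit

/-! ### Hilbert tensor products -/

section Tensor

variable {E G : Type*} [NormedAddCommGroup E] [InnerProductSpace ℂ E] [NormedAddCommGroup G]
  [InnerProductSpace ℂ G]

variable (E G) in
/-- The inclusion of the algebraic tensor product. -/
def tensorIncl : E ⊗[ℂ] G →ₗᵢ[ℂ] HTensor E G := UniformSpace.Completion.toComplₗᵢ

variable (E G) in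
theorem denseRange_tensorIncl : DenseRange (tensorIncl E G) :=
  UniformSpace.Completion.denseRange_coe

theorem inner_tensorIncl_tmul (x x' : E) (g g' : G) :
    inner ℂ (tensorIncl E G (x ⊗ₜ g)) (tensorIncl E G (x' ⊗ₜ g')) =
      inner ℂ x x' * inner ℂ g g' := by
  rw [LinearIsometry.inner_map_map, TensorProduct.inner_tmul]

theorem ampliation_tensorIncl_tmul (X : E →L[ℂ] E) (x : E) (g : G) :
    ampliation X G (tensorIncl E G (x ⊗ₜ g)) = tensorIncl E G (X x ⊗ₜ g) :=
  ampliation_tmul X G x g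

theorem htensor_induction {p : HTensor E G → Prop} (hc : IsClosed {x | p x})
    (hadd : ∀ x y, p x → p y → p (x + y))
    (hp : ∀ x g, p (tensorIncl E G (x ⊗ₜ g))) (z : HTensor E G) : p z := by
  refine (denseRange_tensorIncl E G).induction_on (p := p) z hc fun t => ?_
  induction t using TensorProduct.induction_on with
  | zero =>
    rw [map_zero]
    simpa using hp 0 0
  | tmul x g => exact hp x g
  | add x y hx hy => rw [map_add]; exact hadd _ _ hx hy

theorem clm_ext_htensor {F : Type*} [NormedAddCommGroup F] [InnerProductSpace ℂ F]
    {S T : HTensor E G →L[ℂ] F}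
    (h : ∀ x g, S (tensorIncl E G (x ⊗ₜ g)) = T (tensorIncl E G (x ⊗ₜ g))) : S = T := by
  ext z
  refine htensor_induction (isClosed_eq (by fun_prop) (by fun_prop)) (fun x y hx hy => ?_) h z
  rw [map_add, map_add, hx, hy]

theorem ampliation_mul (X Y : E →L[ℂ] E) :
    ampliation (X * Y) G = ampliation X G * ampliation Y G :=
  clm_ext_htensor fun x g => by
    change _ = ampliation X G (ampliation Y G _)
    simp only [ampliation_tensorIncl_tmul]
    rfl

theorem ampliation_one : ampliation (1 : E →L[ℂ] E) G = 1 :=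
  clm_ext_htensor fun x g => by rw [ampliation_tensorIncl_tmul]; rfl

theorem ampliation_add (X Y : E →L[ℂ] E) :
    ampliation (X + Y) G = ampliation X G + ampliation Y G :=
  clm_ext_htensor fun x g => by
    simp [ampliation_tensorIncl_tmul, TensorProduct.add_tmul]

theorem ampliation_sub (X Y : E →L[ℂ] E) :
    ampliation (X - Y) G = ampliation X G - ampliation Y G :=
  clm_ext_htensor fun x g => by
    simp [ampliation_tensorIncl_tmul, TensorProduct.sub_tmul]

theorem ampliation_smul (c : ℂ) (X : E →L[ℂ] E) :
    ampliation (c • X) G = c • ampliation X G :=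
  clm_ext_htensor fun x g => by
    rw [ampliation_tensorIncl_tmul, _root_.smul_apply, _root_.smul_apply,
      ampliation_tensorIncl_tmul, ← TensorProduct.smul_tmul', map_smul]

theorem norm_ampliation_le (X : E →L[ℂ] E) : ‖ampliation X G‖ ≤ ‖X‖ := by
  refine ContinuousLinearMap.opNorm_le_bound _ (norm_nonneg _) fun z => ?_
  induction z using UniformSpace.Completion.induction_on with
  | hp => exact isClosed_le (by fun_prop) (by fun_prop)
  | ih t =>
    rw [ampliation, ContinuousLinearMap.completion_apply_coe, UniformSpace.Completion.norm_coe,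
      UniformSpace.Completion.norm_coe]
    exact (ContinuousLinearMap.le_opNorm _ _).trans
      (mul_le_mul_of_nonneg_right (ContinuousLinearMap.norm_rTensor_le _ _) (norm_nonneg _))

theorem ampliation_adjoint [CompleteSpace E] (X : E →L[ℂ] E) :
    ampliation (ContinuousLinearMap.adjoint X) G = ContinuousLinearMap.adjoint (ampliation X G) := by
  rw [ContinuousLinearMap.eq_adjoint_iff]
  intro z w
  refine htensor_induction (p := fun z => inner ℂ (ampliation (ContinuousLinearMap.adjoint X) G z) w
    = inner ℂ z (ampliation X G w)) (isClosed_eq (by fun_prop) (by fun_prop))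
    (fun x y hx hy => by rw [map_add, inner_add_left, inner_add_left, hx, hy]) (fun x g => ?_) z
  refine htensor_induction (p := fun w => inner ℂ (ampliation (ContinuousLinearMap.adjoint X) G
    (tensorIncl E G (x ⊗ₜ g))) w = inner ℂ (tensorIncl E G (x ⊗ₜ g)) (ampliation X G w))
    (isClosed_eq (by fun_prop) (by fun_prop))
    (fun x y hx hy => by rw [map_add, inner_add_right, inner_add_right, hx, hy])
    (fun x' g' => ?_) w
  rw [ampliation_tensorIncl_tmul, ampliation_tensorIncl_tmul, inner_tensorIncl_tmul,
    inner_tensorIncl_tmul, ContinuousLinearMap.adjoint_inner_left]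

end Tensor

/-! ### The `ℓ²` space over an index set -/

section EllTwo

variable {A : Type*} [DecidableEq A]

theorem orthonormal_single : Orthonormal ℂ fun a : A => (lp.single 2 a (1 : ℂ) : lp (fun _ : A => ℂ) 2) := by
  rw [orthonormal_iff_ite]
  intro a b
  rw [lp.inner_single_left, lp.single_apply]
  by_cases h : a = b
  · subst h; simp
  · simp [h, Pi.single_eq_of_ne]

theorem hasSum_single_lp (f : lp (fun _ : A => ℂ) 2) :
    HasSum (fun a => f a • (lp.single 2 a (1 : ℂ) : lp (fun _ : A => ℂ) 2)) f := by
  convert lp.hasSum_single (p := 2) (by norm_num) f using 1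
  funext a
  rw [← lp.single_smul, smul_eq_mul, mul_one]

theorem clm_ext_single {F : Type*} [NormedAddCommGroup F] [InnerProductSpace ℂ F]
    {S T : lp (fun _ : A => ℂ) 2 →L[ℂ] F}
    (h : ∀ a, S (lp.single 2 a (1 : ℂ)) = T (lp.single 2 a (1 : ℂ))) : S = T := by
  ext1 f
  have h1 := (hasSum_single_lp f).mapL S
  have h2 := (hasSum_single_lp f).mapL T
  simp only [map_smul, h] at h1 h2
  exact h1.unique h2

theorem htensor_ext_inner_single {G : Type*} [NormedAddCommGroup G] [InnerProductSpace ℂ G]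
    {x y : HTensor (lp (fun _ : A => ℂ) 2) G}
    (h : ∀ a g, inner ℂ x (tensorIncl _ G (lp.single 2 a (1 : ℂ) ⊗ₜ g)) =
      inner ℂ y (tensorIncl _ G (lp.single 2 a (1 : ℂ) ⊗ₜ g))) : x = y := by
  refine ext_inner_right ℂ fun z => ?_
  refine htensor_induction (p := fun z => inner ℂ x z = inner ℂ y z)
    (isClosed_eq (by fun_prop) (by fun_prop))
    (fun z w hz hw => by rw [inner_add_right, inner_add_right, hz, hw]) (fun f g => ?_) z
  let ι := (tensorIncl (lp (fun _ : A => ℂ) 2) G).toContinuousLinearMap ∘L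
    ((TensorProduct.mkL ℂ (lp (fun _ : A => ℂ) 2) G).flip g)
  have : innerSL ℂ x ∘L ι = innerSL ℂ y ∘L ι := clm_ext_single fun a => h a g
  exact congrArg (fun S => S f) this

end EllTwo

/-! ### Diagonal operators and the universal model -/

section Diagonal

variable {k : ℕ} {n : Fin k → ℕ}

/-- The basis vector `e_α`. -/
def basisVec (α : ∀ i, List (Fin (n i))) : Fock n := lp.single 2 α (1 : ℂ)

theorem inner_basisVec_left (α : ∀ i, List (Fin (n i))) (f : Fock n) :
    inner ℂ (basisVec α) f = f α := by
  rw [basisVec, lp.inner_single_left]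
  simp

theorem basisVec_apply (α β : ∀ i, List (Fin (n i))) :
    basisVec α β = if β = α then 1 else 0 := by
  rw [basisVec, lp.single_apply, Pi.single_apply]

theorem basisVec_self (α : ∀ i, List (Fin (n i))) : basisVec α α = 1 := by
  rw [basisVec_apply, if_pos rfl]

theorem hasSum_basisVec (f : Fock n) : HasSum (fun α => f α • basisVec α) f := hasSum_single_lp f

theorem clm_ext_basisVec {F : Type*} [NormedAddCommGroup F] [InnerProductSpace ℂ F]
    {S T : Fock n →L[ℂ] F} (h : ∀ α, S (basisVec α) = T (basisVec α)) : S = T :=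
  clm_ext_single h

theorem norm_basisVec (α : ∀ i, List (Fin (n i))) : ‖basisVec α‖ = 1 :=
  orthonormal_single.1 α

/-- `Y` is diagonal with respect to the basis `e_α`, with entries `y`. -/
def IsDiag (Y : Fock n →L[ℂ] Fock n) (y : (∀ i, List (Fin (n i))) → ℝ) : Prop :=
  ∀ α, Y (basisVec α) = (y α : ℂ) • basisVec α

theorem IsDiag.norm_le {Y : Fock n →L[ℂ] Fock n} {y : (∀ i, List (Fin (n i))) → ℝ}
    (hY : IsDiag Y y) {C : ℝ} (hC : ∀ α, |y α| ≤ C) : ‖Y‖ ≤ |C| := by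
  have : Y = weightedPullback y C hC id Function.injective_id := by
    refine clm_ext_basisVec fun α => ?_
    rw [hY α]
    ext β
    rw [weightedPullback_apply, lp.coeFn_smul, Pi.smul_apply, id, basisVec_apply]
    split_ifs with h
    · rw [h]; simp
    · simp
  rw [this]
  exact LinearMap.mkContinuous_norm_le _ (abs_nonneg _) _

theorem IsDiag.sub {Y Z : Fock n →L[ℂ] Fock n} {y z : (∀ i, List (Fin (n i))) → ℝ}
    (hY : IsDiag Y y) (hZ : IsDiag Z z) : IsDiag (Y - Z) (fun α => y α - z α) := by
  intro α
  rw [_root_.sub_apply, hY α, hZ α, ← sub_smul]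
  push_cast
  rfl

variable (q : ∀ i, PosRegPoly (n i)) (m : Fin k → ℕ)

theorem wordProd_model_basisVec (i : Fin k) (γ : List (Fin (n i))) (β : ∀ i, List (Fin (n i))) :
    wordProd (model q m i) γ (basisVec β) =
      ((√(bCoeff (q i) (m i) (β i)) / √(bCoeff (q i) (m i) (γ ++ β i)) : ℝ) : ℂ) •
        basisVec (Function.update β i (γ ++ β i)) := by
  induction γ with
  | nil =>
    have := (Real.sqrt_pos.2 (bCoeff_pos (q i) (m i) (β i))).ne'
    simp [wordProd_nil, div_self this]
  | cons j γ ih =>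
    have h := (Real.sqrt_pos.2 (bCoeff_pos (q i) (m i) (γ ++ β i))).ne'
    rw [wordProd_cons]
    change model q m i j (wordProd (model q m i) γ (basisVec β)) = _
    rw [ih, map_smul, basisVec, model_single, smul_smul, ← Complex.ofReal_mul]
    simp only [Function.update_self, Function.update_idem]
    rw [div_mul_div_cancel₀ h]
    rfl

theorem star_wordProd_model_basisVec (i : Fin k) (γ : List (Fin (n i)))
    (α : ∀ i, List (Fin (n i))) :
    star (wordProd (model q m i) γ) (basisVec α) =
      if (α i).take γ.length = γ then
        ((√(bCoeff (q i) (m i) ((α i).drop γ.length)) / √(bCoeff (q i) (m i) (α i)) : ℝ) : ℂ) •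
          basisVec (Function.update α i ((α i).drop γ.length))
      else 0 := by
  ext β
  rw [← inner_basisVec_left, ContinuousLinearMap.star_eq_adjoint,
    ContinuousLinearMap.adjoint_inner_right, wordProd_model_basisVec, inner_smul_left,
    Complex.conj_ofReal, inner_basisVec_left, basisVec_apply]
  by_cases h : (α i).take γ.length = γ
  · rw [if_pos h, lp.coeFn_smul, Pi.smul_apply, basisVec_apply]
    by_cases hβ : β = Function.update α i ((α i).drop γ.length)
    · subst hβ
      have h1 : γ ++ (α i).drop γ.length = α i := by
        conv_lhs => rw [← h]
        rw [List.length_take]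
        conv_rhs => rw [← List.take_append_drop γ.length (α i)]
        congr 1
        rw [← List.length_take, h]
      simp [h1]
    · rw [if_neg hβ, if_neg]
      · simp
      · intro h2
        apply hβ
        rw [← h2]
        simp
  · rw [if_neg h, if_neg]
    · simp
    · intro h2
      apply h
      rw [← h2]
      simp

/-- The adjoint strips the prefix `γ` from the `i`-th word and `W_γ` restores it. The two square
root weights coincide and multiply to a ratio of coefficients. -/
theorem conj_model_basisVec {Y : Fock n →L[ℂ] Fock n} {y : (∀ i, List (Fin (n i))) → ℝ}
    (hY : IsDiag Y y) (i : Fin k) (γ : List (Fin (n i))) (α : ∀ i, List (Fin (n i))) :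
    (wordProd (model q m i) γ * Y * star (wordProd (model q m i) γ)) (basisVec α) =
      ((if (α i).take γ.length = γ then
        bCoeff (q i) (m i) ((α i).drop γ.length) / bCoeff (q i) (m i) (α i) *
          y (Function.update α i ((α i).drop γ.length)) else 0 : ℝ) : ℂ) • basisVec α := by
  change wordProd (model q m i) γ (Y (star (wordProd (model q m i) γ) (basisVec α))) = _
  rw [star_wordProd_model_basisVec]
  split_ifs with h
  · have h1 : γ ++ (α i).drop γ.length = α i := by
      nth_rw 1 [← h]
      exact List.take_append_drop _ _
    have hb := bCoeff_pos (q i) (m i) (α i)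
    have hb' := bCoeff_pos (q i) (m i) ((α i).drop γ.length)
    rw [map_smul, hY, map_smul, map_smul, wordProd_model_basisVec]
    simp only [Function.update_self, Function.update_idem, h1, Function.update_eq_self, smul_smul]
    rw [← Complex.ofReal_mul, ← Complex.ofReal_mul]
    congr 2
    have e1 := Real.mul_self_sqrt hb.le
    have e2 := Real.mul_self_sqrt hb'.le
    have e3 := (Real.sqrt_pos.2 hb).ne'
    conv_rhs => rw [← e1, ← e2]
    field_simp
  · simp

/-- A sum over the words in the support of `q` that are prefixes of `α`. -/
theorem sum_support_prefix {n : ℕ} (q : PosRegPoly n) (α : List (Fin n)) (F : ℕ → ℝ) :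
    ∑ γ ∈ q.coeff.support, q.coeff γ * (if α.take γ.length = γ then F γ.length else 0) =
      ∑ l ∈ Finset.range α.length, q.coeff (α.take (l + 1)) * F (l + 1) := by
  have h1 : ∀ γ ∈ q.coeff.support,
      q.coeff γ * (if α.take γ.length = γ then F γ.length else 0) =
      ∑ l ∈ Finset.range α.length,
        if γ = α.take (l + 1) then q.coeff γ * F (l + 1) else 0 := by
    intro γ hγ
    have hne : γ ≠ [] := by
      rintro rfl
      exact Finsupp.mem_support_iff.1 hγ q.coeff_nil
    have hpos : 0 < γ.length := List.length_pos_iff.2 hne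
    split_ifs with h
    · have hlen : γ.length ≤ α.length := by
        have := congrArg List.length h
        rw [List.length_take] at this
        omega
      rw [Finset.sum_eq_single (γ.length - 1)]
      · rw [Nat.sub_add_cancel hpos, if_pos h.symm]
      · intro l hl hne
        rw [if_neg]
        intro h2
        have := congrArg List.length h2
        rw [List.length_take] at this
        have := Finset.mem_range.1 hl
        omega
      · intro h2
        exact absurd (Finset.mem_range.2 (by omega)) h2
    · rw [mul_zero, Finset.sum_eq_zero]
      intro l hl
      rw [if_neg]
      intro h2
      apply h
      have h3 := congrArg List.length h2
      rw [List.length_take] at h3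
      have := Finset.mem_range.1 hl
      rw [h3, min_eq_left (by omega)]
      exact h2.symm
  rw [Finset.sum_congr rfl h1, Finset.sum_comm]
  refine Finset.sum_congr rfl fun l _ => ?_
  rw [Finset.sum_ite_eq']
  split_ifs with h
  · rfl
  · rw [Finsupp.notMem_support_iff.1 h, zero_mul]

theorem isDiag_Phi {Y : Fock n →L[ℂ] Fock n} {y : (∀ i, List (Fin (n i))) → ℝ}
    (hY : IsDiag Y y) (i : Fin k) :
    IsDiag (Phi (q i) (model q m i) Y) fun α => ∑ l ∈ Finset.range (α i).length,
      (q i).coeff ((α i).take (l + 1)) *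
        (bCoeff (q i) (m i) ((α i).drop (l + 1)) / bCoeff (q i) (m i) (α i) *
          y (Function.update α i ((α i).drop (l + 1)))) := by
  intro α
  dsimp only
  rw [Phi_apply, sum_apply, ← sum_support_prefix (q i) (α i) fun l =>
    bCoeff (q i) (m i) ((α i).drop l) / bCoeff (q i) (m i) (α i) *
          y (Function.update α i ((α i).drop l))]
  rw [Complex.ofReal_sum, Finset.sum_smul]
  refine Finset.sum_congr rfl fun γ _ => ?_
  rw [_root_.smul_apply, conj_model_basisVec q m hY, smul_smul, ← Complex.ofReal_mul]

/-- After the factor `1 / b` is cleared, subtracting `Φ_i` is the recursion `serCoeff_succ` read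
backwards, so each application lowers the index of `serCoeff` by one. The factor `R` carries the
other coordinates. -/
theorem isDiag_one_sub_Phi_pow (i : Fin k) {Y : Fock n →L[ℂ] Fock n}
    {R : (∀ i, List (Fin (n i))) → ℝ} (hR : ∀ α δ, R (Function.update α i δ) = R α) (r p : ℕ)
    (hY : IsDiag Y fun α => serCoeff (q i) (r + p) (α i) / bCoeff (q i) (m i) (α i) * R α) :
    IsDiag (((1 - Phi (q i) (model q m i)) ^ p) Y)
      fun α => serCoeff (q i) r (α i) / bCoeff (q i) (m i) (α i) * R α := by
  induction p generalizing Y with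
  | zero => simpa using hY
  | succ p ih =>
    rw [pow_succ, Module.End.mul_apply]
    refine ih ?_
    rw [LinearMap.sub_apply, Module.End.one_apply]
    convert hY.sub (isDiag_Phi q m hY i) using 1
    funext α
    have hb := (bCoeff_pos (q i) (m i) (α i)).ne'
    simp only [Function.update_self, hR]
    have : ∀ l, (q i).coeff ((α i).take (l + 1)) *
        (bCoeff (q i) (m i) ((α i).drop (l + 1)) / bCoeff (q i) (m i) (α i) *
          (serCoeff (q i) (r + (p + 1)) ((α i).drop (l + 1)) /
            bCoeff (q i) (m i) ((α i).drop (l + 1)) * R α)) =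
        (q i).coeff ((α i).take (l + 1)) * serCoeff (q i) (r + (p + 1)) ((α i).drop (l + 1)) *
          (R α / bCoeff (q i) (m i) (α i)) := by
      intro l
      have hb' := (bCoeff_pos (q i) (m i) ((α i).drop (l + 1))).ne'
      field_simp
    simp only [this]
    rw [← Finset.sum_mul, ← add_assoc, serCoeff_succ]
    field_simp
    ring

/-- The identity has entries `serCoeff / bCoeff = 1` at index `m_i`, and each family lowers its own
index by `p_i`. Two cases matter: `p = m`, where only the empty words survive, and `p = (1, …, 1)`,
where the entries tend to zero. -/
theorem isDiag_defect_model (hm : ∀ i, 1 ≤ m i) (p : Fin k → ℕ) (hp : ∀ i, p i ≤ m i) :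
    IsDiag (defect q p (model q m) 1)
      fun α => ∏ i, serCoeff (q i) (m i - p i) (α i) / bCoeff (q i) (m i) (α i) := by
  have key : ∀ l : List (Fin k), l.Nodup →
      IsDiag ((l.map fun i => (1 - Phi (q i) (model q m i)) ^ p i).prod 1)
        fun α => (l.map fun i =>
          serCoeff (q i) (m i - p i) (α i) / bCoeff (q i) (m i) (α i)).prod := by
    intro l hl
    induction l with
    | nil => intro α; simp
    | cons i l ih =>
      obtain ⟨hi, hl⟩ := List.nodup_cons.1 hl
      simp only [List.map_cons, List.prod_cons, Module.End.mul_apply]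
      refine isDiag_one_sub_Phi_pow q m i ?_ _ _ ?_
      · intro α δ
        congr 1
        refine List.map_congr_left fun j hj => ?_
        rw [Function.update_of_ne (by rintro rfl; exact hi hj)]
      · convert ih hl using 1
        funext α
        rw [Nat.sub_add_cancel (hp i), bCoeff_eq_serCoeff (q i) (hm i), div_self, one_mul]
        rw [← bCoeff_eq_serCoeff (q i) (hm i)]
        exact (bCoeff_pos _ _ _).ne'
  have := key (List.finRange k) (List.nodup_finRange k)
  simpa only [defect, List.ofFn_eq_map, ← List.prod_ofFn] using this

end Diagonal

/-! ### The `C^*`-algebra of the universal model -/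

theorem isClosed_cstarOf {k : ℕ} {n : Fin k → ℕ} {E : Type*} [NormedAddCommGroup E]
    [InnerProductSpace ℂ E] [CompleteSpace E] (X : ∀ i, Fin (n i) → (E →L[ℂ] E)) :
    IsClosed (cstarOf X : Set (E →L[ℂ] E)) :=
  StarSubalgebra.isClosed_topologicalClosure _

attribute [local instance] isClosed_cstarOf

section CstarModel

variable {k : ℕ} {n : Fin k → ℕ}

section General

variable {E : Type*} [NormedAddCommGroup E] [InnerProductSpace ℂ E] [CompleteSpace E]

theorem closure_adjoin_induction {s : Set (E →L[ℂ] E)} {S : StarSubalgebra ℂ (E →L[ℂ] E)}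
    (hle : StarAlgebra.adjoin ℂ s ≤ S)
    (hS : ∀ x ∈ S, x ∈ closure (StarAlgebra.adjoin ℂ s : Set (E →L[ℂ] E))) {p : S → Prop}
    (hc : IsClosed {x | p x}) (hgen : ∀ x (hx : x ∈ s), p ⟨x, hle (StarAlgebra.subset_adjoin ℂ s hx)⟩)
    (halg : ∀ c : ℂ, p (algebraMap ℂ _ c)) (hadd : ∀ x y, p x → p y → p (x + y))
    (hmul : ∀ x y, p x → p y → p (x * y)) (hstar : ∀ x, p x → p (star x)) (x : S) :
    p x := by
  have h1 : ∀ y (hy : y ∈ StarAlgebra.adjoin ℂ s), p ⟨y, hle hy⟩ := by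
    intro y hy
    induction hy using StarAlgebra.adjoin_induction with
    | mem y hy => exact hgen y hy
    | algebraMap c =>
      have e : (⟨algebraMap ℂ (E →L[ℂ] E) c, hle (algebraMap_mem _ c)⟩ : S) = algebraMap ℂ S c :=
        Subtype.ext rfl
      rw [e]
      exact halg c
    | add x y hx hy hpx hpy =>
      have e : (⟨x + y, hle (add_mem hx hy)⟩ : S) = ⟨x, hle hx⟩ + ⟨y, hle hy⟩ := Subtype.ext rfl
      rw [e]
      exact hadd _ _ hpx hpy
    | mul x y hx hy hpx hpy =>
      have e : (⟨x * y, hle (mul_mem hx hy)⟩ : S) = ⟨x, hle hx⟩ * ⟨y, hle hy⟩ := Subtype.ext rfl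
      rw [e]
      exact hmul _ _ hpx hpy
    | star x hx hpx =>
      have e : (⟨star x, hle (star_mem hx)⟩ : S) = star ⟨x, hle hx⟩ := Subtype.ext rfl
      rw [e]
      exact hstar _ hpx
  have h2 : x ∈ closure {x : S | (x : E →L[ℂ] E) ∈ StarAlgebra.adjoin ℂ s} := by
    rw [closure_subtype]
    refine closure_mono ?_ (hS _ x.2)
    exact fun y hy => ⟨⟨y, hle hy⟩, hy, rfl⟩
  exact hc.closure_subset_iff.2 (fun y hy => h1 y hy) h2

theorem cstarOf_induction {X : ∀ i, Fin (n i) → (E →L[ℂ] E)} {p : cstarOf X → Prop}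
    (hc : IsClosed {x | p x}) (hgen : ∀ i j, p ⟨X i j, mem_cstarOf X i j⟩)
    (halg : ∀ c : ℂ, p (algebraMap ℂ _ c)) (hadd : ∀ x y, p x → p y → p (x + y))
    (hmul : ∀ x y, p x → p y → p (x * y)) (hstar : ∀ x, p x → p (star x)) (x : cstarOf X) :
    p x :=
  closure_adjoin_induction (s := {Y | ∃ i j, Y = X i j})
    (StarSubalgebra.le_topologicalClosure _) (fun _ hx => hx) hc
    (fun x hx => by obtain ⟨i, j, rfl⟩ := hx; exact hgen i j) halg hadd hmul hstar x

/-- A dense subalgebra is spanned by the countably many words in finitely many generators and their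
adjoints. -/
theorem isSeparable_cstarOf (X : ∀ i, Fin (n i) → (E →L[ℂ] E)) :
    TopologicalSpace.IsSeparable (cstarOf X : Set (E →L[ℂ] E)) := by
  refine TopologicalSpace.IsSeparable.closure (s := (StarAlgebra.adjoin ℂ
    {Y | ∃ i j, Y = X i j} : Set (E →L[ℂ] E))) ?_
  have h := congrArg (fun S : Submodule ℂ (E →L[ℂ] E) => (S : Set (E →L[ℂ] E)))
    (StarAlgebra.adjoin_eq_span (R := ℂ) {Y | ∃ i j, Y = X i j})
  refine (congrArg TopologicalSpace.IsSeparable h).mpr ?_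
  refine TopologicalSpace.IsSeparable.span (Set.Countable.isSeparable ?_)
  set s : Set (E →L[ℂ] E) := {Y | ∃ i j, Y = X i j} ∪ star {Y | ∃ i j, Y = X i j}
  have hfin : {Y | ∃ i j, Y = X i j}.Finite := by
    refine (Set.finite_range fun x : Σ i, Fin (n i) => X x.1 x.2).subset ?_
    rintro _ ⟨i, j, rfl⟩
    exact ⟨⟨i, j⟩, rfl⟩
  have hs : Countable s := (hfin.union hfin.star).countable.to_subtype
  have : Countable (FreeMonoid s) := inferInstanceAs (Countable (List s))
  rw [Submonoid.closure_eq_mrange, MonoidHom.coe_mrange]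
  exact Set.countable_range _

end General

variable (q : ∀ i, PosRegPoly (n i)) (m : Fin k → ℕ)

variable (n) in
/-- The vacuum vector. -/
def vacuum : Fock n := basisVec fun _ => []

theorem exists_multiWordProd_model_vacuum (α : ∀ i, List (Fin (n i))) :
    ∃ c : ℂ, c ≠ 0 ∧ multiWordProd (model q m) α (vacuum n) = c • basisVec α := by
  have key : ∀ l : List (Fin k), l.Nodup → ∃ c : ℂ, c ≠ 0 ∧
      (l.map fun i => wordProd (model q m i) (α i)).prod (vacuum n) =
        c • basisVec (fun i => if i ∈ l then α i else []) := by
    intro l hl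
    induction l with
    | nil => exact ⟨1, one_ne_zero, by simp [vacuum]⟩
    | cons i l ih =>
      obtain ⟨hi, hl⟩ := List.nodup_cons.1 hl
      obtain ⟨c, hc, h⟩ := ih hl
      refine ⟨c * ((√(bCoeff (q i) (m i) []) / √(bCoeff (q i) (m i) (α i)) : ℝ) : ℂ), ?_, ?_⟩
      · have h1 := Real.sqrt_pos.2 (bCoeff_pos (q i) (m i) (α i))
        have h2 := Real.sqrt_pos.2 (bCoeff_pos (q i) (m i) [])
        exact mul_ne_zero hc (Complex.ofReal_ne_zero.2 (div_pos h2 h1).ne')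
      · rw [List.map_cons, List.prod_cons]
        change wordProd (model q m i) (α i)
          ((l.map fun i => wordProd (model q m i) (α i)).prod (vacuum n)) = _
        rw [h, map_smul, wordProd_model_basisVec, smul_smul]
        simp only [if_neg hi, List.append_nil]
        congr 2
        funext j
        by_cases hj : j = i
        · subst hj; simp
        · simp [hj]
  obtain ⟨c, hc, h⟩ := key (List.finRange k) (List.nodup_finRange k)
  refine ⟨c, hc, ?_⟩
  simpa [multiWordProd, List.ofFn_eq_map] using h

/-- The defect operator of the universal model, as an element of the `C^*`-algebra. -/
def vacProj : CstarW q m := defect q m (genW q m) 1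

theorem coe_defect_genW (p : Fin k → ℕ) :
    ((defect q p (genW q m) 1 : CstarW q m) : Fock n →L[ℂ] Fock n) =
      defect q p (model q m) 1 :=
  starAlgHom_defect (cstarOf (model q m)).subtype (genW q m) q p

variable {m} in
theorem vacProj_basisVec (hm : ∀ i, 1 ≤ m i) (α : ∀ i, List (Fin (n i))) :
    (vacProj q m : Fock n →L[ℂ] Fock n) (basisVec α) =
      (if α = fun _ => [] then (1 : ℂ) else 0) • basisVec α := by
  rw [vacProj, coe_defect_genW, isDiag_defect_model q m hm m fun _ => le_rfl]
  congr 1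
  beta_reduce
  split_ifs with h
  · rw [h, Finset.prod_eq_one]
    · simp
    · intro i _
      rw [Nat.sub_self, serCoeff_nil, bCoeff_nil, div_one]
  · obtain ⟨i, hi⟩ : ∃ i, α i ≠ [] := by
      by_contra! h2
      exact h (funext h2)
    rw [Finset.prod_eq_zero (Finset.mem_univ i)]
    · simp
    · rw [Nat.sub_self, serCoeff_zero, if_neg hi, zero_div]

variable {m} in
-- At index zero `serCoeff` is the indicator of the empty word, so every diagonal entry except the
-- one at the vacuum vanishes.
theorem coe_vacProj (hm : ∀ i, 1 ≤ m i) :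
    (vacProj q m : Fock n →L[ℂ] Fock n) =
      InnerProductSpace.rankOne ℂ (vacuum n) (vacuum n) := by
  refine clm_ext_basisVec fun α => ?_
  rw [vacProj_basisVec q hm, InnerProductSpace.rankOne_apply, vacuum, inner_basisVec_left,
    basisVec_apply]
  by_cases h : α = fun _ => []
  · subst h; simp
  · rw [if_neg h, if_neg (Ne.symm h)]; simp

theorem coe_multiWordProd_genW (α : ∀ i, List (Fin (n i))) :
    ((multiWordProd (genW q m) α : CstarW q m) : Fock n →L[ℂ] Fock n) =
      multiWordProd (model q m) α := by
  have h1 : ∀ i γ, ((wordProd (genW q m i) γ : CstarW q m) : Fock n →L[ℂ] Fock n) =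
      wordProd (model q m i) γ := by
    intro i γ
    have := map_list_prod (cstarOf (model q m)).subtype (γ.map (genW q m i))
    rw [List.map_map] at this
    exact this
  have := map_list_prod (cstarOf (model q m)).subtype
    (List.ofFn fun i => wordProd (genW q m i) (α i))
  rw [List.map_ofFn] at this
  refine Eq.trans this ?_
  rw [multiWordProd]
  congr 2
  funext i
  exact h1 i (α i)

variable {m} in
theorem rankOne_mem (hm : ∀ i, 1 ≤ m i) (ξ : Fock n) :
    InnerProductSpace.rankOne ℂ ξ (vacuum n) ∈ cstarOf (model q m) := by
  -- The vacuum is cyclic: `W_α` maps it to a nonzero multiple of `e_α`, so `W_α P` is a nonzero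
  -- multiple of the operator in question. General `ξ` follow by norm limits.
  have h1 : ∀ α, InnerProductSpace.rankOne ℂ (basisVec α) (vacuum n) ∈ cstarOf (model q m) := by
    intro α
    obtain ⟨c, hc, h⟩ := exists_multiWordProd_model_vacuum q m α
    have h2 : InnerProductSpace.rankOne ℂ (basisVec α) (vacuum n) =
        c⁻¹ • (((multiWordProd (genW q m) α * vacProj q m : CstarW q m)) :
          Fock n →L[ℂ] Fock n) := by
      rw [MulMemClass.coe_mul, coe_multiWordProd_genW, coe_vacProj q hm]
      ext1 f
      change _ = c⁻¹ • multiWordProd (model q m) α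
        (InnerProductSpace.rankOne ℂ (vacuum n) (vacuum n) f)
      rw [InnerProductSpace.rankOne_apply, InnerProductSpace.rankOne_apply, map_smul, h,
        smul_comm, inv_smul_smul₀ hc]
    rw [h2]
    exact (cstarOf (model q m)).smul_mem (SetLike.coe_mem _) _
  have h2 := (hasSum_basisVec ξ).mapL ((InnerProductSpace.rankOne ℂ).flip (vacuum n))
  refine (isClosed_cstarOf (model q m)).mem_of_tendsto h2 (Filter.Eventually.of_forall fun s => ?_)
  refine sum_mem fun α _ => ?_
  rw [map_smul]
  exact (cstarOf (model q m)).smul_mem (h1 α) _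

variable {q m}

/-- The rank one operator `f ↦ ⟪e_∅, f⟫ ξ`, as an element of the `C^*`-algebra. -/
def theta (hm : ∀ i, 1 ≤ m i) (ξ : Fock n) : CstarW q m :=
  ⟨InnerProductSpace.rankOne ℂ ξ (vacuum n), rankOne_mem q hm ξ⟩

variable (hm : ∀ i, 1 ≤ m i)

theorem coe_theta_apply (ξ f : Fock n) :
    ((theta hm ξ : CstarW q m) : Fock n →L[ℂ] Fock n) f = inner ℂ (vacuum n) f • ξ := by
  rw [theta, InnerProductSpace.rankOne_apply]

theorem inner_vacuum_self : inner ℂ (vacuum n) (vacuum n) = (1 : ℂ) := by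
  rw [vacuum, inner_basisVec_left, basisVec_self]

theorem mul_theta (X : CstarW q m) (ξ : Fock n) :
    X * theta hm ξ = theta hm ((X : Fock n →L[ℂ] Fock n) ξ) := by
  apply Subtype.ext
  ext1 f
  rw [coe_theta_apply]
  change (X : Fock n →L[ℂ] Fock n) (((theta hm ξ : CstarW q m) : Fock n →L[ℂ] Fock n) f) = _
  rw [coe_theta_apply, map_smul]

theorem theta_vacuum : theta hm (vacuum n) = vacProj q m :=
  Subtype.ext (coe_vacProj q hm).symm

theorem theta_mul_vacProj (ξ : Fock n) : theta hm ξ * vacProj q m = theta hm ξ := by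
  rw [← theta_vacuum hm, mul_theta, coe_theta_apply, inner_vacuum_self, one_smul]

theorem vacProj_mul_self (hm : ∀ i, 1 ≤ m i) : vacProj q m * vacProj q m = vacProj q m := by
  have h := theta_mul_vacProj (q := q) hm (vacuum n)
  rwa [theta_vacuum] at h

/-- Together with `mul_theta` this is the whole algebraic input of the Wold decomposition: inner
products of vectors `π(θ(ξ)) g` reduce to the range of `π(P)`. -/
theorem star_theta_mul_theta (ξ η : Fock n) :
    star (theta hm ξ) * theta hm η = inner ℂ ξ η • vacProj q m := by
  apply Subtype.ext
  change ContinuousLinearMap.adjoint (InnerProductSpace.rankOne ℂ ξ (vacuum n)) *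
    InnerProductSpace.rankOne ℂ η (vacuum n) = inner ℂ ξ η • (vacProj q m : Fock n →L[ℂ] Fock n)
  rw [InnerProductSpace.adjoint_rankOne, coe_vacProj q hm]
  ext1 f
  change InnerProductSpace.rankOne ℂ (vacuum n) ξ (InnerProductSpace.rankOne ℂ η (vacuum n) f) = _
  simp [smul_smul, mul_comm]

theorem star_vacProj (hm : ∀ i, 1 ≤ m i) : star (vacProj q m) = vacProj q m := by
  apply Subtype.ext
  change ContinuousLinearMap.adjoint (vacProj q m : Fock n →L[ℂ] Fock n) = _
  rw [coe_vacProj q hm, InnerProductSpace.adjoint_rankOne]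

variable (q) in
/-- `theta` as a continuous linear map. -/
def thetaL : Fock n →L[ℂ] CstarW q m :=
  LinearMap.mkContinuous
    { toFun := theta hm
      map_add' := fun ξ η => Subtype.ext (by
        change InnerProductSpace.rankOne ℂ _ _ = InnerProductSpace.rankOne ℂ _ _ +
          InnerProductSpace.rankOne ℂ _ _
        rw [map_add]
        rfl)
      map_smul' := fun c ξ => Subtype.ext (by
        change InnerProductSpace.rankOne ℂ _ _ = c • InnerProductSpace.rankOne ℂ _ _
        rw [map_smul]
        rfl) } 1 fun ξ => by
    change ‖InnerProductSpace.rankOne ℂ ξ (vacuum n)‖ ≤ _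
    rw [InnerProductSpace.norm_rankOne, vacuum, norm_basisVec, mul_one, one_mul]

theorem thetaL_apply (ξ : Fock n) : thetaL q hm ξ = theta hm ξ := rfl

theorem exists_multiWordProd_mul_vacProj (α : ∀ i, List (Fin (n i))) :
    ∃ c : ℂ, c ≠ 0 ∧ multiWordProd (genW q m) α * vacProj q m = c • theta hm (basisVec α) := by
  obtain ⟨c, hc, h⟩ := exists_multiWordProd_model_vacuum q m α
  refine ⟨c, hc, ?_⟩
  rw [← theta_vacuum hm, mul_theta, coe_multiWordProd_genW, h, ← thetaL_apply, ← thetaL_apply,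
    map_smul]

/-! ### Representations annihilating the vacuum projection -/

variable (q) in
/-- The projection onto the span of finitely many basis vectors. -/
def coordProj (S : Finset (∀ i, List (Fin (n i)))) : CstarW q m :=
  ∑ α ∈ S, theta hm (basisVec α) * star (theta hm (basisVec α))

theorem isDiag_coordProj (S : Finset (∀ i, List (Fin (n i)))) :
    IsDiag (coordProj q hm S : Fock n →L[ℂ] Fock n) fun α => if α ∈ S then 1 else 0 := by
  intro β
  have h1 : ∀ α, ((theta hm (basisVec α) * star (theta hm (basisVec α)) : CstarW q m) :
      Fock n →L[ℂ] Fock n) = InnerProductSpace.rankOne ℂ (basisVec α) (basisVec α) := by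
    intro α
    change InnerProductSpace.rankOne ℂ (basisVec α) (vacuum n) *
      ContinuousLinearMap.adjoint (InnerProductSpace.rankOne ℂ (basisVec α) (vacuum n)) = _
    rw [InnerProductSpace.adjoint_rankOne]
    ext1 f
    change InnerProductSpace.rankOne ℂ (basisVec α) (vacuum n)
      (InnerProductSpace.rankOne ℂ (vacuum n) (basisVec α) f) = _
    rw [InnerProductSpace.rankOne_apply, InnerProductSpace.rankOne_apply,
      InnerProductSpace.rankOne_apply, inner_smul_right, inner_vacuum_self, mul_one]
  have h2 : (coordProj q hm S : Fock n →L[ℂ] Fock n) =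
      ∑ α ∈ S, InnerProductSpace.rankOne ℂ (basisVec α) (basisVec α) := by
    rw [coordProj, AddSubmonoidClass.coe_finsetSum]
    exact Finset.sum_congr rfl fun α _ => h1 α
  rw [h2, sum_apply]
  have h3 : ∀ α, InnerProductSpace.rankOne ℂ (basisVec α) (basisVec α) (basisVec β) =
      if α = β then basisVec β else 0 := by
    intro α
    rw [InnerProductSpace.rankOne_apply, inner_basisVec_left, basisVec_apply]
    split_ifs with h
    · rw [h, one_smul]
    · rw [zero_smul]
  simp only [h3, Finset.sum_ite_eq']
  split_ifs <;> simp

theorem norm_sub_coordProj_le_one (S : Finset (∀ i, List (Fin (n i)))) :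
    ‖(1 : Fock n →L[ℂ] Fock n) - coordProj q hm S‖ ≤ 1 := by
  have h1 : IsDiag (1 : Fock n →L[ℂ] Fock n) fun _ => 1 := fun α => by simp
  have := (h1.sub (isDiag_coordProj (q := q) hm S)).norm_le (C := 1) (fun α => by
    split_ifs <;> simp)
  simpa using this

theorem tendsto_coordProj (f : Fock n) :
    Filter.Tendsto (fun S => (coordProj q hm S : Fock n →L[ℂ] Fock n) f) Filter.atTop
      (nhds f) := by
  have h0 := hasSum_basisVec f
  rw [HasSum, SummationFilter.unconditional_filter] at h0
  refine h0.congr fun S => ?_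
  have h := (isDiag_coordProj (q := q) hm S)
  have h1 := (hasSum_basisVec f).mapL (coordProj q hm S : Fock n →L[ℂ] Fock n)
  have h2 : (coordProj q hm S : Fock n →L[ℂ] Fock n) f = ∑ α ∈ S, f α • basisVec α := by
    refine h1.unique ?_
    convert hasSum_sum_of_ne_finset_zero (s := S)
      (f := fun α => f α • (if α ∈ S then (1 : ℂ) else 0) • (basisVec α : Fock n)) ?_ using 1
    · funext α
      rw [map_smul, h α]
      by_cases hα : α ∈ S <;> simp [hα]
    · exact Finset.sum_congr rfl fun α hα => by rw [if_pos hα, one_smul]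
    · intro α hα
      rw [if_neg hα]; simp
    · infer_instance
  exact h2.symm

variable {B : Type*} [NonUnitalCStarAlgebra B]

/-- Since `θ(ξ) = θ(ξ) P`, the kernel of `π` contains all `θ(ξ)` and so the coordinate projections.
The rest is contractivity of `π`. -/
theorem map_eq_zero_of_approx (hm : ∀ i, 1 ≤ m i) (π : CstarW q m →⋆ₙₐ[ℂ] B) (hπ : π (vacProj q m) = 0)
    (X : CstarW q m) (hX : ∀ ε > 0, ∃ S, ‖(X : Fock n →L[ℂ] Fock n) -
      (coordProj q hm S : Fock n →L[ℂ] Fock n) * X‖ ≤ ε) : π X = 0 := by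
  have h1 : ∀ ξ, π (theta hm ξ) = 0 := fun ξ => by
    rw [← theta_mul_vacProj, map_mul, hπ, mul_zero]
  have h2 : ∀ S, π (coordProj q hm S) = 0 := fun S => by
    rw [coordProj, map_sum]
    exact Finset.sum_eq_zero fun α _ => by rw [map_mul, h1, zero_mul]
  refine norm_le_zero_iff.1 (le_of_forall_pos_le_add fun ε hε => ?_)
  obtain ⟨S, hS⟩ := hX ε hε
  have h3 : π X = π (X - coordProj q hm S * X) := by
    rw [map_sub, map_mul, h2, zero_mul, sub_zero]
  rw [h3, zero_add]
  exact (NonUnitalStarAlgHom.norm_apply_le π _).trans hS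

theorem annihilatesCompacts_of_vacProj (hm : ∀ i, 1 ≤ m i) (π : CstarW q m →⋆ₙₐ[ℂ] B)
    (hπ : π (vacProj q m) = 0) : AnnihilatesCompacts π := by
  intro X hX
  refine map_eq_zero_of_approx hm π hπ X fun ε hε => ?_
  obtain ⟨C, hC, hsub⟩ := hX.image_closedBall_subset_compact
    (f := ((X : Fock n →L[ℂ] Fock n) : Fock n →ₗ[ℂ] Fock n)) 1
  -- The projections converge strongly to the identity; on a relatively compact image a finite net
  -- makes the convergence uniform.
  obtain ⟨t, -, htf, ht⟩ := hC.finite_cover_balls (e := ε / 2) (by positivity)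
  have h1 : ∀ y ∈ t, ∀ᶠ S in Filter.atTop,
      ‖(coordProj q hm S : Fock n →L[ℂ] Fock n) y - y‖ < ε / 2 := fun y _ => by
    simpa [dist_eq_norm] using (tendsto_coordProj (q := q) hm y).eventually
      (Metric.ball_mem_nhds y (by positivity : 0 < ε / 2))
  obtain ⟨S, hS⟩ := ((Filter.eventually_all_finite htf).2 h1).exists
  refine ⟨S, ContinuousLinearMap.opNorm_le_of_unit_norm hε.le fun f hf => ?_⟩
  have hmem : (X : Fock n →L[ℂ] Fock n) f ∈ C := hsub ⟨f, by simp [hf], rfl⟩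
  obtain ⟨y, hy, hyb⟩ := Set.mem_iUnion₂.1 (ht hmem)
  rw [Metric.mem_ball, dist_eq_norm] at hyb
  set g := (X : Fock n →L[ℂ] Fock n) f with hg
  have e1 : ((X : Fock n →L[ℂ] Fock n) - (coordProj q hm S : Fock n →L[ℂ] Fock n) * X) f =
      ((1 : Fock n →L[ℂ] Fock n) - coordProj q hm S) (g - y) -
        ((coordProj q hm S : Fock n →L[ℂ] Fock n) y - y) := by
    change g - (coordProj q hm S : Fock n →L[ℂ] Fock n) g = _
    rw [_root_.sub_apply, one_apply_eq_self, map_sub]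
    abel
  rw [e1]
  calc _ ≤ ‖((1 : Fock n →L[ℂ] Fock n) - coordProj q hm S) (g - y)‖ +
        ‖(coordProj q hm S : Fock n →L[ℂ] Fock n) y - y‖ := norm_sub_le _ _
    _ ≤ 1 * ‖g - y‖ + ε / 2 := by
        gcongr
        · exact ContinuousLinearMap.le_of_opNorm_le _ (norm_sub_coordProj_le_one hm S) _
        · exact (hS y hy).le
    _ ≤ ε := by linarith

/-- Each factor of the diagonal entry is at most `1`, and by `length_mul_serCoeff_le` it is small at
long words. Only finitely many tuples consist of short words alone, so the operator is approximated
by its finite coordinate compressions. -/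
theorem map_defect_one_eq_zero_of_vacProj (hm : ∀ i, 1 ≤ m i) (π : CstarW q m →⋆ₙₐ[ℂ] B)
    (hπ : π (vacProj q m) = 0) : π (defect q (fun _ => 1) (genW q m) 1) = 0 := by
  refine map_eq_zero_of_approx hm π hπ _ fun ε hε => ?_
  rw [coe_defect_genW]
  set y : (∀ i, List (Fin (n i))) → ℝ := fun α =>
    ∏ i, serCoeff (q i) (m i - 1) (α i) / bCoeff (q i) (m i) (α i) with hy
  have hD : IsDiag (defect q (fun _ => 1) (model q m) 1) y :=
    isDiag_defect_model q m hm (fun _ => 1) hm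
  have hf0 : ∀ i γ, 0 ≤ serCoeff (q i) (m i - 1) γ / bCoeff (q i) (m i) γ := fun i γ =>
    div_nonneg (serCoeff_nonneg _ _ _) (bCoeff_nonneg _ _ _)
  have hb : ∀ i γ, bCoeff (q i) (m i) γ = serCoeff (q i) (m i - 1 + 1) γ := fun i γ => by
    rw [bCoeff_eq_serCoeff _ (hm i), Nat.sub_add_cancel (hm i)]
  have hf1 : ∀ i γ, serCoeff (q i) (m i - 1) γ / bCoeff (q i) (m i) γ ≤ 1 := fun i γ => by
    rw [div_le_one (bCoeff_pos _ _ _), hb]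
    exact serCoeff_le_succ _ _ _
  have hN : ∀ i, ∃ N : ℕ, ∀ γ : List (Fin (n i)), N < γ.length →
      serCoeff (q i) (m i - 1) γ / bCoeff (q i) (m i) γ ≤ ε := by
    intro i
    obtain ⟨-, -, d, -, -, -, -, -, hd⟩ := (q i).exists_bounds
    obtain ⟨N, hN⟩ := exists_nat_gt ((d * (m i - 1 : ℕ) : ℝ) / ε)
    refine ⟨N, fun γ hγ => ?_⟩
    have h1 := length_mul_serCoeff_le (q i) hd (m i - 1) γ
    have h2 := bCoeff_pos (q i) (m i) γ
    rw [← hb] at h1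
    have hN' : (N : ℝ) < γ.length := by exact_mod_cast hγ
    rw [div_lt_iff₀ hε] at hN
    have hpos : (0 : ℝ) < γ.length := lt_of_le_of_lt (Nat.cast_nonneg N) hN'
    rw [div_le_iff₀ h2]
    refine le_of_mul_le_mul_left ?_ hpos
    calc _ ≤ _ := h1
      _ ≤ N * ε * bCoeff (q i) (m i) γ := mul_le_mul_of_nonneg_right hN.le h2.le
      _ ≤ γ.length * ε * bCoeff (q i) (m i) γ := by gcongr
      _ = _ := by ring
  choose N hN using hN
  have hfin : {α : ∀ i, List (Fin (n i)) | ∀ i, (α i).length ≤ N i}.Finite := by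
    have := Set.Finite.pi' (fun i => List.finite_length_le (Fin (n i)) (N i))
    exact this
  refine ⟨hfin.toFinset, ?_⟩
  have hdiag : IsDiag (defect q (fun _ => 1) (model q m) 1 -
      (coordProj q hm hfin.toFinset : Fock n →L[ℂ] Fock n) *
        defect q (fun _ => 1) (model q m) 1)
      fun α => y α - y α * if α ∈ hfin.toFinset then 1 else 0 := by
    refine hD.sub fun α => ?_
    change (coordProj q hm hfin.toFinset : Fock n →L[ℂ] Fock n)
      (defect q (fun _ => 1) (model q m) 1 (basisVec α)) = _
    rw [hD α, map_smul, isDiag_coordProj hm _ α, smul_smul]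
    push_cast
    rfl
  refine (hdiag.norm_le (C := ε) fun α => ?_).trans (abs_of_pos hε).le
  split_ifs with h
  · simpa using hε.le
  · have hy0 : 0 ≤ y α := Finset.prod_nonneg fun i _ => hf0 i _
    rw [mul_zero, sub_zero, abs_of_nonneg hy0]
    obtain ⟨i, hi⟩ : ∃ i, N i < (α i).length := by
      by_contra! h2
      exact h (hfin.mem_toFinset.2 h2)
    calc y α = serCoeff (q i) (m i - 1) (α i) / bCoeff (q i) (m i) (α i) *
          ∏ j ∈ Finset.univ.erase i,
            serCoeff (q j) (m j - 1) (α j) / bCoeff (q j) (m j) (α j) :=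
          (Finset.mul_prod_erase _ _ (Finset.mem_univ i)).symm
      _ ≤ ε * 1 := mul_le_mul (hN i _ hi)
          (Finset.prod_le_one (fun j _ => hf0 j _) fun j _ => hf1 j _)
          (Finset.prod_nonneg fun j _ => hf0 j _) hε.le
      _ = ε := mul_one ε

end CstarModel

/-! ### Unitary equivalence and Hilbert space dimension -/

section Unitary

universe u₁ u₂ u₃ u₄

variable {𝒜 : Type u₁} {K : Type u₂} {K' : Type u₃} {K'' : Type u₄}
  [NormedAddCommGroup K] [InnerProductSpace ℂ K] [NormedAddCommGroup K']
  [InnerProductSpace ℂ K'] [NormedAddCommGroup K''] [InnerProductSpace ℂ K'']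

theorem UnitarilyEquivalent.symm {π : 𝒜 → (K →L[ℂ] K)} {π' : 𝒜 → (K' →L[ℂ] K')}
    (h : UnitarilyEquivalent π π') : UnitarilyEquivalent π' π := by
  obtain ⟨U, hU⟩ := h
  refine ⟨U.symm, fun X x => ?_⟩
  rw [LinearIsometryEquiv.symm_apply_eq, hU, LinearIsometryEquiv.apply_symm_apply]

theorem UnitarilyEquivalent.trans {π : 𝒜 → (K →L[ℂ] K)} {π' : 𝒜 → (K' →L[ℂ] K')}
    {π'' : 𝒜 → (K'' →L[ℂ] K'')} (h : UnitarilyEquivalent π π')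
    (h' : UnitarilyEquivalent π' π'') : UnitarilyEquivalent π π'' := by
  obtain ⟨U, hU⟩ := h
  obtain ⟨V, hV⟩ := h'
  exact ⟨U.trans V, fun X x => by
    rw [LinearIsometryEquiv.trans_apply, LinearIsometryEquiv.trans_apply, hU, hV]⟩

theorem exists_orthonormal_hilbertDim (K : Type u₂) [NormedAddCommGroup K]
    [InnerProductSpace ℂ K] [CompleteSpace K] :
    ∃ s : Set K, Orthonormal ℂ ((↑) : s → K) ∧
      (Submodule.span ℂ s).topologicalClosure = ⊤ ∧ hilbertDim K = Cardinal.mk s := by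
  obtain ⟨s, b, hb⟩ := exists_hilbertBasis ℂ K
  refine csInf_mem (s := {κ | ∃ s : Set K, Orthonormal ℂ ((↑) : s → K) ∧
    (Submodule.span ℂ s).topologicalClosure = ⊤ ∧ κ = Cardinal.mk s}) ⟨Cardinal.mk s, s, ?_, ?_, rfl⟩
  · rw [← hb]; exact b.orthonormal
  · have := b.dense_span
    rwa [hb, Subtype.range_coe] at this

theorem lift_hilbertDim_le [CompleteSpace K] (U : K ≃ₗᵢ[ℂ] K') :
    Cardinal.lift.{u₂} (hilbertDim K') ≤ Cardinal.lift.{u₃} (hilbertDim K) := by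
  obtain ⟨s, hs, hd, hc⟩ := exists_orthonormal_hilbertDim K
  have h1 : hilbertDim K' ≤ Cardinal.mk (U '' s) := by
    refine csInf_le' ⟨U '' s, ?_, ?_, rfl⟩
    · have h2 := hs.comp_linearIsometryEquiv U
      have h3 := h2.toSubtypeRange
      convert h3 using 2 <;> simp [Set.range_comp]
    · rw [eq_top_iff]
      intro y _
      have hy : U.symm y ∈ closure (Submodule.span ℂ s : Set K) := by
        have : U.symm y ∈ (Submodule.span ℂ s).topologicalClosure := hd ▸ Submodule.mem_top
        exact this
      have h4 := map_mem_closure (f := U) U.continuous hy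
        (t := (Submodule.span ℂ (U '' s) : Set K')) (fun x hx => by
          have := Submodule.mem_map_of_mem (f := U.toLinearEquiv.toLinearMap) hx
          rw [Submodule.map_span] at this
          exact this)
      rw [U.apply_symm_apply] at h4
      exact h4
  refine (Cardinal.lift_le.2 h1).trans (le_of_eq ?_)
  rw [hc]
  exact Cardinal.mk_image_eq_lift _ _ U.injective

/-- The infimum defining `hilbertDim` is attained by some orthonormal basis, and unitaries transport
bases. It is therefore not needed that all orthonormal bases have the same cardinality. -/
theorem lift_hilbertDim_eq_iff [CompleteSpace K] [CompleteSpace K'] :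
    Cardinal.lift.{u₃} (hilbertDim K) = Cardinal.lift.{u₂} (hilbertDim K') ↔
      Nonempty (K ≃ₗᵢ[ℂ] K') := by
  constructor
  · intro h
    obtain ⟨s, hs, hd, hc⟩ := exists_orthonormal_hilbertDim K
    obtain ⟨s', hs', hd', hc'⟩ := exists_orthonormal_hilbertDim K'
    rw [hc, hc'] at h
    obtain ⟨e⟩ := Cardinal.lift_mk_eq'.1 h
    let b := HilbertBasis.mk hs (by rw [Subtype.range_coe, hd])
    let b' := HilbertBasis.mk (hs'.comp e e.injective) (by
      rw [Set.range_comp, e.range_eq_univ, Set.image_univ, Subtype.range_coe, hd'])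
    exact ⟨b.repr.trans b'.repr.symm⟩
  · rintro ⟨U⟩
    exact le_antisymm (lift_hilbertDim_le U.symm) (lift_hilbertDim_le U)

variable [CompleteSpace K] [CompleteSpace K']

theorem exists_linearIsometryEquiv_of_orthogonal {M : Submodule ℂ K} {M' : Submodule ℂ K'}
    [CompleteSpace M] [CompleteSpace M'] (U₀ : M ≃ₗᵢ[ℂ] M') (U₁ : Mᗮ ≃ₗᵢ[ℂ] M'ᗮ) :
    ∃ U : K ≃ₗᵢ[ℂ] K', (∀ x : M, U x = U₀ x) ∧ ∀ x : Mᗮ, U x = U₁ x := by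
  let f : (M × Mᗮ) →ₗ[ℂ] K := M.subtype.coprod Mᗮ.subtype
  let g : (M × Mᗮ) →ₗ[ℂ] K' := (M'.subtype ∘ₗ U₀.toLinearEquiv.toLinearMap).coprod
    (M'ᗮ.subtype ∘ₗ U₁.toLinearEquiv.toLinearMap)
  have hf : DenseRange f := by
    refine Function.Surjective.denseRange fun x => ?_
    obtain ⟨y, hy, z, hz, rfl⟩ := M.exists_add_mem_mem_orthogonal x
    exact ⟨(⟨y, hy⟩, ⟨z, hz⟩), rfl⟩
  have hg : DenseRange g := by
    refine Function.Surjective.denseRange fun x => ?_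
    obtain ⟨y, hy, z, hz, rfl⟩ := M'.exists_add_mem_mem_orthogonal x
    refine ⟨(U₀.symm ⟨y, hy⟩, U₁.symm ⟨z, hz⟩), ?_⟩
    change (U₀ (U₀.symm ⟨y, hy⟩) : K') + (U₁ (U₁.symm ⟨z, hz⟩) : K') = _
    simp
  obtain ⟨U, hU⟩ := exists_linearIsometryEquiv_of_denseRange hf hg (fun v => by
    have h1 := norm_add_sq_eq_norm_sq_add_norm_sq_of_inner_eq_zero (𝕜 := ℂ) (v.1 : K) (v.2 : K)
      (v.2.2 _ v.1.2)
    have h2 := norm_add_sq_eq_norm_sq_add_norm_sq_of_inner_eq_zero (𝕜 := ℂ) (U₀ v.1 : K')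
      (U₁ v.2 : K') ((U₁ v.2).2 _ (U₀ v.1).2)
    have e0 : ‖(U₀ v.1 : K')‖ = ‖(v.1 : K)‖ := U₀.norm_map v.1
    have e1 : ‖(U₁ v.2 : K')‖ = ‖(v.2 : K)‖ := U₁.norm_map v.2
    rw [e0, e1, ← h1] at h2
    exact (mul_self_inj (norm_nonneg _) (norm_nonneg _)).1 h2)
  refine ⟨U, fun x => ?_, fun x => ?_⟩
  · have := hU (x, 0)
    simpa [f, g] using this
  · have := hU (0, x)
    simpa [f, g] using this

variable [NonUnitalRing 𝒜] [Module ℂ 𝒜] [Star 𝒜]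

theorem InvariantUnder.orthogonal {𝒜 : Type*} [NonUnitalRing 𝒜] [Module ℂ 𝒜] [StarRing 𝒜]
    {π : 𝒜 →⋆ₙₐ[ℂ] (K →L[ℂ] K)} {M : Submodule ℂ K}
    (hM : InvariantUnder π M) : InvariantUnder π Mᗮ := by
  intro X x hx y hy
  have h1 : π X = ContinuousLinearMap.adjoint (π (star X)) := by
    rw [map_star]
    exact (star_star _).symm
  rw [h1, ContinuousLinearMap.adjoint_inner_right]
  exact hx _ (hM _ _ hy)

theorem unitarilyEquivalent_subrep {π : 𝒜 →⋆ₙₐ[ℂ] (K →L[ℂ] K)}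
    {π' : 𝒜 →⋆ₙₐ[ℂ] (K' →L[ℂ] K')} {U : K ≃ₗᵢ[ℂ] K'} (hU : ∀ X x, U (π X x) = π' X (U x))
    {M : Submodule ℂ K} {M' : Submodule ℂ K'} [CompleteSpace M] [CompleteSpace M']
    (hM : InvariantUnder π M) (hM' : InvariantUnder π' M') (h : ∀ x, U x ∈ M' ↔ x ∈ M) :
    UnitarilyEquivalent ⇑(subrep π M hM) ⇑(subrep π' M' hM') := by
  have hmap : M.map U.toLinearEquiv.toLinearMap = M' := by
    ext y
    constructor
    · rintro ⟨x, hx, rfl⟩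
      exact (h x).2 hx
    · intro hy
      exact ⟨U.symm y, (h _).1 (by rwa [U.apply_symm_apply]), U.apply_symm_apply y⟩
  refine ⟨⟨U.toLinearEquiv.ofSubmodules M M' hmap, fun x => U.norm_map x⟩, fun X x => ?_⟩
  exact Subtype.ext (hU X x)

theorem unitarilyEquivalent_of_subrep {𝒜 : Type*} [NonUnitalRing 𝒜] [Module ℂ 𝒜] [Star 𝒜]
    {π : 𝒜 →⋆ₙₐ[ℂ] (K →L[ℂ] K)}
    {π' : 𝒜 →⋆ₙₐ[ℂ] (K' →L[ℂ] K')} {M : Submodule ℂ K} {M' : Submodule ℂ K'}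
    [CompleteSpace M] [CompleteSpace M'] {hM : InvariantUnder π M} {hM' : InvariantUnder π' M'}
    {hM₁ : InvariantUnder π Mᗮ} {hM₁' : InvariantUnder π' M'ᗮ}
    (h₀ : UnitarilyEquivalent ⇑(subrep π M hM) ⇑(subrep π' M' hM'))
    (h₁ : UnitarilyEquivalent ⇑(subrep π Mᗮ hM₁) ⇑(subrep π' M'ᗮ hM₁')) :
    UnitarilyEquivalent ⇑π ⇑π' := by
  obtain ⟨U₀, hU₀⟩ := h₀
  obtain ⟨U₁, hU₁⟩ := h₁
  obtain ⟨U, h0, h1⟩ := exists_linearIsometryEquiv_of_orthogonal U₀ U₁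
  refine ⟨U, fun X x => ?_⟩
  obtain ⟨y, hy, z, hz, rfl⟩ := M.exists_add_mem_mem_orthogonal x
  have e0 := h0 (subrep π M hM X ⟨y, hy⟩)
  have e1 := h1 (subrep π Mᗮ hM₁ X ⟨z, hz⟩)
  rw [hU₀, coe_subrep_apply, coe_subrep_apply, ← h0] at e0
  rw [hU₁, coe_subrep_apply, coe_subrep_apply, ← h1] at e1
  rw [map_add, map_add, map_add, map_add]
  exact congrArg₂ (· + ·) e0 e1

end Unitary

/-! ### The Wold decomposition -/

section WoldDecomposition

variable {k : ℕ} {n : Fin k → ℕ} {q : ∀ i, PosRegPoly (n i)} {m : Fin k → ℕ}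
variable {K : Type*} [NormedAddCommGroup K] [InnerProductSpace ℂ K] [CompleteSpace K]
variable {K' : Type*} [NormedAddCommGroup K'] [InnerProductSpace ℂ K'] [CompleteSpace K']

/-- The operator `π(1)` fixes every `π(X) x`, and these vectors span a dense subspace. -/
theorem Nondegenerate.map_one {π : RepW q m K} (h : Nondegenerate π) : π 1 = 1 := by
  ext1 x
  have h1 : (Submodule.span ℂ {y | ∃ X x, y = π X x}).topologicalClosure ≤
      LinearMap.eqLocus (π 1).toLinearMap (LinearMap.id : K →ₗ[ℂ] K) := by
    refine Submodule.topologicalClosure_minimal _ (Submodule.span_le.2 ?_) ?_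
    · rintro _ ⟨X, x, rfl⟩
      change π 1 (π X x) = π X x
      change (π 1 * π X) x = π X x
      rw [← map_mul, one_mul]
    · exact isClosed_eq (π 1).continuous continuous_id
  rw [h] at h1
  exact h1 (Submodule.mem_top (x := x))

/-- A representation with `π(1) = 1`, as a unital representation. -/
def RepW.toUnital (π : RepW q m K) (h1 : π 1 = 1) : CstarW q m →⋆ₐ[ℂ] (K →L[ℂ] K) :=
  { π with
    map_one' := h1
    commutes' := fun c => by
      change π (algebraMap ℂ _ c) = algebraMap ℂ _ c
      rw [Algebra.algebraMap_eq_smul_one, Algebra.algebraMap_eq_smul_one, map_smul, h1] }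

theorem defect_repTuple {π : RepW q m K} (h1 : π 1 = 1) (p : Fin k → ℕ) :
    defect q p (repTuple π) 1 = π (defect q p (genW q m) 1) :=
  (starAlgHom_defect (π.toUnital h1) (genW q m) q p).symm

theorem repDefect_eq {π : RepW q m K} (h1 : π 1 = 1) : repDefect π = π (vacProj q m) :=
  defect_repTuple h1 m

theorem map_star_apply_inner (π : RepW q m K) (X : CstarW q m) (x y : K) :
    inner ℂ x (π (star X) y) = inner ℂ (π X x) y := by
  rw [map_star, ContinuousLinearMap.star_eq_adjoint, ContinuousLinearMap.adjoint_inner_right]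

theorem map_mul_apply (π : RepW q m K) (X Y : CstarW q m) (x : K) :
    π (X * Y) x = π X (π Y x) := by
  rw [map_mul]; rfl

variable (hm : ∀ i, 1 ≤ m i)

theorem RepW.continuous (π : RepW q m K) : Continuous π :=
  AddMonoidHomClass.continuous_of_bound π 1 fun X => by
    rw [one_mul]
    exact NonUnitalStarAlgHom.norm_apply_le π X

theorem continuous_theta_apply (π : RepW q m K) (x : K) :
    Continuous fun ξ => π (theta hm ξ) x := by
  have h1 := π.continuous
  have h2 : Continuous fun ξ => thetaL q hm ξ := (thetaL q hm).continuous
  have h3 : Continuous fun ξ => π (thetaL q hm ξ) := h1.comp h2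
  exact h3.clm_apply continuous_const

/-- The linear map `ξ ⊗ g ↦ π(θ(ξ)) (ι g)`. -/
def woldMap (π : RepW q m K) {D : Type*} [AddCommGroup D] [Module ℂ D] (ι : D →ₗ[ℂ] K) :
    Fock n ⊗[ℂ] D →ₗ[ℂ] K :=
  TensorProduct.lift (LinearMap.mk₂ ℂ (fun ξ g => π (thetaL q hm ξ) (ι g))
    (fun ξ η g => by rw [map_add, map_add]; rfl)
    (fun c ξ g => by rw [map_smul, map_smul]; rfl)
    (fun ξ g g' => by rw [map_add, map_add])
    (fun c ξ g => by rw [map_smul, map_smul]))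

theorem woldMap_tmul (π : RepW q m K) {D : Type*} [AddCommGroup D] [Module ℂ D] (ι : D →ₗ[ℂ] K)
    (ξ : Fock n) (g : D) : woldMap hm π ι (ξ ⊗ₜ g) = π (theta hm ξ) (ι g) := rfl

/-- `W_α P` is a nonzero multiple of `θ(e_α)`, and `θ` is continuous. In this description invariance
is immediate from `X θ(ξ) = θ(X ξ)`. -/
theorem woldSpace_eq {π : RepW q m K} (h1 : π 1 = 1) :
    woldSpace π = (Submodule.span ℂ {y | ∃ ξ x, y = π (theta hm ξ) x}).topologicalClosure := by
  apply le_antisymm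
  · refine Submodule.topologicalClosure_mono (Submodule.span_mono ?_)
    rintro _ ⟨α, x, rfl⟩
    obtain ⟨c, -, h⟩ := exists_multiWordProd_mul_vacProj (q := q) hm α
    refine ⟨c • basisVec α, x, ?_⟩
    rw [repDefect_eq h1, ← map_mul_apply, h, ← thetaL_apply, ← thetaL_apply]
    simp only [map_smul]
  · refine Submodule.topologicalClosure_minimal _ (Submodule.span_le.2 ?_)
      (Submodule.isClosed_topologicalClosure _)
    rintro _ ⟨ξ, x, rfl⟩
    have hb : ∀ α, π (theta hm (basisVec α)) x ∈ woldSpace π := by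
      intro α
      obtain ⟨c, hc, h⟩ := exists_multiWordProd_mul_vacProj (q := q) hm α
      have e : π (theta hm (basisVec α)) x =
          c⁻¹ • π (multiWordProd (genW q m) α) (repDefect π x) := by
        rw [repDefect_eq h1, ← map_mul_apply, h, map_smul, _root_.smul_apply, inv_smul_smul₀ hc]
      rw [e]
      exact Submodule.smul_mem _ _
        (Submodule.le_topologicalClosure _ (Submodule.subset_span ⟨α, x, rfl⟩))
    have h2 := (continuous_theta_apply hm π x).tendsto ξ |>.comp (hasSum_basisVec ξ)
    refine (Submodule.isClosed_topologicalClosure _).mem_of_tendsto h2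
      (Filter.Eventually.of_forall fun s => ?_)
    change π (theta hm (∑ α ∈ s, ξ α • basisVec α)) x ∈ woldSpace π
    rw [← thetaL_apply, map_sum, map_sum, sum_apply]
    refine Submodule.sum_mem _ fun α _ => ?_
    rw [map_smul, map_smul, _root_.smul_apply]
    exact Submodule.smul_mem _ _ (hb α)

theorem theta_apply_mem_woldSpace {π : RepW q m K} (h1 : π 1 = 1) (ξ : Fock n) (x : K) :
    π (theta hm ξ) x ∈ woldSpace π := by
  rw [woldSpace_eq hm h1]
  exact Submodule.le_topologicalClosure _ (Submodule.subset_span ⟨ξ, x, rfl⟩)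

theorem invariantUnder_woldSpace (hm : ∀ i, 1 ≤ m i) {π : RepW q m K} (h1 : π 1 = 1) :
    InvariantUnder π (woldSpace π) := by
  intro X x hx
  have h2 : woldSpace π ≤ (woldSpace π).comap (π X).toLinearMap := by
    conv_lhs => rw [woldSpace_eq hm h1]
    refine Submodule.topologicalClosure_minimal _ (Submodule.span_le.2 ?_)
      ((Submodule.isClosed_topologicalClosure _).preimage (π X).continuous)
    rintro _ ⟨ξ, x, rfl⟩
    change π X (π (theta hm ξ) x) ∈ woldSpace π
    rw [← map_mul_apply, mul_theta]
    exact theta_apply_mem_woldSpace hm h1 _ _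
  exact h2 hx

/-- The criterion involves only the action of elements of the algebra, so it is carried along by
every intertwining unitary. -/
theorem mem_woldSpace_orthogonal_iff {π : RepW q m K} (h1 : π 1 = 1) (x : K) :
    x ∈ (woldSpace π)ᗮ ↔ ∀ ξ, π (star (theta hm ξ)) x = 0 := by
  constructor
  · intro hx ξ
    refine ext_inner_left ℂ fun y => ?_
    rw [map_star_apply_inner, inner_zero_right]
    exact hx _ (theta_apply_mem_woldSpace hm h1 ξ y)
  · intro h
    rw [woldSpace_eq hm h1, Submodule.orthogonal_closure, Submodule.mem_orthogonal]
    intro y hy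
    induction hy using Submodule.span_induction with
    | mem y hy =>
      obtain ⟨ξ, z, rfl⟩ := hy
      rw [← map_star_apply_inner, h, inner_zero_right]
    | zero => exact inner_zero_left _
    | add y z _ _ hy hz => rw [inner_add_left, hy, hz, add_zero]
    | smul c y _ hy => rw [inner_smul_left, hy, mul_zero]

theorem vacProj_apply_vacProj (hm : ∀ i, 1 ≤ m i) (π : RepW q m K) (x : K) :
    π (vacProj q m) (π (vacProj q m) x) = π (vacProj q m) x := by
  rw [← map_mul_apply, vacProj_mul_self hm]

theorem inner_woldMap {π : RepW q m K} {D : Type*} [NormedAddCommGroup D] [InnerProductSpace ℂ D]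
    (ι : D →ₗᵢ[ℂ] K) (hι : ∀ g, π (vacProj q m) (ι g) = ι g) (s t : Fock n ⊗[ℂ] D) :
    inner ℂ (woldMap hm π ι.toLinearMap s) (woldMap hm π ι.toLinearMap t) = inner ℂ s t := by
  induction s using TensorProduct.induction_on with
  | zero => rw [map_zero, inner_zero_left, inner_zero_left]
  | add s s' hs hs' => rw [map_add, inner_add_left, inner_add_left, hs, hs']
  | tmul ξ g =>
    induction t using TensorProduct.induction_on with
    | zero => rw [map_zero, inner_zero_right, inner_zero_right]
    | add t t' ht ht' => rw [map_add, inner_add_right, inner_add_right, ht, ht']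
    | tmul η g' =>
      rw [woldMap_tmul, woldMap_tmul, ← map_star_apply_inner, ← map_mul_apply,
        star_theta_mul_theta, map_smul, _root_.smul_apply, inner_smul_right,
        TensorProduct.inner_tmul]
      congr 1
      change inner ℂ (ι g) (π (vacProj q m) (ι g')) = _
      rw [hι, ι.inner_map_map]

/-- The multiplicity space is an arbitrary `D` mapped isometrically onto the range of `π(P)`: that
range itself for the Wold decomposition, the defect space of `T` for the dilation. -/
theorem exists_wold_equiv {π : RepW q m K} (h1 : π 1 = 1) {D : Type*} [NormedAddCommGroup D]
    [InnerProductSpace ℂ D] (ι : D →ₗᵢ[ℂ] K)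
    (hι : LinearMap.range ι.toLinearMap = LinearMap.range (π (vacProj q m)).toLinearMap) :
    ∃ U : HTensor (Fock n) D ≃ₗᵢ[ℂ] woldSpace π,
      (∀ ξ g, (U (tensorIncl _ D (ξ ⊗ₜ g)) : K) = π (theta hm ξ) (ι g)) ∧
      ∀ (X : CstarW q m) z, (U (ampliation (X : Fock n →L[ℂ] Fock n) D z) : K) = π X (U z) := by
  have hfix : ∀ g, π (vacProj q m) (ι g) = ι g := by
    intro g
    have : ι g ∈ LinearMap.range (π (vacProj q m)).toLinearMap := hι ▸ ⟨g, rfl⟩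
    obtain ⟨x, hx⟩ := this
    rw [← hx]
    exact vacProj_apply_vacProj hm π x
  have hmem : ∀ t, woldMap hm π ι.toLinearMap t ∈ woldSpace π := by
    intro t
    induction t using TensorProduct.induction_on with
    | zero => rw [map_zero]; exact zero_mem _
    | add s t hs ht => rw [map_add]; exact add_mem hs ht
    | tmul ξ g => exact theta_apply_mem_woldSpace hm h1 ξ _
  let f := (tensorIncl (Fock n) D).toLinearMap
  let g := (woldMap hm π ι.toLinearMap).codRestrict (woldSpace π) hmem
  have hg : DenseRange g := by
    intro y
    rw [closure_subtype]
    have hy : (y : K) ∈ closure (Submodule.span ℂ {y | ∃ ξ x, y = π (theta hm ξ) x} : Set K) := by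
      have h2 := (woldSpace_eq hm h1).le y.2
      exact h2
    refine closure_mono ?_ hy
    have hle : Submodule.span ℂ {y | ∃ ξ x, y = π (theta hm ξ) x} ≤
        LinearMap.range (woldMap hm π ι.toLinearMap) := by
      refine Submodule.span_le.2 ?_
      rintro _ ⟨ξ, x, rfl⟩
      have : π (vacProj q m) x ∈ LinearMap.range ι.toLinearMap := hι ▸ ⟨x, rfl⟩
      obtain ⟨d, hd⟩ := this
      refine ⟨ξ ⊗ₜ d, ?_⟩
      rw [woldMap_tmul, hd, ← map_mul_apply, theta_mul_vacProj]
    intro z hz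
    obtain ⟨t, rfl⟩ := hle hz
    exact ⟨g t, ⟨t, rfl⟩, rfl⟩
  obtain ⟨U, hU⟩ := exists_linearIsometryEquiv_of_denseRange
    (f := f) (denseRange_tensorIncl (Fock n) D) (g := g) hg (fun v => by
      have e := inner_woldMap hm ι hfix v v
      have e1 : ‖woldMap hm π ι.toLinearMap v‖ = ‖v‖ := by
        rw [inner_self_eq_norm_sq_to_K] at e
        replace e := e.trans (inner_self_eq_norm_sq_to_K (𝕜 := ℂ) v)
        have e2 : ‖woldMap hm π ι.toLinearMap v‖ ^ 2 = ‖v‖ ^ 2 := by exact_mod_cast e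
        exact (sq_eq_sq₀ (norm_nonneg _) (norm_nonneg _)).1 e2
      exact e1.trans ((tensorIncl (Fock n) D).norm_map v).symm)
  have hU1 : ∀ ξ g, (U (tensorIncl _ D (ξ ⊗ₜ g)) : K) = π (theta hm ξ) (ι g) := fun ξ g =>
    congrArg Subtype.val (hU (ξ ⊗ₜ g))
  refine ⟨U, hU1, fun X z => ?_⟩
  refine htensor_induction (p := fun z => (U (ampliation (X : Fock n →L[ℂ] Fock n) D z) : K) =
    π X (U z)) (isClosed_eq (by fun_prop) (by fun_prop)) (fun x y hx hy => ?_) (fun ξ d => ?_) z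
  · simp only [map_add, Submodule.coe_add, hx, hy]
  · rw [ampliation_tensorIncl_tmul, hU1, hU1, ← map_mul_apply, mul_theta]

theorem residualRep_one {π : RepW q m K} (h1 : π 1 = 1) (h₁ : InvariantUnder π (woldSpace π)ᗮ) :
    residualRep π h₁ 1 = 1 := by
  ext1 x
  apply Subtype.ext
  change π 1 x = x
  rw [h1]; rfl

/-- A vector `π(θ(ξ)) x` always lies in `K_0`; for `x` in `K_0^⊥` it lies in `K_0^⊥` too. -/
theorem residualRep_theta {π : RepW q m K} (h1 : π 1 = 1)
    (h₁ : InvariantUnder π (woldSpace π)ᗮ) (ξ : Fock n) : residualRep π h₁ (theta hm ξ) = 0 := by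
  ext1 x
  apply Subtype.ext
  have h2 := theta_apply_mem_woldSpace hm h1 ξ (x : K)
  have h3 := h₁ (theta hm ξ) x x.2
  exact inner_self_eq_zero.1 (h3 _ h2)

theorem residualRep_vacProj (hm : ∀ i, 1 ≤ m i) {π : RepW q m K} (h1 : π 1 = 1)
    (h₁ : InvariantUnder π (woldSpace π)ᗮ) : residualRep π h₁ (vacProj q m) = 0 := by
  rw [← theta_vacuum hm, residualRep_theta hm h1]

/-- An equivalence with a part of `π_1` forces every `θ(ξ)^*` to vanish on the corresponding part of
`K_0`, which is then orthogonal to `K_0`. -/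
theorem areDisjoint_pureRep_residualRep (hm : ∀ i, 1 ≤ m i) {π : RepW q m K} (h1 : π 1 = 1)
    (h₀ : InvariantUnder π (woldSpace π)) (h₁ : InvariantUnder π (woldSpace π)ᗮ) :
    AreDisjoint (pureRep π h₀) (residualRep π h₁) := by
  intro M M' _ _ hM hM' hU
  obtain ⟨U, hU⟩ := hU
  rw [Submodule.eq_bot_iff]
  intro x hx
  have h2 : (x : K) ∈ (woldSpace π)ᗮ := by
    rw [mem_woldSpace_orthogonal_iff hm h1]
    intro ξ
    have e := hU (star (theta hm ξ)) ⟨x, hx⟩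
    have e1 : subrep (residualRep π h₁) M' hM' (star (theta hm ξ)) (U ⟨x, hx⟩) = 0 := by
      apply Subtype.ext
      change residualRep π h₁ (star (theta hm ξ)) (U ⟨x, hx⟩) = 0
      rw [map_star, residualRep_theta hm h1, star_zero]; rfl
    rw [e1] at e
    have e2 := (map_eq_zero_iff U U.injective).1 e
    exact congrArg (fun y : M => ((y : woldSpace π) : K)) e2
  apply Subtype.ext
  exact inner_self_eq_zero.1 (h2 _ x.2)

theorem isClosed_range_vacProj (hm : ∀ i, 1 ≤ m i) (π : RepW q m K) :
    IsClosed (LinearMap.range (π (vacProj q m)).toLinearMap : Set K) := by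
  have : (LinearMap.range (π (vacProj q m)).toLinearMap : Set K) =
      {x | π (vacProj q m) x = x} := by
    ext x
    constructor
    · rintro ⟨y, rfl⟩
      exact vacProj_apply_vacProj hm π y
    · intro hx
      exact ⟨x, hx⟩
  rw [this]
  exact isClosed_eq (π (vacProj q m)).continuous continuous_id

theorem woldDecomposition (hm : ∀ i, 1 ≤ m i) {π : RepW q m K} (h1 : π 1 = 1)
    (h₀ : InvariantUnder π (woldSpace π)) (h₁ : InvariantUnder π (woldSpace π)ᗮ) :
    CompleteSpace (LinearMap.range (repDefect π).toLinearMap) ∧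
    UnitarilyEquivalent ⇑(pureRep π h₀)
      (ampRep q m (LinearMap.range (repDefect π).toLinearMap)) ∧
    AnnihilatesCompacts ⇑(residualRep π h₁) ∧
    defect q (fun _ => 1) (repTuple (residualRep π h₁)) 1 = 0 := by
  refine ⟨?_, ?_, annihilatesCompacts_of_vacProj hm _ (residualRep_vacProj hm h1 h₁), ?_⟩
  · rw [repDefect_eq h1]
    exact (isClosed_range_vacProj hm π).completeSpace_coe
  · obtain ⟨U, -, hU⟩ := exists_wold_equiv hm h1
      (LinearMap.range (repDefect π).toLinearMap).subtypeₗᵢ (by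
        rw [← repDefect_eq h1]
        exact Submodule.range_subtype _)
    exact UnitarilyEquivalent.symm ⟨U, fun X z => Subtype.ext (hU X z)⟩
  · rw [defect_repTuple (residualRep_one h1 h₁)]
    exact map_defect_one_eq_zero_of_vacProj hm _ (residualRep_vacProj hm h1 h₁)

/-! ### Classification -/

/-- The fixed space of `P ⊗ I` is `e_∅ ⊗ G`. An equivalence of amplifications maps fixed space to
fixed space, so it determines `G` up to unitaries. -/
theorem exists_linearIsometry_range_ampRep_vacProj (hm : ∀ i, 1 ≤ m i) (G : Type*)
    [NormedAddCommGroup G] [InnerProductSpace ℂ G] [CompleteSpace G] :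
    ∃ j : G →ₗᵢ[ℂ] HTensor (Fock n) G,
      ∀ z, z ∈ LinearMap.range j.toLinearMap ↔ ampRep q m G (vacProj q m) z = z := by
  let j : G →ₗᵢ[ℂ] HTensor (Fock n) G :=
    ⟨(tensorIncl (Fock n) G).toLinearMap ∘ₗ TensorProduct.mk ℂ (Fock n) G (vacuum n), fun g => by
      change ‖tensorIncl (Fock n) G (vacuum n ⊗ₜ g)‖ = ‖g‖
      rw [LinearIsometry.norm_map, TensorProduct.norm_tmul, vacuum, norm_basisVec, one_mul]⟩
  have hj : ∀ g, j g = tensorIncl (Fock n) G (vacuum n ⊗ₜ g) := fun g => rfl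
  have hP : ∀ ξ g, ampRep q m G (vacProj q m) (tensorIncl (Fock n) G (ξ ⊗ₜ g)) =
      j (inner ℂ (vacuum n) ξ • g) := fun ξ g => by
    rw [ampRep, ampliation_tensorIncl_tmul, ← theta_vacuum hm, coe_theta_apply, hj,
      TensorProduct.smul_tmul]
  refine ⟨j, fun z => ⟨?_, fun hz => ?_⟩⟩
  · rintro ⟨g, rfl⟩
    change ampRep q m G (vacProj q m) (j g) = j g
    rw [hj, hP, inner_vacuum_self, one_smul, hj]
  · rw [← hz]
    refine htensor_induction (p := fun z => ampRep q m G (vacProj q m) z ∈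
      LinearMap.range j.toLinearMap) ?_ (fun x y hx hy => ?_) (fun ξ g => ?_) z
    · have hc : IsClosed (Set.range j) := j.isometry.isClosedEmbedding.isClosed_range
      exact hc.preimage (ampRep q m G (vacProj q m)).continuous
    · rw [map_add]; exact add_mem hx hy
    · rw [hP]; exact ⟨_, rfl⟩

theorem nonempty_equiv_of_ampRep (hm : ∀ i, 1 ≤ m i) {G G' : Type*} [NormedAddCommGroup G]
    [InnerProductSpace ℂ G] [CompleteSpace G] [NormedAddCommGroup G'] [InnerProductSpace ℂ G']
    [CompleteSpace G']
    (h : UnitarilyEquivalent (ampRep q m G) (ampRep q m G')) : Nonempty (G ≃ₗᵢ[ℂ] G') := by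
  obtain ⟨U, hU⟩ := h
  obtain ⟨j, hj⟩ := exists_linearIsometry_range_ampRep_vacProj (q := q) hm G
  obtain ⟨j', hj'⟩ := exists_linearIsometry_range_ampRep_vacProj (q := q) hm G'
  have hmap : (LinearMap.range j.toLinearMap).map U.toLinearEquiv.toLinearMap =
      LinearMap.range j'.toLinearMap := by
    ext y
    constructor
    · rintro ⟨x, hx, rfl⟩
      rw [hj']
      change ampRep q m G' (vacProj q m) (U x) = U x
      rw [← hU, (hj x).1 hx]
    · intro hy
      refine ⟨U.symm y, (hj _).2 (U.injective ?_), U.apply_symm_apply y⟩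
      rw [hU, U.apply_symm_apply, (hj' y).1 hy]
  have e : LinearMap.range j.toLinearMap ≃ₗᵢ[ℂ] LinearMap.range j'.toLinearMap :=
    ⟨U.toLinearEquiv.ofSubmodules _ _ hmap, fun x => U.norm_map x⟩
  exact ⟨(j.equivRange.trans e).trans j'.equivRange.symm⟩

theorem ampRep_congr {G G' : Type*} [NormedAddCommGroup G]
    [InnerProductSpace ℂ G] [NormedAddCommGroup G'] [InnerProductSpace ℂ G']
    (e : G ≃ₗᵢ[ℂ] G') : UnitarilyEquivalent (ampRep q m G) (ampRep q m G') := by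
  let f := (tensorIncl (Fock n) G).toLinearMap
  let g := (tensorIncl (Fock n) G').toLinearMap ∘ₗ
    (TensorProduct.congr (LinearEquiv.refl ℂ (Fock n)) e.toLinearEquiv).toLinearMap
  have hg : DenseRange g := (denseRange_tensorIncl (Fock n) G').comp
    (TensorProduct.congr (LinearEquiv.refl ℂ (Fock n)) e.toLinearEquiv).surjective.denseRange
    (tensorIncl (Fock n) G').continuous
  obtain ⟨U, hU⟩ := exists_linearIsometryEquiv_of_denseRange (f := f)
    (denseRange_tensorIncl (Fock n) G) hg (fun v => by
      change ‖tensorIncl (Fock n) G' (TensorProduct.map LinearMap.id e.toLinearEquiv.toLinearMap v)‖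
        = ‖tensorIncl (Fock n) G v‖
      rw [LinearIsometry.norm_map, LinearIsometry.norm_map]
      exact TensorProduct.norm_map LinearIsometry.id e.toLinearIsometry v)
  have hU1 : ∀ ξ g, U (tensorIncl _ G (ξ ⊗ₜ g)) = tensorIncl _ G' (ξ ⊗ₜ e g) := fun ξ g =>
    hU (ξ ⊗ₜ g)
  refine ⟨U, fun X z => ?_⟩
  refine htensor_induction (p := fun z => U (ampRep q m G X z) = ampRep q m G' X (U z))
    (isClosed_eq (by fun_prop) (by fun_prop)) (fun x y hx hy => ?_) (fun ξ d => ?_) z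
  · simp only [map_add, hx, hy]
  · rw [ampRep, ampRep, ampliation_tensorIncl_tmul, hU1, hU1, ampliation_tensorIncl_tmul]

theorem mem_orthogonal_woldSpace_iff_map (hm : ∀ i, 1 ≤ m i) {π : RepW q m K} {π' : RepW q m K'}
    (h1 : π 1 = 1) (h1' : π' 1 = 1) {U : K ≃ₗᵢ[ℂ] K'} (hU : ∀ X x, U (π X x) = π' X (U x))
    (x : K) : U x ∈ (woldSpace π')ᗮ ↔ x ∈ (woldSpace π)ᗮ := by
  rw [mem_woldSpace_orthogonal_iff hm h1, mem_woldSpace_orthogonal_iff hm h1']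
  refine forall_congr' fun ξ => ?_
  rw [← hU, map_eq_zero_iff U U.injective]

/-- The orthogonal complement is intrinsic by the criterion with `θ(ξ)^*`, and the closed subspace
`K_0` is its own double complement. -/
theorem mem_woldSpace_iff_map (hm : ∀ i, 1 ≤ m i) {π : RepW q m K} {π' : RepW q m K'}
    (h1 : π 1 = 1) (h1' : π' 1 = 1) {U : K ≃ₗᵢ[ℂ] K'} (hU : ∀ X x, U (π X x) = π' X (U x))
    (x : K) : U x ∈ woldSpace π' ↔ x ∈ woldSpace π := by
  have e : (woldSpace π)ᗮᗮ = woldSpace π := Submodule.orthogonal_orthogonal _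
  have e' : (woldSpace π')ᗮᗮ = woldSpace π' := Submodule.orthogonal_orthogonal _
  rw [← e, ← e', Submodule.mem_orthogonal, Submodule.mem_orthogonal]
  constructor
  · intro h y hy
    rw [← U.inner_map_map]
    exact h _ ((mem_orthogonal_woldSpace_iff_map hm h1 h1' hU y).2 hy)
  · intro h y hy
    have h2 := h (U.symm y) ((mem_orthogonal_woldSpace_iff_map hm h1 h1' hU _).1 (by
      rwa [U.apply_symm_apply]))
    rwa [← U.inner_map_map, U.apply_symm_apply] at h2

theorem unitarilyEquivalent_iff_of_ampRep (hm : ∀ i, 1 ≤ m i) {π : RepW q m K}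
    {π' : RepW q m K'} (h1 : π 1 = 1) (h1' : π' 1 = 1)
    (h₀ : InvariantUnder π (woldSpace π)) (h₁ : InvariantUnder π (woldSpace π)ᗮ)
    (h₀' : InvariantUnder π' (woldSpace π')) (h₁' : InvariantUnder π' (woldSpace π')ᗮ)
    {G G' : Type*} [NormedAddCommGroup G] [InnerProductSpace ℂ G]
    [CompleteSpace G] [NormedAddCommGroup G'] [InnerProductSpace ℂ G'] [CompleteSpace G']
    (hG : UnitarilyEquivalent ⇑(pureRep π h₀) (ampRep q m G))
    (hG' : UnitarilyEquivalent ⇑(pureRep π' h₀') (ampRep q m G')) :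
    UnitarilyEquivalent ⇑π ⇑π' ↔ Nonempty (G ≃ₗᵢ[ℂ] G') ∧
      UnitarilyEquivalent ⇑(residualRep π h₁) ⇑(residualRep π' h₁') := by
  constructor
  · rintro ⟨U, hU⟩
    refine ⟨nonempty_equiv_of_ampRep hm (hG.symm.trans (UnitarilyEquivalent.trans ?_ hG')), ?_⟩
    · exact unitarilyEquivalent_subrep hU h₀ h₀' (mem_woldSpace_iff_map hm h1 h1' hU)
    · exact unitarilyEquivalent_subrep hU h₁ h₁' (mem_orthogonal_woldSpace_iff_map hm h1 h1' hU)
  · rintro ⟨⟨e⟩, h⟩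
    exact unitarilyEquivalent_of_subrep (hG.trans ((ampRep_congr e).trans hG'.symm)) h

end WoldDecomposition

/-! ### Poisson kernels -/

section Kernel

variable {k : ℕ} {n : Fin k → ℕ}

theorem multiWordProd_prepend {M : Type*} [Monoid M] {X : ∀ i, Fin (n i) → M}
    (hX : ∀ i i', i ≠ i' → ∀ j j', Commute (X i j) (X i' j')) (i : Fin k) (j : Fin (n i))
    (α : ∀ i, List (Fin (n i))) : multiWordProd X (prepend i j α) = X i j * multiWordProd X α := by
  have hne : ∀ i', i' ≠ i → wordProd (X i') (prepend i j α i') = wordProd (X i') (α i') :=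
    fun i' h => by rw [prepend, Function.update_of_ne h]
  have hcomm : ∀ i', i' ≠ i → Commute (wordProd (X i') (α i')) (X i j) := by
    intro i' h
    refine Commute.list_prod_left _ _ fun x hx => ?_
    obtain ⟨j', _, rfl⟩ := List.mem_map.1 hx
    exact hX i' i h j' j
  have key : ∀ l : List (Fin k), l.Nodup →
      (l.map fun i' => wordProd (X i') (prepend i j α i')).prod =
        if i ∈ l then X i j * (l.map fun i' => wordProd (X i') (α i')).prod
        else (l.map fun i' => wordProd (X i') (α i')).prod := by
    intro l hl
    induction l with
    | nil => simp
    | cons i' l ih =>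
      obtain ⟨hi, hl⟩ := List.nodup_cons.1 hl
      rw [List.map_cons, List.prod_cons, List.map_cons, List.prod_cons, ih hl]
      by_cases h : i' = i
      · subst h
        rw [if_neg hi, if_pos List.mem_cons_self, prepend, Function.update_self, wordProd_cons,
          mul_assoc]
      · rw [hne i' h]
        by_cases h2 : i ∈ l
        · rw [if_pos h2, if_pos (List.mem_cons_of_mem _ h2), ← mul_assoc, (hcomm i' h).eq,
            mul_assoc]
        · rw [if_neg h2, if_neg (by simp [h2, Ne.symm h])]
  have := key (List.finRange k) (List.nodup_finRange k)
  rw [if_pos (List.mem_finRange i)] at this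
  simpa [multiWordProd, List.ofFn_eq_map] using this

theorem model_basisVec (q : ∀ i, PosRegPoly (n i)) (m : Fin k → ℕ) (i : Fin k) (j : Fin (n i))
    (α : ∀ i, List (Fin (n i))) :
    model q m i j (basisVec α) = (weight (q i) (m i) j (α i) : ℂ) • basisVec (prepend i j α) :=
  wordProd_model_basisVec q m i [j] α

/-- The weights of the model are made for this: applying the adjoint of the shift turns the
coefficient `√b` of the Poisson kernel at the longer word into the one at the shorter word. -/
theorem weight_mul_sqrt_prod_bCoeff (q : ∀ i, PosRegPoly (n i)) (m : Fin k → ℕ) (i : Fin k)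
    (j : Fin (n i)) (α : ∀ i, List (Fin (n i))) :
    weight (q i) (m i) j (α i) * √(∏ l, bCoeff (q l) (m l) (prepend i j α l)) =
      √(∏ l, bCoeff (q l) (m l) (α l)) := by
  rw [← Finset.mul_prod_erase _ _ (Finset.mem_univ i),
    ← Finset.mul_prod_erase _ (fun l => bCoeff (q l) (m l) (α l)) (Finset.mem_univ i),
    Real.sqrt_mul (bCoeff_nonneg _ _ _), Real.sqrt_mul (bCoeff_nonneg _ _ _)]
  have h1 : ∏ l ∈ Finset.univ.erase i, bCoeff (q l) (m l) (prepend i j α l) =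
      ∏ l ∈ Finset.univ.erase i, bCoeff (q l) (m l) (α l) :=
    Finset.prod_congr rfl fun l hl => by
      rw [prepend, Function.update_of_ne (Finset.ne_of_mem_erase hl)]
  have h2 : 0 < √(bCoeff (q i) (m i) (j :: α i)) := Real.sqrt_pos.2 (bCoeff_pos _ _ _)
  rw [h1, prepend, Function.update_self, weight, ← mul_assoc, div_mul_cancel₀ _ h2.ne']

variable {H : Type*} [NormedAddCommGroup H] [InnerProductSpace ℂ H]

variable (n H) in
/-- The isometry `g ↦ e_α ⊗ g`. -/
def basisIncl (α : ∀ i, List (Fin (n i))) : H →ₗᵢ[ℂ] HTensor (Fock n) H :=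
  ⟨(tensorIncl (Fock n) H).toLinearMap ∘ₗ TensorProduct.mk ℂ (Fock n) H (basisVec α), fun g => by
    change ‖tensorIncl (Fock n) H (basisVec α ⊗ₜ g)‖ = ‖g‖
    rw [LinearIsometry.norm_map, TensorProduct.norm_tmul, norm_basisVec, one_mul]⟩

theorem basisIncl_apply (α : ∀ i, List (Fin (n i))) (g : H) :
    basisIncl n H α g = tensorIncl (Fock n) H (basisVec α ⊗ₜ g) := rfl

variable (n H) in
theorem orthogonalFamily_basisIncl :
    OrthogonalFamily ℂ (fun _ : ∀ i, List (Fin (n i)) => H) (basisIncl n H) := by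
  intro α β hαβ g g'
  rw [basisIncl_apply, basisIncl_apply, inner_tensorIncl_tmul, inner_basisVec_left,
    basisVec_apply, if_neg hαβ, zero_mul]

variable [CompleteSpace H]

/-- A positive operator `D` and a tuple `T` such that `∑_α b_α ⟪D T_α^* h, T_α^* h⟫ = ‖h‖²` give
an isometry intertwining the adjoints of `T` with those of the model. -/
theorem exists_kernel_of_tsum (q : ∀ i, PosRegPoly (n i)) (m : Fin k → ℕ)
    {T : ∀ i, Fin (n i) → (H →L[ℂ] H)}
    (hT : ∀ i i', i ≠ i' → ∀ j j', Commute (T i j) (T i' j')) {D : H →L[ℂ] H}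
    (hD : D.IsPositive)
    (hsum : ∀ h, ∑' α, ENNReal.ofReal ((∏ i, bCoeff (q i) (m i) (α i)) *
      D.reApplyInnerSelf (star (multiWordProd T α) h)) = ENNReal.ofReal (‖h‖ ^ 2)) :
    ∃ κ : H →ₗᵢ[ℂ] HTensor (Fock n) H, ∀ i j h,
      ampliation (ContinuousLinearMap.adjoint (model q m i j)) H (κ h) =
        κ (ContinuousLinearMap.adjoint (T i j) h) := by
  obtain ⟨R, hR⟩ := CStarAlgebra.nonneg_iff_eq_star_mul_self.1
    ((ContinuousLinearMap.nonneg_iff_isPositive D).2 hD)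
  have hRD : ∀ h, ‖R h‖ ^ 2 = D.reApplyInnerSelf h := by
    intro h
    rw [ContinuousLinearMap.reApplyInnerSelf_apply, hR]
    change _ = RCLike.re (inner ℂ (ContinuousLinearMap.adjoint R (R h)) h)
    rw [ContinuousLinearMap.adjoint_inner_left]
    exact (inner_self_eq_norm_sq (𝕜 := ℂ) _).symm
  -- The coefficients of the Poisson kernel, with `R` playing the role of `D^{1/2}`; the hypothesis
  -- on the sum says exactly that `v h` has norm `‖h‖`.
  let v : H → (∀ i, List (Fin (n i))) → H := fun h α =>
    ((√(∏ i, bCoeff (q i) (m i) (α i)) : ℝ) : ℂ) • R (star (multiWordProd T α) h)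
  have hv : ∀ h α, ‖v h α‖ ^ 2 = (∏ i, bCoeff (q i) (m i) (α i)) *
      D.reApplyInnerSelf (star (multiWordProd T α) h) := by
    intro h α
    rw [norm_smul, mul_pow, hRD, Complex.norm_real, Real.norm_eq_abs, sq_abs,
      Real.sq_sqrt (Finset.prod_nonneg fun i _ => bCoeff_nonneg _ _ _)]
  have hsum' : ∀ h, ∑' α, ENNReal.ofReal (‖v h α‖ ^ 2) = ENNReal.ofReal (‖h‖ ^ 2) := fun h => by
    rw [← hsum h]
    exact tsum_congr fun α => by rw [hv]
  have hs : ∀ h, Summable fun α => ‖v h α‖ ^ 2 := by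
    intro h
    have h1 := ENNReal.summable_toReal (f := fun α => ENNReal.ofReal (‖v h α‖ ^ 2))
      (by rw [hsum']; exact ENNReal.ofReal_ne_top)
    simpa using h1
  have ht : ∀ h, ∑' α, ‖v h α‖ ^ 2 = ‖h‖ ^ 2 := by
    intro h
    have h1 := congrArg ENNReal.toReal (hsum' h)
    rw [ENNReal.tsum_toReal_eq fun _ => ENNReal.ofReal_ne_top] at h1
    simpa using h1
  have hmem : ∀ h, Memℓp (v h) 2 := fun h => memℓp_gen (by simpa using hs h)
  let vL : H →ₗᵢ[ℂ] lp (fun _ : ∀ i, List (Fin (n i)) => H) 2 :=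
    { toFun := fun h => ⟨v h, hmem h⟩
      map_add' := fun h h' => by
        ext α
        change v (h + h') α = v h α + v h' α
        simp only [v, map_add, smul_add]
      map_smul' := fun c h => by
        ext α
        change v (c • h) α = c • v h α
        simp only [v, map_smul]
        rw [smul_comm]
      norm_map' := fun h => by
        have h1 := lp.norm_rpow_eq_tsum (p := 2) (by norm_num)
          (⟨v h, hmem h⟩ : lp (fun _ : ∀ i, List (Fin (n i)) => H) 2)
        have h2 : ‖(⟨v h, hmem h⟩ : lp (fun _ : ∀ i, List (Fin (n i)) => H) 2)‖ ^ 2 = ‖h‖ ^ 2 := by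
          rw [← ht h]
          simpa using h1
        exact (sq_eq_sq₀ (norm_nonneg _) (norm_nonneg _)).1 h2 }
  -- The `H`-valued `ℓ²` space embeds isometrically into the tensor product through the orthogonal
  -- copies `e_α ⊗ H`.
  let κ := (orthogonalFamily_basisIncl n H).linearIsometry.comp vL
  have hκ : ∀ h α g, inner ℂ (κ h) (tensorIncl (Fock n) H (basisVec α ⊗ₜ g)) =
      inner ℂ (v h α) g := by
    classical
    intro h α g
    rw [← basisIncl_apply, ← (orthogonalFamily_basisIncl n H).linearIsometry_apply_single]
    change inner ℂ ((orthogonalFamily_basisIncl n H).linearIsometry (vL h)) _ = _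
    rw [LinearIsometry.inner_map_map, lp.inner_single_right]
    rfl
  refine ⟨κ, fun i j h => htensor_ext_inner_single fun α g => ?_⟩
  change inner ℂ _ (tensorIncl (Fock n) H (basisVec α ⊗ₜ g)) =
    inner ℂ _ (tensorIncl (Fock n) H (basisVec α ⊗ₜ g))
  rw [ampliation_adjoint, ContinuousLinearMap.adjoint_inner_left, ampliation_tensorIncl_tmul,
    model_basisVec, ← TensorProduct.smul_tmul', map_smul, inner_smul_right, hκ, hκ]
  simp only [v]
  rw [inner_smul_left, inner_smul_left, ← mul_assoc, Complex.conj_ofReal, Complex.conj_ofReal,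
    ← Complex.ofReal_mul, weight_mul_sqrt_prod_bCoeff, multiWordProd_prepend hT, star_mul]
  rfl

theorem exists_kernel (q : ∀ i, PosRegPoly (n i)) (m : Fin k → ℕ) (hm : ∀ i, 1 ≤ m i)
    {T : ∀ i, Fin (n i) → (H →L[ℂ] H)} (hT : T ∈ polydomain q m H) {s : ℝ} (hs : 0 < s)
    (hs1 : s < 1) :
    ∃ κ : H →ₗᵢ[ℂ] HTensor (Fock n) H, ∀ i j h,
      ampliation (ContinuousLinearMap.adjoint (model (fun i => (q i).scale s hs) m i j)) H (κ h) =
        κ (ContinuousLinearMap.adjoint (T i j) h) :=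
  exists_kernel_of_tsum _ m hT.1 (isPositive_defect_scale q m hT hs hs1.le m fun _ => le_rfl)
    (tsum_bCoeff_scale_mul_defect q m hm hT hs hs1)

/-- Shifts along the same map differ by the shift with the difference of the weights, so uniform
convergence of the weights is norm convergence of the models. -/
theorem norm_weightedShift_sub_le {A B : Type*} {w w' : A → ℝ} {C C' ε : ℝ}
    (hw : ∀ a, |w a| ≤ C) (hw' : ∀ a, |w' a| ≤ C') {σ : A → B} (hσ : Function.Injective σ)
    (hε : 0 ≤ ε) (h : ∀ a, |w a - w' a| ≤ ε) :
    ‖weightedShift w C hw σ hσ - weightedShift w' C' hw' σ hσ‖ ≤ ε := by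
  have e : weightedPullback w C hw σ hσ - weightedPullback w' C' hw' σ hσ =
      weightedPullback (fun a => w a - w' a) ε h σ hσ := by
    ext f a
    change (w a : ℂ) * f (σ a) - (w' a : ℂ) * f (σ a) = ((w a - w' a : ℝ) : ℂ) * f (σ a)
    push_cast
    ring
  rw [weightedShift, weightedShift, ← map_sub, e, LinearIsometryEquiv.norm_map]
  exact (LinearMap.mkContinuous_norm_le _ (abs_nonneg ε) _).trans (abs_of_nonneg hε).le

theorem exists_norm_model_scale_sub_le (q : ∀ i, PosRegPoly (n i)) (m : Fin k → ℕ)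
    (hm : ∀ i, 1 ≤ m i) (i : Fin k) :
    ∃ C : ℝ, 0 ≤ C ∧ ∀ (s : ℝ) (hs : 0 < s), 1 / 2 ≤ s → s ≤ 1 → ∀ j,
      ‖model (fun i => (q i).scale s hs) m i j - model q m i j‖ ≤ C * (1 - s) := by
  obtain ⟨C, hC0, hC⟩ := exists_weight_scale_sub_le (q i) (hm i)
  exact ⟨C, hC0, fun s hs hs2 hs1 j => norm_weightedShift_sub_le _ _ _
    (mul_nonneg hC0 (by linarith)) fun α => hC s hs hs2 hs1 j (α i)⟩

end Kernel

/-! ### The limit representation -/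

section LimitRepresentation


variable {k : ℕ} {n m : Fin k → ℕ} {q : ∀ i, PosRegPoly (n i)}

/-- The linear map `X ⊗ h ↦ (X ⊗ I) κ h`. -/
def ampMap (q : ∀ i, PosRegPoly (n i)) (m : Fin k → ℕ) {H : Type*} [NormedAddCommGroup H]
    [InnerProductSpace ℂ H] (κ : H →ₗᵢ[ℂ] HTensor (Fock n) H) :
    CstarW q m ⊗[ℂ] H →ₗ[ℂ] HTensor (Fock n) H :=
  TensorProduct.lift (LinearMap.mk₂ ℂ
    (fun X h => ampliation (X : Fock n →L[ℂ] Fock n) H (κ h))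
    (fun X Y h => by
      change ampliation ((X : Fock n →L[ℂ] Fock n) + (Y : Fock n →L[ℂ] Fock n)) H (κ h) = _
      rw [ampliation_add]; rfl)
    (fun c X h => by
      change ampliation (c • (X : Fock n →L[ℂ] Fock n)) H (κ h) = _
      rw [ampliation_smul]; rfl)
    (fun X h h' => by rw [map_add, map_add])
    (fun c X h => by rw [map_smul, map_smul]))

variable {H : Type u} [NormedAddCommGroup H] [InnerProductSpace ℂ H]

theorem ampMap_tmul (κ : H →ₗᵢ[ℂ] HTensor (Fock n) H) (X : CstarW q m) (h : H) :
    ampMap q m κ (X ⊗ₜ h) = ampliation (X : Fock n →L[ℂ] Fock n) H (κ h) := rfl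

theorem ampMap_mulLeft (κ : H →ₗᵢ[ℂ] HTensor (Fock n) H) (X : CstarW q m)
    (v : CstarW q m ⊗[ℂ] H) :
    ampMap q m κ ((LinearMap.mulLeft ℂ X).rTensor H v) =
      ampliation (X : Fock n →L[ℂ] Fock n) H (ampMap q m κ v) := by
  induction v using TensorProduct.induction_on with
  | zero => simp only [map_zero]
  | add v w hv hw => simp only [map_add, hv, hw]
  | tmul Y h =>
    rw [LinearMap.rTensor_tmul, LinearMap.mulLeft_apply, ampMap_tmul, ampMap_tmul,
      MulMemClass.coe_mul, ampliation_mul]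
    rfl

/-- The bound is independent of `κ`, as is needed for inner products to converge along an
ultrafilter. -/
theorem exists_norm_ampMap_le (v : CstarW q m ⊗[ℂ] H) :
    ∃ C : ℝ, ∀ κ : H →ₗᵢ[ℂ] HTensor (Fock n) H, ‖ampMap q m κ v‖ ≤ C := by
  induction v using TensorProduct.induction_on with
  | zero => exact ⟨0, fun κ => by rw [map_zero, norm_zero]⟩
  | add v w hv hw =>
    obtain ⟨C, hC⟩ := hv
    obtain ⟨C', hC'⟩ := hw
    exact ⟨C + C', fun κ => by
      rw [map_add]
      exact (norm_add_le _ _).trans (add_le_add (hC κ) (hC' κ))⟩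
  | tmul X h =>
    refine ⟨‖X‖ * ‖h‖, fun κ => ?_⟩
    rw [ampMap_tmul]
    refine (ContinuousLinearMap.le_opNorm _ _).trans ?_
    rw [κ.norm_map]
    exact mul_le_mul_of_nonneg_right (norm_ampliation_le _) (norm_nonneg _)

theorem clm_ext_denseRange {V E F : Type*} [AddCommGroup V] [Module ℂ V] [NormedAddCommGroup E]
    [InnerProductSpace ℂ E] [NormedAddCommGroup F] [InnerProductSpace ℂ F] {f : V →ₗ[ℂ] E}
    (hf : DenseRange f) {S T : E →L[ℂ] F} (h : ∀ v, S (f v) = T (f v)) : S = T := by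
  ext x
  exact congrFun (hf.equalizer S.continuous T.continuous (funext h)) x

theorem rTensor_mulLeft_mul {A V : Type*} [Ring A] [Algebra ℂ A] [AddCommGroup V] [Module ℂ V]
    (X Y : A) (v : A ⊗[ℂ] V) : (LinearMap.mulLeft ℂ (X * Y)).rTensor V v =
      (LinearMap.mulLeft ℂ X).rTensor V ((LinearMap.mulLeft ℂ Y).rTensor V v) := by
  rw [LinearMap.mulLeft_mul, LinearMap.rTensor_comp]
  rfl

theorem rTensor_mulLeft_add {A V : Type*} [Ring A] [Algebra ℂ A] [AddCommGroup V] [Module ℂ V]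
    (X Y : A) (v : A ⊗[ℂ] V) : (LinearMap.mulLeft ℂ (X + Y)).rTensor V v =
      (LinearMap.mulLeft ℂ X).rTensor V v + (LinearMap.mulLeft ℂ Y).rTensor V v := by
  have : LinearMap.mulLeft ℂ (X + Y) = LinearMap.mulLeft ℂ X + LinearMap.mulLeft ℂ Y := by
    ext1 Z
    exact add_mul X Y Z
  rw [this, LinearMap.rTensor_add]
  rfl

theorem rTensor_mulLeft_algebraMap {A V : Type*} [Ring A] [Algebra ℂ A] [AddCommGroup V]
    [Module ℂ V] (c : ℂ) (v : A ⊗[ℂ] V) :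
    (LinearMap.mulLeft ℂ (algebraMap ℂ A c)).rTensor V v = c • v := by
  have : LinearMap.mulLeft ℂ (algebraMap ℂ A c) = c • LinearMap.id := by
    ext1 Z
    exact (Algebra.smul_def c Z).symm
  rw [this, LinearMap.rTensor_smul, LinearMap.rTensor_id]
  rfl

set_option maxHeartbeats 1000000 in
-- For each kernel, left multiplication on `C^*(W) ⊗ H` corresponds to the operators `X ⊗ I`. The
-- algebraic relations already hold on `C^*(W) ⊗ H`; the norm bound and the adjoint relation pass to
-- the limit of the inner products.
theorem exists_limit_representation (U : Ultrafilter ℕ) (κ : ℕ → H →ₗᵢ[ℂ] HTensor (Fock n) H) :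
    ∃ (K : Type u) (_ : NormedAddCommGroup K) (_ : InnerProductSpace ℂ K) (_ : CompleteSpace K)
      (Λ : CstarW q m ⊗[ℂ] H →ₗ[ℂ] K) (ρ : CstarW q m →⋆ₐ[ℂ] (K →L[ℂ] K)), DenseRange Λ ∧
      (∀ v, Filter.Tendsto (fun N => ‖ampMap q m (κ N) v‖) U (nhds ‖Λ v‖)) ∧
      ∀ X v, ρ X (Λ v) = Λ ((LinearMap.mulLeft ℂ X).rTensor H v) := by
  obtain ⟨K, _, _, _, Λ, hΛ, hlim⟩ := exists_limit_space U (fun N => ampMap q m (κ N))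
    (fun v => by
      obtain ⟨C, hC⟩ := exists_norm_ampMap_le v
      exact ⟨C, fun N => hC (κ N)⟩)
  have hnorm : ∀ v, Filter.Tendsto (fun N => ‖ampMap q m (κ N) v‖) U (nhds ‖Λ v‖) := by
    intro v
    have h1 := ((Complex.continuous_re.tendsto _).comp (hlim v v)).sqrt
    convert h1 using 1
    · funext N
      exact norm_eq_sqrt_re_inner (𝕜 := ℂ) _
    · exact congrArg nhds (norm_eq_sqrt_re_inner (𝕜 := ℂ) _)
  have hex : ∀ X : CstarW q m, ∃ S : K →L[ℂ] K, ∀ v,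
      S (Λ v) = Λ ((LinearMap.mulLeft ℂ X).rTensor H v) := by
    intro X
    refine exists_clm_of_denseRange hΛ (Λ ∘ₗ (LinearMap.mulLeft ℂ X).rTensor H) (C := ‖X‖)
      fun v => ?_
    refine le_of_tendsto_of_tendsto' (hnorm _) ((hnorm v).const_mul ‖X‖) fun N => ?_
    rw [ampMap_mulLeft]
    exact (ContinuousLinearMap.le_opNorm _ _).trans
      (mul_le_mul_of_nonneg_right (norm_ampliation_le _) (norm_nonneg _))
  choose S hS using hex
  have hSalg : ∀ c : ℂ, S (algebraMap ℂ (CstarW q m) c) = algebraMap ℂ _ c := fun c =>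
    clm_ext_denseRange hΛ fun v => by
      rw [hS, rTensor_mulLeft_algebraMap, map_smul, Algebra.algebraMap_eq_smul_one]; rfl
  have hSstar : ∀ X, S (star X) = star (S X) := by
    intro X
    rw [ContinuousLinearMap.star_eq_adjoint]
    refine clm_ext_denseRange hΛ fun v => ?_
    refine ext_inner_left ℂ fun y => ?_
    rw [ContinuousLinearMap.adjoint_inner_right]
    refine hΛ.induction_on (p := fun y => inner ℂ y (S (star X) (Λ v)) = inner ℂ (S X y) (Λ v)) y
      (isClosed_eq (by fun_prop) (by fun_prop)) fun w => ?_
    rw [hS, hS]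
    refine tendsto_nhds_unique (hlim _ _) ((hlim _ _).congr fun N => ?_)
    rw [ampMap_mulLeft, ampMap_mulLeft]
    have e : ((star X : CstarW q m) : Fock n →L[ℂ] Fock n) =
      ContinuousLinearMap.adjoint (X : Fock n →L[ℂ] Fock n) := rfl
    rw [e, ampliation_adjoint, ContinuousLinearMap.adjoint_inner_right]
  have hSmul : ∀ X Y, S (X * Y) = S X * S Y := fun X Y =>
    clm_ext_denseRange hΛ fun v => by
      have e : (S X * S Y) (Λ v) = S X (S Y (Λ v)) := rfl
      rw [e, hS, hS, hS, rTensor_mulLeft_mul]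
  have hSadd : ∀ X Y, S (X + Y) = S X + S Y := fun X Y =>
    clm_ext_denseRange hΛ fun v => by
      rw [_root_.add_apply, hS, hS, hS, rTensor_mulLeft_add, map_add]
  have hSone : S 1 = 1 := by
    have := hSalg 1
    rwa [map_one, map_one] at this
  have hSzero : S 0 = 0 := by
    have := hSalg 0
    rwa [map_zero, map_zero] at this
  refine ⟨K, inferInstance, inferInstance, inferInstance, Λ,
    { toFun := S
      map_one' := hSone
      map_zero' := hSzero
      map_mul' := hSmul
      map_add' := hSadd
      commutes' := hSalg
      map_star' := hSstar }, hΛ, hnorm, hS⟩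

/-- For `T` in the polydomain there is a representation `ρ` with a `ρ`-cyclic isometric copy of
`H` which is co-invariant under the operators `ρ(W_{i,j})` and on which their adjoints act as
those of `T`. -/
theorem exists_cyclic_representation [CompleteSpace H] (hm : ∀ i, 1 ≤ m i)
    {T : ∀ i, Fin (n i) → (H →L[ℂ] H)} (hT : T ∈ polydomain q m H) :
    ∃ (K : Type u) (_ : NormedAddCommGroup K) (_ : InnerProductSpace ℂ K) (_ : CompleteSpace K)
      (ρ : CstarW q m →⋆ₐ[ℂ] (K →L[ℂ] K)) (J : H →ₗᵢ[ℂ] K),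
      (∀ i j h, ContinuousLinearMap.adjoint (ρ (genW q m i j)) (J h) =
        J (ContinuousLinearMap.adjoint (T i j) h)) ∧
      (Submodule.span ℂ {x | ∃ X h, x = ρ X (J h)}).topologicalClosure = ⊤ := by
  -- Any sequence in `[1/2, 1)` with limit `1` would do; `1/2` is the range of the weight estimate.
  let s : ℕ → ℝ := fun N => 1 - 1 / ((N : ℝ) + 2)
  have hN : ∀ N : ℕ, (0 : ℝ) < N + 2 := fun N => by positivity
  have hs2 : ∀ N, 1 / 2 ≤ s N := fun N => by
    have h1 : 1 / ((N : ℝ) + 2) ≤ 1 / 2 :=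
      one_div_le_one_div_of_le (by norm_num) (by linarith [Nat.cast_nonneg (α := ℝ) N])
    change 1 / 2 ≤ 1 - 1 / ((N : ℝ) + 2)
    linarith
  have hs1 : ∀ N, s N < 1 := fun N => by
    have := one_div_pos.2 (hN N)
    change 1 - 1 / ((N : ℝ) + 2) < 1
    linarith
  have hs0 : ∀ N, 0 < s N := fun N => lt_of_lt_of_le (by norm_num) (hs2 N)
  have hs : Filter.Tendsto (fun N => 1 - s N) Filter.atTop (nhds 0) := by
    have h1 := (tendsto_one_div_add_atTop_nhds_zero_nat (𝕜 := ℝ)).comp (Filter.tendsto_add_atTop_nat 1)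
    refine h1.congr fun N => ?_
    change 1 / (((N + 1 : ℕ) : ℝ) + 1) = 1 - (1 - 1 / ((N : ℝ) + 2))
    push_cast
    rw [sub_sub_cancel]
    congr 1
    ring
  choose κ hκ using fun N => exists_kernel q m hm hT (hs0 N) (hs1 N)
  obtain ⟨K, _, _, _, Λ, ρ, hΛ, hnorm, hρ⟩ :=
    exists_limit_representation (q := q) (m := m) (Filter.hyperfilter ℕ) κ
  let J : H →ₗᵢ[ℂ] K := ⟨Λ ∘ₗ TensorProduct.mk ℂ (CstarW q m) H 1, fun h => by
    refine tendsto_nhds_unique (hnorm _) (tendsto_const_nhds.congr fun N => ?_)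
    rw [TensorProduct.mk_apply, ampMap_tmul]
    change ‖h‖ = ‖ampliation (1 : Fock n →L[ℂ] Fock n) H (κ N h)‖
    rw [ampliation_one]
    exact ((κ N).norm_map h).symm⟩
  have hJ : ∀ X h, ρ X (J h) = Λ (X ⊗ₜ h) := by
    intro X h
    change ρ X (Λ (1 ⊗ₜ h)) = _
    rw [hρ, LinearMap.rTensor_tmul, LinearMap.mulLeft_apply, mul_one]
  refine ⟨K, inferInstance, inferInstance, inferInstance, ρ, J, fun i j h => ?_, ?_⟩
  -- The norm of the difference is the limit of the norms of `((W^* - W^{(s)*}) ⊗ I) κ_s h`, since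
  -- `κ_s` intertwines exactly with the scaled model; these norms are at most `C (1 - s) ‖h‖`.
  · rw [← ContinuousLinearMap.star_eq_adjoint, ← map_star, hJ, ← sub_eq_zero]
    change Λ _ - Λ (1 ⊗ₜ _) = 0
    rw [← map_sub, ← norm_eq_zero]
    obtain ⟨C, hC0, hC⟩ := exists_norm_model_scale_sub_le q m hm i
    have hz : Filter.Tendsto (fun N => C * (1 - s N) * ‖h‖) (Filter.hyperfilter ℕ) (nhds 0) := by
      have h1 := ((hs.const_mul C).mul_const ‖h‖).mono_left
        (Nat.hyperfilter_le_atTop)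
      simpa using h1
    refine tendsto_nhds_unique (hnorm _) (squeeze_zero (fun N => norm_nonneg _) (fun N => ?_) hz)
    rw [map_sub, ampMap_tmul, ampMap_tmul]
    have e1 : ampliation ((1 : CstarW q m) : Fock n →L[ℂ] Fock n) H
        (κ N (ContinuousLinearMap.adjoint (T i j) h)) =
        κ N (ContinuousLinearMap.adjoint (T i j) h) := by
      change ampliation (1 : Fock n →L[ℂ] Fock n) H _ = _
      rw [ampliation_one]; rfl
    have e2 : ((star (genW q m i j) : CstarW q m) : Fock n →L[ℂ] Fock n) =
      ContinuousLinearMap.adjoint (model q m i j) := rfl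
    rw [e1, e2, ← hκ, ← _root_.sub_apply, ← ampliation_sub, ← map_sub]
    refine (ContinuousLinearMap.le_opNorm _ _).trans ?_
    rw [(κ N).norm_map]
    refine mul_le_mul_of_nonneg_right ((norm_ampliation_le _).trans ?_) (norm_nonneg _)
    rw [LinearIsometryEquiv.norm_map, norm_sub_rev]
    exact hC (s N) (hs0 N) (hs2 N) (hs1 N).le j
  · rw [eq_top_iff]
    intro x _
    refine closure_mono ?_ (hΛ x)
    rintro _ ⟨v, rfl⟩
    induction v using TensorProduct.induction_on with
    | zero => rw [map_zero]; exact zero_mem _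
    | add v w hv hw => rw [map_add]; exact add_mem hv hw
    | tmul X h => exact Submodule.subset_span ⟨X, h, (hJ X h).symm⟩

end LimitRepresentation

/-! ### The dilation theorem -/

section DilationTheorem


variable {k : ℕ} {n m : Fin k → ℕ} {q : ∀ i, PosRegPoly (n i)}
variable {H : Type*} [NormedAddCommGroup H] [InnerProductSpace ℂ H] [CompleteSpace H]
variable {K : Type*} [NormedAddCommGroup K] [InnerProductSpace ℂ K] [CompleteSpace K]

/-- By co-invariance the compression `Y ↦ J^* Y J` satisfies the conjugation identity of
`apply_defect`. -/
theorem adjoint_comp_defect_comp {T : ∀ i, Fin (n i) → (H →L[ℂ] H)}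
    {S : ∀ i, Fin (n i) → (K →L[ℂ] K)} (J : H →ₗᵢ[ℂ] K)
    (hJ : ∀ i j h, ContinuousLinearMap.adjoint (S i j) (J h) =
      J (ContinuousLinearMap.adjoint (T i j) h)) (p : Fin k → ℕ) :
    ContinuousLinearMap.adjoint J.toContinuousLinearMap ∘L
      (defect q p S 1 ∘L J.toContinuousLinearMap) = defect q p T 1 := by
  let j := J.toContinuousLinearMap
  let Θ : (K →L[ℂ] K) →ₗ[ℂ] (H →L[ℂ] H) :=
    { toFun := fun Y => ContinuousLinearMap.adjoint j ∘L (Y ∘L j)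
      map_add' := fun X Y => by
        ext h
        change ContinuousLinearMap.adjoint j (X (j h) + Y (j h)) = _
        rw [map_add]; rfl
      map_smul' := fun c Y => by
        ext h
        change ContinuousLinearMap.adjoint j (c • Y (j h)) = _
        rw [map_smul]; rfl }
  have hΘ : ∀ i l Y, Θ (S i l * Y * star (S i l)) = T i l * Θ Y * star (T i l) := by
    intro i l Y
    ext h
    refine ext_inner_left ℂ fun y => ?_
    change inner ℂ y (ContinuousLinearMap.adjoint j (S i l (Y (ContinuousLinearMap.adjoint (S i l)
      (J h))))) = inner ℂ y (T i l (ContinuousLinearMap.adjoint j (Y (j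
        (ContinuousLinearMap.adjoint (T i l) h)))))
    rw [hJ, ContinuousLinearMap.adjoint_inner_right, ← ContinuousLinearMap.adjoint_inner_left,
      ← ContinuousLinearMap.adjoint_inner_left (T i l), ContinuousLinearMap.adjoint_inner_right]
    change inner ℂ (ContinuousLinearMap.adjoint (S i l) (J y)) _ = inner ℂ (J _) _
    rw [hJ]
    rfl
  have h1 : Θ 1 = 1 := by
    ext h
    refine ext_inner_left ℂ fun y => ?_
    change inner ℂ y (ContinuousLinearMap.adjoint j (J h)) = inner ℂ y h
    rw [ContinuousLinearMap.adjoint_inner_right]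
    exact J.inner_map_map y h
  have h2 := apply_defect Θ hΘ q p 1
  rw [h1] at h2
  exact h2

theorem exists_isSelfAdjoint_mul_self {D : H →L[ℂ] H} (hD : D.IsPositive) :
    ∃ R : H →L[ℂ] H, IsSelfAdjoint R ∧ R * R = D := by
  have h := (ContinuousLinearMap.nonneg_iff_isPositive D).2 hD
  exact ⟨CFC.sqrt D, (CFC.sqrt_nonneg D).isSelfAdjoint, CFC.sqrt_mul_sqrt_self D h⟩

/-- Closures of ranges of self-adjoint operators are the complements of their kernels, and `R²` has
the kernel of `R`. So the defect space is also the closed range of `Δ_T^{1/2}`. -/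
theorem topologicalClosure_range_mul_self {R : H →L[ℂ] H} (hR : IsSelfAdjoint R) :
    (LinearMap.range (R * R).toLinearMap).topologicalClosure =
      (LinearMap.range R.toLinearMap).topologicalClosure := by
  have hR' : ∀ x y, inner ℂ (R x) y = inner ℂ x (R y) := fun x y => by
    rw [← ContinuousLinearMap.adjoint_inner_right, ← ContinuousLinearMap.star_eq_adjoint, hR.star_eq]
  rw [← Submodule.orthogonal_orthogonal_eq_closure, ← Submodule.orthogonal_orthogonal_eq_closure]
  congr 1
  ext x
  rw [Submodule.mem_orthogonal, Submodule.mem_orthogonal]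
  constructor
  · intro h
    have h1 : R x = 0 := by
      have h2 := h (R (R x)) ⟨x, rfl⟩
      rw [hR', inner_self_eq_zero] at h2
      exact h2
    rintro _ ⟨y, rfl⟩
    change inner ℂ (R y) x = 0
    rw [hR', h1, inner_zero_right]
  · rintro h _ ⟨y, rfl⟩
    exact h _ ⟨R y, rfl⟩

/-! ### The defect space as the range of the vacuum projection. -/

section Range

variable {ρ : RepW q m K} {J : H →ₗᵢ[ℂ] K} {T : ∀ i, Fin (n i) → (H →L[ℂ] H)}

theorem map_star_multiWordProd_apply
    (hJ : ∀ i j h, ρ (star (genW q m i j)) (J h) = J (star (T i j) h)) (h1 : ρ 1 = 1)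
    (α : ∀ i, List (Fin (n i))) (h : H) :
    ρ (star (multiWordProd (genW q m) α)) (J h) = J (star (multiWordProd T α) h) := by
  have hmul : ∀ (x y : CstarW q m) (a b : H →L[ℂ] H), (∀ h, ρ (star x) (J h) = J (star a h)) →
      (∀ h, ρ (star y) (J h) = J (star b h)) → ∀ h, ρ (star (x * y)) (J h) = J (star (a * b) h) := by
    intro x y a b hx hy h
    rw [star_mul, map_mul_apply, hx, hy, star_mul]
    rfl
  have hone : ∀ h, ρ (star (1 : CstarW q m)) (J h) = J (star (1 : H →L[ℂ] H) h) := fun h => by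
    rw [star_one, star_one, h1]
    rfl
  have hw : ∀ i γ h, ρ (star (wordProd (genW q m i) γ)) (J h) = J (star (wordProd (T i) γ) h) := by
    intro i γ
    induction γ with
    | nil => exact hone
    | cons j γ ih =>
      rw [wordProd_cons, wordProd_cons]
      exact hmul _ _ _ _ (hJ i j) ih
  have key : ∀ l : List (Fin k), ∀ h,
      ρ (star (l.map fun i => wordProd (genW q m i) (α i)).prod) (J h) =
        J (star (l.map fun i => wordProd (T i) (α i)).prod h) := by
    intro l
    induction l with
    | nil => exact hone
    | cons i l ih =>
      rw [List.map_cons, List.map_cons, List.prod_cons, List.prod_cons]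
      exact hmul _ _ _ _ (hw i (α i)) ih
  have h2 := key (List.finRange k) h
  rwa [← List.ofFn_eq_map, ← List.ofFn_eq_map] at h2

/-- By cyclicity it suffices to treat `ρ(P X) J h`. Here `P X = θ(X^* e_∅)^*` is a limit of
combinations of the `P W_α^*`, and `ρ(W_α^*) J h = J T_α^* h`, so nothing beyond `ρ(P) J H` arises.
-/
theorem range_vacProj_le (hm : ∀ i, 1 ≤ m i)
    (hJ : ∀ i j h, ρ (star (genW q m i j)) (J h) = J (star (T i j) h)) (h1 : ρ 1 = 1)
    (hcyc : (Submodule.span ℂ {x | ∃ X h, x = ρ X (J h)}).topologicalClosure = ⊤) :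
    LinearMap.range (ρ (vacProj q m)).toLinearMap ≤
      (LinearMap.range ((ρ (vacProj q m)).toLinearMap ∘ₗ J.toLinearMap)).topologicalClosure := by
  set N := (LinearMap.range ((ρ (vacProj q m)).toLinearMap ∘ₗ J.toLinearMap)).topologicalClosure
    with hN
  have hNc : IsClosed (N : Set K) := Submodule.isClosed_topologicalClosure _
  have hb : ∀ α h, ρ (star (theta hm (basisVec α))) (J h) ∈ N := by
    intro α h
    obtain ⟨c, hc, hα⟩ := exists_multiWordProd_mul_vacProj (q := q) hm α
    have e : star (theta hm (basisVec α)) =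
        (star c)⁻¹ • (vacProj q m * star (multiWordProd (genW q m) α)) := by
      have h2 := congrArg star hα
      rw [star_mul, star_vacProj hm, star_smul] at h2
      rw [h2, inv_smul_smul₀ (star_ne_zero.2 hc)]
    rw [e, map_smul, _root_.smul_apply, map_mul_apply, map_star_multiWordProd_apply hJ h1]
    exact N.smul_mem _ (Submodule.le_topologicalClosure _ ⟨_, rfl⟩)
  have hξ : ∀ ξ h, ρ (star (theta hm ξ)) (J h) ∈ N := by
    intro ξ h
    have hc : Continuous fun ξ => ρ (star (theta hm ξ)) (J h) := by
      have c1 : Continuous fun ξ : Fock n => star (thetaL q hm ξ) := (thetaL q hm).continuous.star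
      exact (ρ.continuous.comp c1).clm_apply continuous_const
    refine hNc.mem_of_tendsto ((hc.tendsto ξ).comp (hasSum_basisVec ξ))
      (Filter.Eventually.of_forall fun s => ?_)
    change ρ (star (theta hm (∑ α ∈ s, ξ α • basisVec α))) (J h) ∈ N
    rw [← thetaL_apply, map_sum, star_sum, map_sum, sum_apply]
    refine N.sum_mem fun α _ => ?_
    rw [map_smul, star_smul, map_smul, _root_.smul_apply]
    exact N.smul_mem _ (hb α h)
  have hle : (Submodule.span ℂ {x | ∃ X h, x = ρ X (J h)}).topologicalClosure ≤
      N.comap (ρ (vacProj q m)).toLinearMap := by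
    refine Submodule.topologicalClosure_minimal _ (Submodule.span_le.2 ?_)
      (hNc.preimage (ρ (vacProj q m)).continuous)
    rintro _ ⟨X, h, rfl⟩
    change ρ (vacProj q m) (ρ X (J h)) ∈ N
    have e : vacProj q m * X = star (theta hm (((star X : CstarW q m) :
        Fock n →L[ℂ] Fock n) (vacuum n))) := by
      rw [← mul_theta, star_mul, star_star, theta_vacuum, star_vacProj hm]
    rw [← map_mul_apply, e]
    exact hξ _ h
  rintro _ ⟨x, rfl⟩
  exact hle (hcyc.symm ▸ Submodule.mem_top : x ∈ _)

/-- Compressing the defect gives `‖ρ(P) J h‖² = ⟪h, Δ_T h⟫ = ‖R h‖²` with `R = Δ_T^{1/2}`, so `R h ↦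
ρ(P) J h` extends to a unitary between the closures. -/
theorem exists_defectSpace_isometry (hm : ∀ i, 1 ≤ m i) (hT : T ∈ polydomain q m H)
    (hJ : ∀ i j h, ρ (star (genW q m i j)) (J h) = J (star (T i j) h)) (h1 : ρ 1 = 1)
    (hcyc : (Submodule.span ℂ {x | ∃ X h, x = ρ X (J h)}).topologicalClosure = ⊤) :
    ∃ ι : defectSpace q m T →ₗᵢ[ℂ] K,
      LinearMap.range ι.toLinearMap = LinearMap.range (ρ (vacProj q m)).toLinearMap := by
  obtain ⟨R, hR, hRR⟩ := exists_isSelfAdjoint_mul_self (hT.2 m fun _ => le_rfl)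
  have hcl : defectSpace q m T = (LinearMap.range R.toLinearMap).topologicalClosure := by
    rw [defectSpace, ← hRR]
    exact topologicalClosure_range_mul_self hR
  let f : H →ₗ[ℂ] defectSpace q m T := R.toLinearMap.codRestrict _ fun h =>
    hcl ▸ Submodule.le_topologicalClosure _ ⟨h, rfl⟩
  let G := LinearMap.range (ρ (vacProj q m)).toLinearMap
  have hGc : CompleteSpace G := (isClosed_range_vacProj hm ρ).completeSpace_coe
  let g : H →ₗ[ℂ] G := ((ρ (vacProj q m)).toLinearMap ∘ₗ J.toLinearMap).codRestrict _ fun h =>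
    ⟨J h, rfl⟩
  have hf : DenseRange f := by
    intro y
    rw [closure_subtype]
    have hy : (y : H) ∈ closure (LinearMap.range R.toLinearMap : Set H) := hcl.le y.2
    refine closure_mono ?_ hy
    rintro _ ⟨h, rfl⟩
    exact ⟨f h, ⟨h, rfl⟩, rfl⟩
  have hg : DenseRange g := by
    intro y
    rw [closure_subtype]
    have hy : (y : K) ∈ closure
      (LinearMap.range ((ρ (vacProj q m)).toLinearMap ∘ₗ J.toLinearMap) : Set K) :=
      range_vacProj_le hm hJ h1 hcyc y.2
    refine closure_mono ?_ hy
    rintro _ ⟨h, rfl⟩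
    exact ⟨g h, ⟨h, rfl⟩, rfl⟩
  have hdef := adjoint_comp_defect_comp (q := q) (S := repTuple ρ) (T := T) J (fun i j h => by
    have := hJ i j h
    rwa [map_star] at this) m
  rw [defect_repTuple h1] at hdef
  have hnorm : ∀ h, ‖g h‖ = ‖f h‖ := by
    intro h
    change ‖ρ (vacProj q m) (J h)‖ = ‖R h‖
    have e1 : inner ℂ (ρ (vacProj q m) (J h)) (ρ (vacProj q m) (J h)) =
        inner ℂ (J h) (ρ (vacProj q m) (J h)) := by
      rw [← map_star_apply_inner, star_vacProj hm, vacProj_apply_vacProj hm]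
    have e2 : inner ℂ (J h) (ρ (vacProj q m) (J h)) = inner ℂ h (defect q m T 1 h) := by
      rw [← hdef]
      exact (ContinuousLinearMap.adjoint_inner_right J.toContinuousLinearMap h _).symm
    have e3 : inner ℂ h (defect q m T 1 h) = inner ℂ (R h) (R h) := by
      rw [← hRR]
      change inner ℂ h (R (R h)) = _
      conv_lhs => rw [← hR.star_eq]
      rw [ContinuousLinearMap.star_eq_adjoint, ContinuousLinearMap.adjoint_inner_right]
      rw [← ContinuousLinearMap.star_eq_adjoint, hR.star_eq]
    have e4 := e1.trans (e2.trans e3)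
    rw [inner_self_eq_norm_sq_to_K, inner_self_eq_norm_sq_to_K] at e4
    have e5 : ‖ρ (vacProj q m) (J h)‖ ^ 2 = ‖R h‖ ^ 2 := by exact_mod_cast e4
    exact (sq_eq_sq₀ (norm_nonneg _) (norm_nonneg _)).1 e5
  obtain ⟨e, -⟩ := exists_linearIsometryEquiv_of_denseRange hf hg hnorm
  refine ⟨G.subtypeₗᵢ.comp e.toLinearIsometry, ?_⟩
  ext x
  constructor
  · rintro ⟨y, rfl⟩
    exact (e y).2
  · intro hx
    exact ⟨e.symm ⟨x, hx⟩, congrArg Subtype.val (e.apply_symm_apply ⟨x, hx⟩)⟩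

end Range

theorem exists_prod_equiv {E : Type*} [NormedAddCommGroup E] [InnerProductSpace ℂ E]
    [CompleteSpace E] {M : Submodule ℂ K} [CompleteSpace M] (U : E ≃ₗᵢ[ℂ] M) :
    ∃ Ω : WithLp 2 (E × Mᗮ) ≃ₗᵢ[ℂ] K, ∀ x y, Ω (WithLp.toLp 2 (x, y)) = (U x : K) + y := by
  let f : (E × Mᗮ) →ₗ[ℂ] WithLp 2 (E × Mᗮ) := (WithLp.linearEquiv 2 ℂ (E × Mᗮ)).symm.toLinearMap
  let g : (E × Mᗮ) →ₗ[ℂ] K := (M.subtype ∘ₗ U.toLinearEquiv.toLinearMap).coprod Mᗮ.subtype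
  have hf : DenseRange f := (WithLp.linearEquiv 2 ℂ (E × Mᗮ)).symm.surjective.denseRange
  have hg : DenseRange g := by
    refine Function.Surjective.denseRange fun x => ?_
    obtain ⟨y, hy, z, hz, rfl⟩ := M.exists_add_mem_mem_orthogonal x
    refine ⟨(U.symm ⟨y, hy⟩, ⟨z, hz⟩), ?_⟩
    change (U (U.symm ⟨y, hy⟩) : K) + z = _
    simp
  obtain ⟨Ω, hΩ⟩ := exists_linearIsometryEquiv_of_denseRange hf hg (fun v => by
    have h1 := norm_add_sq_eq_norm_sq_add_norm_sq_of_inner_eq_zero (𝕜 := ℂ) (U v.1 : K) (v.2 : K)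
      (v.2.2 _ (U v.1).2)
    have h2 := WithLp.prod_norm_sq_eq_of_L2 (f v)
    have e0 : ‖(U v.1 : K)‖ = ‖v.1‖ := U.norm_map v.1
    refine (sq_eq_sq₀ (norm_nonneg _) (norm_nonneg _)).1 ?_
    rw [h2, sq]
    refine h1.trans ?_
    rw [e0, ← sq, ← sq]
    rfl)
  exact ⟨Ω, fun x y => hΩ (x, y)⟩

theorem mem_cstarOf_of_map {L : Type*} [NormedAddCommGroup L] [InnerProductSpace ℂ L]
    [CompleteSpace L] (φ : CstarW q m →⋆ₐ[ℂ] (L →L[ℂ] L)) (X : CstarW q m) :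
    φ X ∈ cstarOf fun i j => φ (genW q m i j) := by
  have hc : Continuous φ := RepW.continuous φ.toNonUnitalStarAlgHom
  refine cstarOf_induction (p := fun X : CstarW q m => φ X ∈ cstarOf fun i j => φ (genW q m i j))
    ((isClosed_cstarOf _).preimage hc) (fun i j => mem_cstarOf _ i j) (fun c => ?_)
    (fun x y hx hy => ?_) (fun x y hx hy => ?_) (fun x hx => ?_) X
  · rw [AlgHomClass.commutes]; exact algebraMap_mem _ c
  · rw [map_add]; exact add_mem hx hy
  · rw [map_mul]; exact mul_mem hx hy
  · rw [map_star]; exact star_mem hx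

theorem separableSpace_of_cyclic {H : Type*} [NormedAddCommGroup H] [InnerProductSpace ℂ H]
    [TopologicalSpace.SeparableSpace H]
    (ρ : CstarW q m →⋆ₐ[ℂ] (K →L[ℂ] K)) (J : H →ₗᵢ[ℂ] K)
    (hcyc : (Submodule.span ℂ {x | ∃ X h, x = ρ X (J h)}).topologicalClosure = ⊤) :
    TopologicalSpace.SeparableSpace K := by
  have hsep : TopologicalSpace.SeparableSpace (CstarW q m) :=
    (isSeparable_cstarOf (model q m)).separableSpace
  have hc : Continuous fun x : CstarW q m × H => ρ x.1 (J x.2) :=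
    ((RepW.continuous ρ.toNonUnitalStarAlgHom).comp continuous_fst).clm_apply (J.continuous.comp continuous_snd)
  have h1 : TopologicalSpace.IsSeparable {x | ∃ X h, x = ρ X (J h)} := by
    refine (TopologicalSpace.isSeparable_range hc).mono ?_
    rintro _ ⟨X, h, rfl⟩
    exact ⟨(X, h), rfl⟩
  have h2 := h1.span (R := ℂ).closure
  have h3 : closure (Submodule.span ℂ {x | ∃ X h, x = ρ X (J h)} : Set K) = Set.univ :=
    congrArg (fun S : Submodule ℂ K => (S : Set K)) hcyc
  rw [h3] at h2
  exact TopologicalSpace.isSeparable_univ_iff.1 h2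

/-! ### Transport of cyclicity and co-invariance along a unitary. -/

section Transport

variable {L : Type*} [NormedAddCommGroup L] [InnerProductSpace ℂ L] [CompleteSpace L]
  {ρ : CstarW q m →⋆ₐ[ℂ] (K →L[ℂ] K)} {Ω : L ≃ₗᵢ[ℂ] K} {S : ∀ i, Fin (n i) → (L →L[ℂ] L)}

theorem symm_apply_mem_cstarOf (hS : ∀ i j x, Ω (S i j x) = ρ (genW q m i j) (Ω x))
    (X : CstarW q m) : ∃ Y ∈ cstarOf S, ∀ x, Y x = Ω.symm (ρ X (Ω x)) := by
  -- Conjugating `ρ` by `Ω` gives a representation sending the generators to `S`, so its image lies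
  -- in `cstarOf S`.
  let φ : CstarW q m →⋆ₐ[ℂ] (L →L[ℂ] L) := Ω.symm.conjStarAlgEquiv.toStarAlgHom.comp ρ
  have hφ : (fun i j => φ (genW q m i j)) = S := by
    funext i j
    ext1 x
    change Ω.symm (ρ (genW q m i j) (Ω x)) = S i j x
    rw [← hS, Ω.symm_apply_apply]
  exact ⟨φ X, hφ ▸ mem_cstarOf_of_map φ X, fun x => rfl⟩

theorem adjoint_apply_symm (hS : ∀ i j x, Ω (S i j x) = ρ (genW q m i j) (Ω x)) (i : Fin k)
    (j : Fin (n i)) (x : K) : ContinuousLinearMap.adjoint (S i j) (Ω.symm x) =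
      Ω.symm (ContinuousLinearMap.adjoint (ρ (genW q m i j)) x) := by
  refine ext_inner_left ℂ fun y => ?_
  rw [ContinuousLinearMap.adjoint_inner_right, ← Ω.inner_map_map, ← Ω.inner_map_map y, hS,
    Ω.apply_symm_apply, Ω.apply_symm_apply, ContinuousLinearMap.adjoint_inner_right]

theorem isStarCyclic_of_cyclic (hS : ∀ i j x, Ω (S i j x) = ρ (genW q m i j) (Ω x))
    {H : Type*} [NormedAddCommGroup H] [InnerProductSpace ℂ H] {J : H →ₗᵢ[ℂ] K}
    (hcyc : (Submodule.span ℂ {x | ∃ X h, x = ρ X (J h)}).topologicalClosure = ⊤) :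
    IsStarCyclic S (LinearMap.range (Ω.symm.toLinearIsometry.comp J).toLinearMap) := by
  rw [IsStarCyclic, eq_top_iff]
  intro x _
  have hx : Ω x ∈ (Submodule.span ℂ {x | ∃ X h, x = ρ X (J h)}).topologicalClosure :=
    hcyc.symm ▸ Submodule.mem_top
  have h2 := map_mem_closure (f := Ω.symm) Ω.symm.continuous hx (t := (Submodule.span ℂ
    {x | ∃ Y ∈ cstarOf S, ∃ h ∈ LinearMap.range (Ω.symm.toLinearIsometry.comp J).toLinearMap,
      x = Y h} : Set L))
    (fun y hy => by
      have h3 := Submodule.mem_map_of_mem (f := Ω.symm.toLinearEquiv.toLinearMap) hy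
      rw [Submodule.map_span] at h3
      refine Submodule.span_mono ?_ h3
      rintro _ ⟨_, ⟨X, h, rfl⟩, rfl⟩
      obtain ⟨Y, hY, hYX⟩ := symm_apply_mem_cstarOf hS X
      refine ⟨Y, hY, Ω.symm (J h), ⟨h, rfl⟩, ?_⟩
      rw [hYX, Ω.apply_symm_apply]
      rfl)
  rw [Ω.symm_apply_apply] at h2
  exact h2

end Transport

set_option maxHeartbeats 1000000 in
theorem exists_dilation {H : Type u} [NormedAddCommGroup H] [InnerProductSpace ℂ H]
    [CompleteSpace H] (hm : ∀ i, 1 ≤ m i) {T : ∀ i, Fin (n i) → (H →L[ℂ] H)}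
    (hT : T ∈ polydomain q m H) :
    ∃ (K : Type u) (_ : NormedAddCommGroup K) (_ : InnerProductSpace ℂ K) (_ : CompleteSpace K)
        (π : CstarW q m →⋆ₐ[ℂ] (K →L[ℂ] K))
        (J : H →ₗᵢ[ℂ] WithLp 2 (HTensor (Fock n) ↥(defectSpace q m T) × K)),
        (TopologicalSpace.SeparableSpace H → TopologicalSpace.SeparableSpace K) ∧
        AnnihilatesCompacts ⇑π ∧
        defect q (fun _ => 1) (fun i j => π (genW q m i j)) 1 = 0 ∧
        IsStarCyclic (dilation q m ↥(defectSpace q m T) ⇑π) (LinearMap.range J.toLinearMap) ∧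
        (∀ i j, ∀ x ∈ LinearMap.range J.toLinearMap,
          ContinuousLinearMap.adjoint (dilation q m ↥(defectSpace q m T) ⇑π i j) x ∈
            LinearMap.range J.toLinearMap) ∧
        (∀ i j h, ContinuousLinearMap.adjoint (dilation q m ↥(defectSpace q m T) ⇑π i j) (J h) =
          J (ContinuousLinearMap.adjoint (T i j) h)) := by
  obtain ⟨K, _, _, _, ρ, J, hJ, hcyc⟩ := exists_cyclic_representation hm hT
  let ρ' : RepW q m K := ρ.toNonUnitalStarAlgHom
  have hρ : ∀ X, ρ' X = ρ X := fun X => rfl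
  have h1 : ρ' 1 = 1 := map_one ρ
  obtain ⟨ι, hι⟩ := exists_defectSpace_isometry (ρ := ρ') (J := J) hm hT (fun i j h => by
    rw [hρ, map_star]; exact hJ i j h) h1 hcyc
  -- The Wold decomposition of `ρ` with multiplicity space the defect space: `U` identifies the pure
  -- part with `W ⊗ I`, and the residual part serves as `π`.
  obtain ⟨U, -, hU⟩ := exists_wold_equiv hm h1 ι hι
  have h₁ := (invariantUnder_woldSpace hm h1).orthogonal
  let π := (residualRep ρ' h₁).toUnital (residualRep_one h1 h₁)
  obtain ⟨Ω, hΩ⟩ := exists_prod_equiv U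
  have hS : ∀ i j x, Ω (dilation q m (defectSpace q m T) ⇑π i j x) = ρ (genW q m i j) (Ω x) := by
    intro i j x
    obtain ⟨⟨z, y⟩, rfl⟩ := (WithLp.linearEquiv 2 ℂ _).symm.surjective x
    change Ω (WithLp.toLp 2 (ampliation (model q m i j) _ z, π (genW q m i j) y)) =
      ρ _ (Ω (WithLp.toLp 2 (z, y)))
    rw [hΩ, hΩ, map_add]
    congr 1
    exact hU (genW q m i j) z
  have hvac := residualRep_vacProj hm h1 h₁
  have hadj : ∀ i j h, ContinuousLinearMap.adjoint (dilation q m (defectSpace q m T) ⇑π i j)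
      (Ω.symm (J h)) = Ω.symm (J (ContinuousLinearMap.adjoint (T i j) h)) := by
    intro i j h
    rw [adjoint_apply_symm hS, hJ]
  refine ⟨↥(woldSpace ρ')ᗮ, inferInstance, inferInstance, inferInstance, π,
    Ω.symm.toLinearIsometry.comp J, ?_, annihilatesCompacts_of_vacProj hm _ hvac, ?_, ?_, ?_, hadj⟩
  · intro hs
    have := separableSpace_of_cyclic ρ J hcyc
    exact ((TopologicalSpace.isSeparable_univ_iff.2 this).mono (Set.subset_univ _)).separableSpace
  · refine (defect_repTuple (residualRep_one h1 h₁) _).trans ?_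
    exact map_defect_one_eq_zero_of_vacProj hm _ hvac
  · exact isStarCyclic_of_cyclic hS hcyc
  · rintro i j _ ⟨h, rfl⟩
    exact ⟨ContinuousLinearMap.adjoint (T i j) h, (hadj i j h).symm⟩

end DilationTheorem

end Polydomain

end

theorem mainTheorem12 {k : ℕ} (hk : 1 ≤ k) (n m : Fin k → ℕ) (hn : ∀ i, 1 ≤ n i)
    (hm : ∀ i, 1 ≤ m i) (q : ∀ i, PosRegPoly (n i)) :
    -- the dilation theorem
    (∀ (H : Type u) [NormedAddCommGroup H] [InnerProductSpace ℂ H] [CompleteSpace H]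
        (T : ∀ i, Fin (n i) → (H →L[ℂ] H)), T ∈ polydomain q m H →
      ∃ (K : Type u) (_ : NormedAddCommGroup K) (_ : InnerProductSpace ℂ K) (_ : CompleteSpace K)
        (π : CstarW q m →⋆ₐ[ℂ] (K →L[ℂ] K))
        (J : H →ₗᵢ[ℂ] WithLp 2 (HTensor (Fock n) ↥(defectSpace q m T) × K)),
        (TopologicalSpace.SeparableSpace H → TopologicalSpace.SeparableSpace K) ∧
        AnnihilatesCompacts ⇑π ∧
        defect q (fun _ => 1) (fun i j => π (genW q m i j)) 1 = 0 ∧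
        IsStarCyclic (dilation q m ↥(defectSpace q m T) ⇑π) (LinearMap.range J.toLinearMap) ∧
        (∀ i j, ∀ x ∈ LinearMap.range J.toLinearMap,
          ContinuousLinearMap.adjoint (dilation q m ↥(defectSpace q m T) ⇑π i j) x ∈
            LinearMap.range J.toLinearMap) ∧
        (∀ i j h, ContinuousLinearMap.adjoint (dilation q m ↥(defectSpace q m T) ⇑π i j) (J h) =
          J (ContinuousLinearMap.adjoint (T i j) h))) ∧
    -- the Wold decomposition
    (∀ (K : Type v) [NormedAddCommGroup K] [InnerProductSpace ℂ K] [CompleteSpace K]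
        [TopologicalSpace.SeparableSpace K] (π : RepW q m K),
      Nondegenerate π →
      ∃ (h₀ : InvariantUnder π (woldSpace π)) (h₁ : InvariantUnder π (woldSpace π)ᗮ),
        AreDisjoint (pureRep π h₀) (residualRep π h₁) ∧
        (∃ (G : Type v) (_ : NormedAddCommGroup G) (_ : InnerProductSpace ℂ G)
          (_ : CompleteSpace G),
          UnitarilyEquivalent ⇑(pureRep π h₀)
            (ampRep q m G) ∧
          hilbertDim G = hilbertDim ↥(LinearMap.range (repDefect π).toLinearMap)) ∧
        AnnihilatesCompacts ⇑(residualRep π h₁) ∧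
        defect q (fun _ => 1) (repTuple (residualRep π h₁)) 1 = 0) ∧
    -- the Wold decomposition classifies the representations
    (∀ (K : Type v) [NormedAddCommGroup K] [InnerProductSpace ℂ K] [CompleteSpace K]
        [TopologicalSpace.SeparableSpace K] (π : RepW q m K)
        (K' : Type w) [NormedAddCommGroup K'] [InnerProductSpace ℂ K'] [CompleteSpace K']
        [TopologicalSpace.SeparableSpace K'] (π' : RepW q m K'),
      Nondegenerate π → Nondegenerate π' →
      ∀ (h₀ : InvariantUnder π (woldSpace π)) (h₁ : InvariantUnder π (woldSpace π)ᗮ)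
        (h₀' : InvariantUnder π' (woldSpace π')) (h₁' : InvariantUnder π' (woldSpace π')ᗮ)
        (G : Type v) [NormedAddCommGroup G] [InnerProductSpace ℂ G] [CompleteSpace G]
        (G' : Type w) [NormedAddCommGroup G'] [InnerProductSpace ℂ G'] [CompleteSpace G'],
        UnitarilyEquivalent ⇑(pureRep π h₀)
          (ampRep q m G) →
        UnitarilyEquivalent ⇑(pureRep π' h₀')
          (ampRep q m G') →
        (UnitarilyEquivalent ⇑π ⇑π' ↔
          Cardinal.lift.{w} (hilbertDim G) = Cardinal.lift.{v} (hilbertDim G') ∧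
          UnitarilyEquivalent ⇑(residualRep π h₁)
            ⇑(residualRep π' h₁'))) := by
  refine ⟨fun H _ _ _ T hT => exists_dilation hm hT, ?_, ?_⟩
  · intro K _ _ _ _ π hπ
    have h1 := hπ.map_one
    have h₀ := invariantUnder_woldSpace hm h1
    have h₁ := h₀.orthogonal
    obtain ⟨hc, hu, ha, hd⟩ := woldDecomposition hm h1 h₀ h₁
    exact ⟨h₀, h₁, areDisjoint_pureRep_residualRep hm h1 h₀ h₁,
      ⟨LinearMap.range (repDefect π).toLinearMap, inferInstance, inferInstance, hc, hu, rfl⟩,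
      ha, hd⟩
  · intro K _ _ _ _ π K' _ _ _ _ π' hπ hπ' h₀ h₁ h₀' h₁' G _ _ _ G' _ _ _ hG hG'
    -- The multiplicity spaces live in different universes, hence the lifted dimensions.
    rw [lift_hilbertDim_eq_iff]
    exact unitarilyEquivalent_iff_of_ampRep hm hπ.map_one hπ'.map_one h₀ h₁ h₀' h₁' hG hG'
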